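/- Let $\mathbb F_q$ be a finite field with $q$ elements, let $C$ and $C'$ be smooth projective geometrically irreducible curves over $\mathbb F_q$, and let $\pi\colon C'\to C$ be a finite $\mathbb F_q$-morphism of degree $n$. Let $\infty\in C$ be a closed point above which there is exactly one point $\infty'\in C'$. Put $A=\Gamma(C\setminus\{\infty\},\mathcal O_C)$ and $A'=\Gamma(C'\setminus\{\infty'\},\mathcal O_{C'})$, and regard $A'$ as an $A$-algebra via $\pi^*$. Write $\mathrm{ord}_\infty$ for the normalized valuation at $\infty$ and $\deg(\infty)=[\kappa(\infty):\mathbb F_q]$, and similarly for $\infty'$. Drinfeld modules. Let $c\colon S\to\operatorname{Spec}A$ be a morphism of schemes and let $r\ge 1$ be an integer. A Drinfeld-$A$-module of rank $r$ and characteristic $c$ over $S$ is a pair $(E,\phi)$, where $E$ is a commutative group scheme over $S$ and $\phi\colon A\to\operatorname{End}_S(E)$ is a ring homomorphism, such that $S$ is covered by affine open subschemes $U=\operatorname{Spec}B$ for which there is an isomorphism $\psi\colon E_U\to\mathbb G_{a,U}$ of $U$-group schemes with the following property: for every $a\in A\setminus\{0\}$, $$\psi\circ\phi(a)\circ\psi^{-1}=\sum_{i\ge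 0}\delta_i(a)\,\tau^i\quad\text{(a finite sum, } \tau \text{ the } q\text{-th power Frobenius endomorphism of } \mathbb G_{a,U}\text{)}$$ with $\delta_i(a)\in B$ such that $\delta_0(a)=c^*(a)$, $\delta_i(a)\in B^\times$ for $i=d(a):=-r\,\mathrm{ord}_\infty(a)\deg(\infty)$, and $\delta_i(a)$ is nilpotent for $i>d(a)$. A morphism $(E,\phi)\to(\widetilde E,\widetilde\phi)$ is a homomorphism $\epsilon\colon E\to\widetilde E$ of $S$-group schemes with $\widetilde\phi(a)\circ\epsilon=\epsilon\circ\phi(a)$ for all $a\in A$. Drinfeld-$A'$-modules are defined in the same way from $C'$ and $\infty'$. Write $f^*(E,\phi)$ for the base change along $f\colon S'\to S$, and $\pi_*(E',\phi')=(E',\phi'\circ\pi^*)$ for restriction of coefficients from $A'$ to $A$. Let $r'\ge 1$, let $c\colon S\to\operatorname{Spec}A$ be a morphism of schemes (with $S$ arbitrary), and let $(E,\phi)$ be a Drinfeld-$A$-module of rank $nr'$ and characteristic $c$ over $S$. Let $\underline T$ be the contravariant functor from schemes over $\operatorname{Spec}A'\times_{\operatorname{Spec}A}S$ to sets which sends $(c',f)\colon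 S'\to\operatorname{Spec}A'\times_{\operatorname{Spec}A}S$ to the set of isomorphism classes of triples $(E',\phi',\alpha)$, where $(E',\phi')$ is a Drinfeld-$A'$-module of rank $r'$ and characteristic $c'$ over $S'$ and $\alpha\colon f^*(E,\phi)\to\pi_*(E',\phi')$ is an isomorphism; an isomorphism $(E'_1,\phi'_1,\alpha_1)\to(E'_2,\phi'_2,\alpha_2)$ is an isomorphism $\beta\colon(E'_1,\phi'_1)\to(E'_2,\phi'_2)$ with $\pi_*\beta\circ\alpha_1=\alpha_2$, and $\underline T$ acts on morphisms by pullback. Then $\underline T$ is representable by a scheme, and every scheme $T$ representing $\underline T$ is finite over $S$. -/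

import Mathlib

open CategoryTheory CategoryTheory.Limits AlgebraicGeometry Opposite

universe u

namespace DrinfeldRestriction

open scoped MonObj

section Pullback

variable {S S' S'' : Scheme.{u}}

/-- The projection `f^* Z = Z ×_S S' ⟶ Z`. -/
noncomputable def toBase (f : S' ⟶ S) (Z : Over S) : ((Over.pullback f).obj Z).left ⟶ Z.left :=
  pullback.fst Z.hom f

lemma toBase_comp_hom (f : S' ⟶ S) (Z : Over S) :
    toBase f Z ≫ Z.hom = ((Over.pullback f).obj Z).hom ≫ f :=
  pullback.condition

lemma pullback_hom_ext {f : S' ⟶ S} {Z : Over S} {T : Over S'}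
    {x y : T ⟶ (Over.pullback f).obj Z}
    (h : x.left ≫ toBase f Z = y.left ≫ toBase f Z) : x = y :=
  Over.OverMorphism.ext (pullback.hom_ext h ((Over.w x).trans (Over.w y).symm))

lemma pullback_pullback_hom_ext {u : S'' ⟶ S'} {f : S' ⟶ S} {Z : Over S} {T : Over S''}
    {x y : T ⟶ (Over.pullback u).obj ((Over.pullback f).obj Z)}
    (h : x.left ≫ toBase u _ ≫ toBase f Z = y.left ≫ toBase u _ ≫ toBase f Z) : x = y := by
  refine pullback_hom_ext (pullback.hom_ext ?_ ?_)
  · exact (Category.assoc _ _ _).trans (h.trans (Category.assoc _ _ _).symm)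
  · change (x.left ≫ toBase u _) ≫ ((Over.pullback f).obj Z).hom =
      (y.left ≫ toBase u _) ≫ ((Over.pullback f).obj Z).hom
    rw [Category.assoc, Category.assoc, toBase_comp_hom, ← Category.assoc, ← Category.assoc,
      Over.w, Over.w]

lemma map_left_toBase (f : S' ⟶ S) {Z W : Over S} (k : Z ⟶ W) :
    ((Over.pullback f).map k).left ≫ toBase f W = toBase f Z ≫ k.left :=
  pullback.lift_fst _ _ _

/-- The universal property of `f^* Z`. -/
noncomputable def liftBase (f : S' ⟶ S) (Z : Over S) (T : Over S') (p : T.left ⟶ Z.left)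
    (hp : p ≫ Z.hom = T.hom ≫ f) : T ⟶ (Over.pullback f).obj Z :=
  Over.homMk (pullback.lift p T.hom hp) (pullback.lift_snd _ _ _)

lemma liftBase_left_toBase (f : S' ⟶ S) (Z : Over S) (T : Over S') (p : T.left ⟶ Z.left)
    (hp : p ≫ Z.hom = T.hom ≫ f) : (liftBase f Z T p hp).left ≫ toBase f Z = p :=
  pullback.lift_fst _ _ _

/-- The canonical morphism `g^* Z ⟶ u^* f^* Z` for `g = u ≫ f`. -/
noncomputable def pullbackCompHom (u : S'' ⟶ S') (f : S' ⟶ S) (g : S'' ⟶ S) (h : u ≫ f = g)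
    (Z : Over S) : (Over.pullback g).obj Z ⟶ (Over.pullback u).obj ((Over.pullback f).obj Z) :=
  liftBase u _ _
    (liftBase f Z (Over.mk (((Over.pullback g).obj Z).hom ≫ u)) (toBase g Z)
      (by rw [toBase_comp_hom, ← h]; exact (Category.assoc _ _ _).symm)).left
    (Over.w _)

lemma pullbackCompHom_left (u : S'' ⟶ S') (f : S' ⟶ S) (g : S'' ⟶ S) (h : u ≫ f = g)
    (Z : Over S) : (pullbackCompHom u f g h Z).left ≫ toBase u _ ≫ toBase f Z = toBase g Z := by
  rw [← Category.assoc, pullbackCompHom, liftBase_left_toBase, liftBase_left_toBase]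

/-- The canonical morphism `u^* f^* Z ⟶ g^* Z` for `g = u ≫ f`. -/
noncomputable def pullbackCompInv (u : S'' ⟶ S') (f : S' ⟶ S) (g : S'' ⟶ S) (h : u ≫ f = g)
    (Z : Over S) : (Over.pullback u).obj ((Over.pullback f).obj Z) ⟶ (Over.pullback g).obj Z :=
  liftBase g Z _ (toBase u _ ≫ toBase f Z)
    (by rw [Category.assoc, toBase_comp_hom, ← Category.assoc, toBase_comp_hom, Category.assoc, h])

lemma pullbackCompInv_left (u : S'' ⟶ S') (f : S' ⟶ S) (g : S'' ⟶ S) (h : u ≫ f = g)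
    (Z : Over S) : (pullbackCompInv u f g h Z).left ≫ toBase g Z = toBase u _ ≫ toBase f Z :=
  liftBase_left_toBase _ _ _ _ _

lemma pullbackCompHom_naturality (u : S'' ⟶ S') (f : S' ⟶ S) (g : S'' ⟶ S) (h : u ≫ f = g)
    {Z W : Over S} (k : Z ⟶ W) :
    (Over.pullback g).map k ≫ pullbackCompHom u f g h W =
      pullbackCompHom u f g h Z ≫ (Over.pullback u).map ((Over.pullback f).map k) :=
  pullback_pullback_hom_ext (by
    rw [Over.comp_left, Over.comp_left, Category.assoc, Category.assoc, pullbackCompHom_left,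
      map_left_toBase, ← Category.assoc (Over.Hom.left ((Over.pullback u).map _)),
      map_left_toBase, Category.assoc, map_left_toBase, ← pullbackCompHom_left u f g h Z]
    simp only [Category.assoc])

lemma pullbackCompHom_id_left (u : S' ⟶ S') (hu : u = 𝟙 S') (f : S' ⟶ S) (h : u ≫ f = f)
    (Z : Over S) : (pullbackCompHom u f f h Z).left ≫ toBase u _ = 𝟙 _ := by
  refine pullback.hom_ext ?_ ?_
  · change (_ ≫ _) ≫ toBase f Z = 𝟙 _ ≫ toBase f Z
    rw [Category.assoc, pullbackCompHom_left, Category.id_comp]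
  · change (_ ≫ _) ≫ ((Over.pullback f).obj Z).hom = 𝟙 _ ≫ ((Over.pullback f).obj Z).hom
    rw [Category.assoc, toBase_comp_hom, ← Category.assoc, Over.w, hu, Category.comp_id,
      Category.id_comp]

lemma pullbackCompHom_assoc {S₃ : Scheme.{u}} (v : S₃ ⟶ S'') (u : S'' ⟶ S')
    (w : S₃ ⟶ S') (hw : v ≫ u = w) (f : S' ⟶ S) (g : S'' ⟶ S) (k : S₃ ⟶ S)
    (h : u ≫ f = g) (h' : v ≫ g = k) (h'' : w ≫ f = k) (Z : Over S) :
    pullbackCompHom w f k h'' Z ≫ pullbackCompHom v u w hw ((Over.pullback f).obj Z) =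
      pullbackCompHom v g k h' Z ≫ (Over.pullback v).map (pullbackCompHom u f g h Z) := by
  apply pullback_pullback_hom_ext
  rw [Over.comp_left, Over.comp_left, Category.assoc, Category.assoc, pullbackCompHom_left,
    ← Category.assoc (Over.Hom.left ((Over.pullback v).map _)), map_left_toBase, Category.assoc]
  refine pullback.hom_ext ?_ ?_
  · change (_ ≫ _) ≫ toBase f Z = (_ ≫ _ ≫ _ ≫ _) ≫ toBase f Z
    simp only [Category.assoc]
    rw [pullbackCompHom_left, pullbackCompHom_left, pullbackCompHom_left]
  · change (_ ≫ _) ≫ ((Over.pullback f).obj Z).hom =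
      (_ ≫ _ ≫ _ ≫ _) ≫ ((Over.pullback f).obj Z).hom
    simp only [Category.assoc]
    rw [toBase_comp_hom, toBase_comp_hom, ← Category.assoc, Over.w,
      ← Category.assoc (Over.Hom.left (pullbackCompHom u f g h Z)), Over.w,
      ← Category.assoc (toBase v _), toBase_comp_hom, Category.assoc, hw,
      ← Category.assoc, Over.w]

/-- The canonical isomorphism `g^* ≅ u^* f^*` for `g = u ≫ f`. -/
noncomputable def pullbackCompIso (u : S'' ⟶ S') (f : S' ⟶ S) (g : S'' ⟶ S) (h : u ≫ f = g) :
    Over.pullback g ≅ Over.pullback f ⋙ Over.pullback u :=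
  NatIso.ofComponents (fun Z =>
    { hom := pullbackCompHom u f g h Z
      inv := pullbackCompInv u f g h Z
      hom_inv_id := pullback_hom_ext (by
        rw [Over.comp_left, Category.assoc, pullbackCompInv_left, pullbackCompHom_left,
          Over.id_left, Category.id_comp])
      inv_hom_id := pullback_pullback_hom_ext (by
        rw [Over.comp_left, Category.assoc, pullbackCompHom_left, pullbackCompInv_left,
          Over.id_left]
        exact (Category.id_comp _).symm) })
    (fun k => pullbackCompHom_naturality u f g h k)

/-- The canonical isomorphism `u^* ≅ id` for `u = 𝟙 S`. -/
noncomputable def pullbackIdIso (u : S ⟶ S) (h : u = 𝟙 S) : Over.pullback u ≅ 𝟭 (Over S) :=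
  NatIso.ofComponents (fun Z =>
    { hom := Over.homMk (toBase u Z)
        ((toBase_comp_hom u Z).trans (by rw [h]; exact Category.comp_id _))
      inv := liftBase u Z Z (𝟙 _) (by rw [h, Category.comp_id, Category.id_comp])
      hom_inv_id := pullback_hom_ext (by
        rw [Over.comp_left, Category.assoc, liftBase_left_toBase, Over.id_left, Category.id_comp]
        exact Category.comp_id _)
      inv_hom_id := Over.OverMorphism.ext (liftBase_left_toBase _ _ _ _ _) })
    (fun k => Over.OverMorphism.ext (map_left_toBase u k))

/-- Base change `E ↦ f^* E` of commutative group schemes. -/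
noncomputable abbrev groupPullback (f : S' ⟶ S) : CommGrp (Over S) ⥤ CommGrp (Over S') :=
  (Over.pullback f).mapCommGrp

/-- `g^* E ≅ u^* f^* E` as group schemes, for `g = u ≫ f`. -/
noncomputable def groupPullbackComp (u : S'' ⟶ S') (f : S' ⟶ S) (g : S'' ⟶ S) (h : u ≫ f = g) :
    groupPullback g ≅ groupPullback f ⋙ groupPullback u :=
  Functor.mapCommGrpNatIso (pullbackCompIso u f g h) ≪≫ Functor.mapCommGrpCompIso

lemma groupPullbackComp_hom (u : S'' ⟶ S') (f : S' ⟶ S) (g : S'' ⟶ S) (h : u ≫ f = g)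
    (E : CommGrp (Over S)) :
    ((groupPullbackComp u f g h).hom.app E).hom.hom.hom = pullbackCompHom u f g h E.X := by
  rw [groupPullbackComp, Iso.trans_hom, NatTrans.comp_app, CommGrp.comp_hom, Grp.comp_hom_hom,
    Functor.mapCommGrpNatIso_hom_app_hom_hom_hom, Functor.mapCommGrpCompIso_hom_app_hom_hom_hom]
  exact Category.comp_id (pullbackCompHom u f g h E.X)

/-- `u^* E ≅ E` as group schemes, for `u = 𝟙 S`. -/
noncomputable def groupPullbackId (u : S ⟶ S) (h : u = 𝟙 S) :
    groupPullback u ≅ 𝟭 (CommGrp (Over S)) :=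
  Functor.mapCommGrpNatIso (pullbackIdIso u h) ≪≫ Functor.mapCommGrpIdIso

lemma groupPullbackId_hom (u : S ⟶ S) (h : u = 𝟙 S) (E : CommGrp (Over S)) :
    ((groupPullbackId u h).hom.app E).hom.hom.hom.left = toBase u E.X := by
  rw [groupPullbackId, Iso.trans_hom, NatTrans.comp_app, CommGrp.comp_hom, Grp.comp_hom_hom,
    Functor.mapCommGrpNatIso_hom_app_hom_hom_hom, Functor.mapCommGrpIdIso_hom_app_hom_hom_hom]
  exact Category.comp_id (toBase u E.X)

end Pullback

/-- The morphism of `S`-schemes underlying a homomorphism of commutative `S`-group schemes. -/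
noncomputable def toSchemeHom {S : Scheme.{u}} {E E' : CommGrp (Over S)} (k : E ⟶ E') :
    E.X ⟶ E'.X :=
  k.hom.hom.hom

/-- `φ : A → End_S(E)` is a ring homomorphism. Here `E` is a commutative group scheme over `S`, the
product in `End_S(E)` is composition (written in diagrammatic order by `≫`) and the sum of two
endomorphisms is their product in the group `E(E)` of `E`-valued points of `E`. -/
structure IsAction {A : CommRingCat.{u}} {S : Scheme.{u}} (E : CommGrp (Over S))
    (φ : A → (E ⟶ E)) : Prop where
  map_one : φ 1 = 𝟙 E
  map_mul : ∀ a b : A, φ (a * b) = φ b ≫ φ a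
  map_add : ∀ a b : A, toSchemeHom (φ (a + b)) = toSchemeHom (φ a) * toSchemeHom (φ b)

/-- A pair `(E, φ)` of a commutative group scheme `E` over `S` and a ring homomorphism
`φ : A → End_S(E)`. -/
structure ModuleScheme (A : CommRingCat.{u}) (S : Scheme.{u}) where
  E : CommGrp (Over S)
  φ : A → (E ⟶ E)
  isAction : IsAction E φ

namespace ModuleScheme

variable {A A' : CommRingCat.{u}} {S S' S'' : Scheme.{u}}

/-- Morphisms `(E, φ) ⟶ (F, χ)`: homomorphisms `ε : E ⟶ F` of group schemes with
`χ(a) ∘ ε = ε ∘ φ(a)` for all `a`. -/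
@[ext]
structure Hom (M N : ModuleScheme A S) where
  hom : M.E ⟶ N.E
  comm : ∀ a : A, M.φ a ≫ hom = hom ≫ N.φ a

noncomputable instance : Category (ModuleScheme A S) where
  Hom := Hom
  id M := ⟨𝟙 M.E, fun a => by rw [Category.comp_id, Category.id_comp]⟩
  comp f g := ⟨f.hom ≫ g.hom, fun a => by
    rw [← Category.assoc, f.comm, Category.assoc, g.comm, Category.assoc]⟩
  id_comp f := Hom.ext (Category.id_comp _)
  comp_id f := Hom.ext (Category.comp_id _)
  assoc f g h := Hom.ext (Category.assoc _ _ _)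

lemma hom_ext' {M N : ModuleScheme A S} {f g : M ⟶ N}
    (h : f.hom.hom.hom.hom = g.hom.hom.hom.hom) : f = g :=
  Hom.ext (CommGrp.hom_ext _ _ h)

/-- The underlying morphism of `S`-schemes. -/
noncomputable def und {M N : ModuleScheme A S} (f : M ⟶ N) : M.E.X ⟶ N.E.X := toSchemeHom f.hom

/-- Isomorphisms of `A`-module schemes -/
noncomputable def mkIso {M N : ModuleScheme A S} (e : M.E ≅ N.E)
    (h : ∀ a : A, M.φ a ≫ e.hom = e.hom ≫ N.φ a) : M ≅ N where
  hom := ⟨e.hom, h⟩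
  inv := ⟨e.inv, fun a => by rw [Iso.eq_inv_comp, ← Category.assoc, ← h, Category.assoc,
    Iso.hom_inv_id, Category.comp_id]⟩
  hom_inv_id := Hom.ext e.hom_inv_id
  inv_hom_id := Hom.ext e.inv_hom_id

lemma und_ext {M N : ModuleScheme A S} {f g : M ⟶ N} (h : und f = und g) : f = g := hom_ext' h

lemma und_comp {M N P : ModuleScheme A S} (f : M ⟶ N) (g : N ⟶ P) :
    und (f ≫ g) = und f ≫ und g := rfl

/-- Base change `(E, φ) ↦ (f^* E, f^* φ)`. -/
noncomputable def baseChange (f : S' ⟶ S) : ModuleScheme A S ⥤ ModuleScheme A S' where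
  obj M :=
    { E := (groupPullback f).obj M.E
      φ := fun a => (groupPullback f).map (M.φ a)
      isAction :=
        { map_one := by rw [M.isAction.map_one, CategoryTheory.Functor.map_id]
          map_mul := fun a b => by rw [M.isAction.map_mul, CategoryTheory.Functor.map_comp]
          map_add := fun a b => by
            have := (Over.pullback f).map_mul (toSchemeHom (M.φ a)) (toSchemeHom (M.φ b))
            rw [← M.isAction.map_add] at this
            exact this } }
  map e := ⟨(groupPullback f).map e.hom, fun a => by
    rw [← Functor.map_comp, e.comm, Functor.map_comp]⟩
  map_id M := Hom.ext ((groupPullback f).map_id M.E)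
  map_comp e e' := Hom.ext ((groupPullback f).map_comp e.hom e'.hom)

lemma und_baseChange (f : S' ⟶ S) {M N : ModuleScheme A S} (e : M ⟶ N) :
    und ((baseChange f).map e) = (Over.pullback f).map (und e) := rfl

/-- Restriction of coefficients `(E, φ) ↦ (E, φ ∘ ρ)` along a ring homomorphism `ρ : A ⟶ A'`. -/
noncomputable def restrictScalars (ρ : A ⟶ A') : ModuleScheme A' S ⥤ ModuleScheme A S where
  obj M :=
    { E := M.E
      φ := fun a => M.φ (ρ.hom a)
      isAction :=
        { map_one := by rw [map_one, M.isAction.map_one]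
          map_mul := fun a b => by rw [map_mul, M.isAction.map_mul]
          map_add := fun a b => by rw [map_add, M.isAction.map_add] } }
  map e := ⟨e.hom, fun a => e.comm (ρ.hom a)⟩

lemma restrict_refl {ρ : A ⟶ A'} {P : ModuleScheme A S} {N : ModuleScheme A' S}
    (a : P ⟶ (restrictScalars ρ).obj N) :
    a ≫ (restrictScalars ρ).map (Iso.refl N).hom = a :=
  und_ext (Category.comp_id (und a))

lemma restrict_symm {ρ : A ⟶ A'} {P : ModuleScheme A S} {N₁ N₂ : ModuleScheme A' S}
    {a₁ : P ⟶ (restrictScalars ρ).obj N₁} {a₂ : P ⟶ (restrictScalars ρ).obj N₂} {β : N₁ ≅ N₂}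
    (h : a₁ ≫ (restrictScalars ρ).map β.hom = a₂) :
    a₂ ≫ (restrictScalars ρ).map β.symm.hom = a₁ := by
  rw [← h, Category.assoc, ← Functor.map_comp, Iso.symm_hom, Iso.hom_inv_id]
  exact restrict_refl a₁

lemma restrict_trans {ρ : A ⟶ A'} {P : ModuleScheme A S} {N₁ N₂ N₃ : ModuleScheme A' S}
    {a₁ : P ⟶ (restrictScalars ρ).obj N₁} {a₂ : P ⟶ (restrictScalars ρ).obj N₂}
    {a₃ : P ⟶ (restrictScalars ρ).obj N₃} {β : N₁ ≅ N₂} {β' : N₂ ≅ N₃}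
    (h : a₁ ≫ (restrictScalars ρ).map β.hom = a₂) (h' : a₂ ≫ (restrictScalars ρ).map β'.hom = a₃) :
    a₁ ≫ (restrictScalars ρ).map (β ≪≫ β').hom = a₃ := by
  rw [← h', ← h, Category.assoc, ← Functor.map_comp, Iso.trans_hom]

lemma und_restrictScalars (ρ : A ⟶ A') {M N : ModuleScheme A' S} (e : M ⟶ N) :
    und ((restrictScalars ρ).map e) = und e := rfl

/-- `g^* M ≅ u^* f^* M` for `g = u ≫ f`. -/
noncomputable def baseChangeComp (u : S'' ⟶ S') (f : S' ⟶ S) (g : S'' ⟶ S) (h : u ≫ f = g)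
    (M : ModuleScheme A S) :
    (baseChange g).obj M ≅ (baseChange u).obj ((baseChange f).obj M) :=
  mkIso ((groupPullbackComp u f g h).app M.E)
    (fun a => (groupPullbackComp u f g h).hom.naturality (M.φ a))

lemma und_baseChangeComp (u : S'' ⟶ S') (f : S' ⟶ S) (g : S'' ⟶ S) (h : u ≫ f = g)
    (M : ModuleScheme A S) :
    und (baseChangeComp u f g h M).hom = pullbackCompHom u f g h M.E.X :=
  groupPullbackComp_hom u f g h M.E

/-- `u^* M ≅ M` for `u = 𝟙 S`. -/
noncomputable def baseChangeId (u : S ⟶ S) (h : u = 𝟙 S) (M : ModuleScheme A S) :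
    (baseChange u).obj M ≅ M :=
  mkIso ((groupPullbackId u h).app M.E)
    (fun a => (groupPullbackId u h).hom.naturality (M.φ a))

lemma und_baseChangeId (u : S ⟶ S) (h : u = 𝟙 S) (M : ModuleScheme A S) :
    (und (baseChangeId u h M).hom).left = toBase u M.E.X :=
  groupPullbackId_hom u h M.E

/-- `(f^* N)|_A = f^* (N|_A)`. -/
noncomputable def baseChangeRestrict (ρ : A ⟶ A') (f : S' ⟶ S) (N : ModuleScheme A' S) :
    (baseChange f).obj ((restrictScalars ρ).obj N) ≅ (restrictScalars ρ).obj ((baseChange f).obj N) :=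
  mkIso (Iso.refl _) (fun _ => (Category.comp_id _).trans (Category.id_comp _).symm)

lemma und_baseChangeRestrict (ρ : A ⟶ A') (f : S' ⟶ S) (N : ModuleScheme A' S) :
    und (baseChangeRestrict ρ f N).hom = 𝟙 _ := rfl

lemma baseChangeRestrict_naturality (ρ : A ⟶ A') (f : S' ⟶ S) {N₁ N₂ : ModuleScheme A' S}
    (β : N₁ ⟶ N₂) :
    (baseChange f).map ((restrictScalars ρ).map β) ≫ (baseChangeRestrict ρ f N₂).hom =
      (baseChangeRestrict ρ f N₁).hom ≫ (restrictScalars ρ).map ((baseChange f).map β) :=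
  und_ext ((Category.comp_id ((Over.pullback f).map (und β))).trans
    (Category.id_comp ((Over.pullback f).map (und β))).symm)

/-- The isomorphism `g^* M ≅ u^* f^* M ≅ u^* (N|_A) = (u^* N)|_A` induced by `α : f^* M ≅ N|_A`,
for `g = u ≫ f`. -/
noncomputable def pullbackIso {ρ : A ⟶ A'} (u : S'' ⟶ S') (f : S' ⟶ S) (g : S'' ⟶ S)
    (h : u ≫ f = g) {M : ModuleScheme A S} {N : ModuleScheme A' S'}
    (α : (baseChange f).obj M ≅ (restrictScalars ρ).obj N) :
    (baseChange g).obj M ≅ (restrictScalars ρ).obj ((baseChange u).obj N) :=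
  baseChangeComp u f g h M ≪≫ (baseChange u).mapIso α ≪≫ baseChangeRestrict ρ u N

lemma und_pullbackIso {ρ : A ⟶ A'} (u : S'' ⟶ S') (f : S' ⟶ S) (g : S'' ⟶ S)
    (h : u ≫ f = g) {M : ModuleScheme A S} {N : ModuleScheme A' S'}
    (α : (baseChange f).obj M ≅ (restrictScalars ρ).obj N) :
    und (pullbackIso u f g h α).hom =
      pullbackCompHom u f g h M.E.X ≫ (Over.pullback u).map (und α.hom) := by
  rw [pullbackIso, Iso.trans_hom, und_comp, Iso.trans_hom, und_comp, und_baseChangeComp,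
    und_baseChangeRestrict, Functor.mapIso_hom, und_baseChange]
  exact congrArg (_ ≫ ·) (Category.comp_id ((Over.pullback u).map (und α.hom)))

lemma pullbackHom_comp {ρ : A ⟶ A'} (u : S'' ⟶ S') (f : S' ⟶ S) (g : S'' ⟶ S)
    (h : u ≫ f = g) {M : ModuleScheme A S} {N₁ N₂ : ModuleScheme A' S'}
    {α₁ : (baseChange f).obj M ≅ (restrictScalars ρ).obj N₁}
    {α₂ : (baseChange f).obj M ≅ (restrictScalars ρ).obj N₂} {β : N₁ ≅ N₂}
    (h' : α₁.hom ≫ (restrictScalars ρ).map β.hom = α₂.hom) :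
    (pullbackIso u f g h α₁).hom ≫ (restrictScalars ρ).map ((baseChange u).mapIso β).hom =
      (pullbackIso u f g h α₂).hom := by
  rw [pullbackIso, pullbackIso, Iso.trans_hom, Iso.trans_hom, Iso.trans_hom, Iso.trans_hom,
    Category.assoc, Category.assoc, Functor.mapIso_hom, Functor.mapIso_hom, Functor.mapIso_hom,
    ← baseChangeRestrict_naturality, ← h', Functor.map_comp, Category.assoc]

lemma pullbackHom_id {ρ : A ⟶ A'} (u : S' ⟶ S') (hu : u = 𝟙 S') (f : S' ⟶ S)
    (h : u ≫ f = f) {M : ModuleScheme A S} {N : ModuleScheme A' S'}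
    (α : (baseChange f).obj M ≅ (restrictScalars ρ).obj N) :
    (pullbackIso u f f h α).hom ≫ (restrictScalars ρ).map (baseChangeId u hu N).hom = α.hom := by
  apply und_ext
  rw [und_comp, und_pullbackIso, und_restrictScalars]
  apply Over.OverMorphism.ext
  have e₁ := und_baseChangeId u hu N
  have e₂ := pullbackCompHom_id_left u hu f h M.E.X
  have e₃ := map_left_toBase u (und α.hom)
  refine (congrArg (((pullbackCompHom u f f h M.E.X).left ≫
    ((Over.pullback u).map (und α.hom)).left) ≫ ·) e₁).trans ?_
  refine (Category.assoc _ _ _).trans ?_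
  refine (congrArg (_ ≫ ·) e₃).trans ?_
  refine (Category.assoc _ _ _).symm.trans ?_
  exact (congrArg (· ≫ _) e₂).trans (Category.id_comp _)

lemma pullbackHom_pullbackHom {S₃ : Scheme.{u}} {ρ : A ⟶ A'} (v : S₃ ⟶ S'') (u : S'' ⟶ S')
    (w : S₃ ⟶ S') (hw : v ≫ u = w) (f : S' ⟶ S) (g : S'' ⟶ S) (k : S₃ ⟶ S)
    (h : u ≫ f = g) (h' : v ≫ g = k) (h'' : w ≫ f = k)
    {M : ModuleScheme A S} {N : ModuleScheme A' S'}
    (α : (baseChange f).obj M ≅ (restrictScalars ρ).obj N) :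
    (pullbackIso w f k h'' α).hom ≫ (restrictScalars ρ).map (baseChangeComp v u w hw N).hom =
      (pullbackIso v g k h' (pullbackIso u f g h α)).hom := by
  apply und_ext
  rw [und_comp, und_pullbackIso, und_restrictScalars, und_baseChangeComp, und_pullbackIso,
    und_pullbackIso]
  refine (Category.assoc (pullbackCompHom w f k h'' M.E.X) ((Over.pullback w).map (und α.hom))
    (pullbackCompHom v u w hw N.E.X)).trans ?_
  refine (congrArg (pullbackCompHom w f k h'' M.E.X ≫ ·)
    (pullbackCompHom_naturality v u w hw (und α.hom))).trans ?_
  refine (Category.assoc _ _ _).symm.trans ?_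
  refine (congrArg (· ≫ _) (pullbackCompHom_assoc v u w hw f g k h h' h'' M.E.X)).trans ?_
  refine (Category.assoc _ _ _).trans ?_
  exact congrArg (pullbackCompHom v g k h' M.E.X ≫ ·)
    ((Over.pullback v).map_comp (pullbackCompHom u f g h M.E.X)
      ((Over.pullback u).map (und α.hom))).symm

end ModuleScheme

/-- An isomorphism `ψ : E_U ≅ 𝔾_{a,U}` of group schemes over the open subscheme `U` of `S`, given on
points: for all `S`-schemes `T` whose structure morphism factors through `U` (these are
the `U`-schemes), an isomorphism `E(T) ≅ Γ(T, 𝒪_T) = 𝔾_a(T)` of groups, natural in `T`. -/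
structure AdditiveCoordinate {S : Scheme.{u}} (E : CommGrp (Over S)) (U : S.Opens) where
  equiv : ∀ T : Over S, ⊤ ≤ T.hom ⁻¹ᵁ U → ((T ⟶ E.X) ≃ Γ(T.left, ⊤))
  map_mul : ∀ (T : Over S) (hT : ⊤ ≤ T.hom ⁻¹ᵁ U) (x y : T ⟶ E.X),
    equiv T hT (x * y) = equiv T hT x + equiv T hT y
  naturality : ∀ (T T' : Over S) (hT : ⊤ ≤ T.hom ⁻¹ᵁ U) (hT' : ⊤ ≤ T'.hom ⁻¹ᵁ U)
    (g : T' ⟶ T) (x : T ⟶ E.X),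
    equiv T' hT' (g ≫ x) = g.left.appTop.hom (equiv T hT x)

/-- The function `c^*(a)` on the open subscheme `U`. -/
noncomputable def pullbackScalar {A : CommRingCat.{u}} {S : Scheme.{u}} (c : S ⟶ Spec A)
    (U : S.Opens) (a : A) :
    Γ(S, U) :=
  (c.appLE ⊤ U le_top).hom ((Scheme.ΓSpecIso A).inv.hom a)

/-- For every nonzero `a`, the endomorphism `ψ ∘ φ(a) ∘ ψ⁻¹` of `𝔾_{a,U}` is `∑ i, δ_i τ^i` with
`τ` the `q`-th power Frobenius, where `δ_0 = c^*(a)`, where `δ_i` is a unit for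
`i = d(a)`, and where `δ_i` is nilpotent for `i > d(a)`. -/
def AdditiveCoordinate.IsDrinfeld {A : CommRingCat.{u}} {S : Scheme.{u}}
    {M : ModuleScheme A S} {U : S.Opens} (ψ : AdditiveCoordinate M.E U)
    (q : ℕ) (d : A → ℤ) (c : S ⟶ Spec A) : Prop :=
  ∀ a : A, a ≠ 0 → ∃ δ : ℕ →₀ Γ(S, U),
    (∀ (T : Over S) (hT : ⊤ ≤ T.hom ⁻¹ᵁ U) (x : T ⟶ M.E.X),
      ψ.equiv T hT (x ≫ toSchemeHom (M.φ a)) =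
        δ.sum fun i b => (T.hom.appLE U ⊤ hT).hom b * ψ.equiv T hT x ^ q ^ i) ∧
    δ 0 = pullbackScalar c U a ∧
    (∀ i : ℕ, (i : ℤ) = d a → IsUnit (δ i)) ∧
    (∀ i : ℕ, d a < (i : ℤ) → IsNilpotent (δ i))

/-- `M = (E, φ)` is a Drinfeld module of characteristic `c` with degree function `d`, where for rank
`r` one takes `d(a) = - r ord_∞(a) deg(∞)`: locally on `S` there is an isomorphism of `E`
with `𝔾_a` through which each nonzero `a` acts by a polynomial in `τ` as above. -/
def ModuleScheme.IsDrinfeld {A : CommRingCat.{u}} {S : Scheme.{u}} (M : ModuleScheme A S)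
    (q : ℕ) (d : A → ℤ) (c : S ⟶ Spec A) : Prop :=
  ∀ s : S, ∃ U : S.Opens, s ∈ U ∧ IsAffineOpen U ∧
    ∃ ψ : AdditiveCoordinate M.E U, ψ.IsDrinfeld q d c

section BaseChange

variable {S S' : Scheme.{u}}

lemma le_preimage {f : S' ⟶ S} {U : S.Opens} {U' : S'.Opens} (hU : U' ≤ f ⁻¹ᵁ U)
    {T : Over S'} (hT : ⊤ ≤ T.hom ⁻¹ᵁ U') : ⊤ ≤ ((Over.map f).obj T).hom ⁻¹ᵁ U :=
  fun _ hx => hU (hT hx)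

/-- `T`-valued points of `f^* E` are points of `E` with values in `T` considered over `S`. -/
noncomputable def pointsEquiv (f : S' ⟶ S) (E : CommGrp (Over S)) (T : Over S') :
    (T ⟶ ((groupPullback f).obj E).X) ≃ ((Over.map f).obj T ⟶ E.X) :=
  ((Over.mapPullbackAdj f).homEquiv T E.X).symm

open scoped CategoryTheory.Obj in
lemma pointsEquiv_symm_mul (f : S' ⟶ S) (E : CommGrp (Over S)) (T : Over S')
    (x y : (Over.map f).obj T ⟶ E.X) :
    (pointsEquiv f E T).symm (x * y) = (pointsEquiv f E T).symm x * (pointsEquiv f E T).symm y := by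
  change (Over.mapPullbackAdj f).homEquiv T E.X (x * y) = _
  refine ((Over.mapPullbackAdj f).homEquiv_unit _ _ _).trans ?_
  refine (congrArg (_ ≫ ·) ((Over.pullback f).map_mul x y)).trans ?_
  refine (MonObj.comp_mul _ _ _).trans ?_
  exact congrArg₂ (· * ·) ((Over.mapPullbackAdj f).homEquiv_unit _ _ _).symm
    ((Over.mapPullbackAdj f).homEquiv_unit _ _ _).symm

lemma pointsEquiv_mul (f : S' ⟶ S) (E : CommGrp (Over S)) (T : Over S')
    (x y : T ⟶ ((groupPullback f).obj E).X) :
    pointsEquiv f E T (x * y) = pointsEquiv f E T x * pointsEquiv f E T y := by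
  rw [← Equiv.eq_symm_apply, pointsEquiv_symm_mul, Equiv.symm_apply_apply, Equiv.symm_apply_apply]

lemma pointsEquiv_comp (f : S' ⟶ S) (E : CommGrp (Over S)) {T T' : Over S'} (g : T' ⟶ T)
    (x : T ⟶ ((groupPullback f).obj E).X) :
    pointsEquiv f E T' (g ≫ x) = (Over.map f).map g ≫ pointsEquiv f E T x :=
  (Over.mapPullbackAdj f).homEquiv_naturality_left_symm g x

lemma pointsEquiv_comp_map (f : S' ⟶ S) {E E' : CommGrp (Over S)} (k : E ⟶ E') {T : Over S'}
    (x : T ⟶ ((groupPullback f).obj E).X) :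
    pointsEquiv f E' T (x ≫ toSchemeHom ((groupPullback f).map k)) =
      pointsEquiv f E T x ≫ toSchemeHom k :=
  (Over.mapPullbackAdj f).homEquiv_naturality_right_symm x (toSchemeHom k)

/-- The coordinate on `f^* E` induced by a coordinate on `E`. -/
noncomputable def AdditiveCoordinate.baseChange {E : CommGrp (Over S)} {U : S.Opens}
    (ψ : AdditiveCoordinate E U) (f : S' ⟶ S) (U' : S'.Opens) (hU : U' ≤ f ⁻¹ᵁ U) :
    AdditiveCoordinate ((groupPullback f).obj E) U' where
  equiv T hT := (pointsEquiv f E T).trans (ψ.equiv ((Over.map f).obj T) (le_preimage hU hT))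
  map_mul T hT x y :=
    (congrArg (ψ.equiv ((Over.map f).obj T) (le_preimage hU hT)) (pointsEquiv_mul f E T x y)).trans
      (ψ.map_mul _ _ _ _)
  naturality _ T' _ hT' g x :=
    (congrArg (ψ.equiv ((Over.map f).obj T') (le_preimage hU hT')) (pointsEquiv_comp f E g x)).trans
      (ψ.naturality _ _ _ _ _ _)

lemma AdditiveCoordinate.IsDrinfeld.baseChange {A : CommRingCat.{u}}
    {M : ModuleScheme A S} {U : S.Opens} {ψ : AdditiveCoordinate M.E U}
    {q : ℕ} {d : A → ℤ} {c : S ⟶ Spec A} (h : ψ.IsDrinfeld q d c)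
    (f : S' ⟶ S) (U' : S'.Opens) (hU : U' ≤ f ⁻¹ᵁ U) :
    AdditiveCoordinate.IsDrinfeld (M := (ModuleScheme.baseChange f).obj M)
      (ψ.baseChange f U' hU) q d (f ≫ c) := by
  intro a ha
  obtain ⟨δ, h1, h2, h3, h4⟩ := h a ha
  refine ⟨δ.mapRange (f.appLE U U' hU).hom (map_zero _), fun T hT x => ?_, ?_, fun i hi => ?_,
    fun i hi => ?_⟩
  · refine (congrArg (ψ.equiv ((Over.map f).obj T) (le_preimage hU hT))
      (pointsEquiv_comp_map f (M.φ a) x)).trans ?_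
    rw [Finsupp.sum_mapRange_index (fun i => by rw [map_zero, zero_mul])]
    refine (h1 _ _ _).trans ?_
    refine Finset.sum_congr rfl fun i _ => ?_
    refine congrArg (· * _) ?_
    have := Scheme.Hom.appLE_comp_appLE T.hom f U U' ⊤ hU hT
    exact (ConcreteCategory.congr_hom this (δ i)).symm
  · rw [Finsupp.mapRange_apply, h2]
    have := Scheme.Hom.appLE_comp_appLE f c ⊤ U U' le_top hU
    exact ConcreteCategory.congr_hom this _
  · rw [Finsupp.mapRange_apply]; exact (h3 i hi).map _
  · rw [Finsupp.mapRange_apply]; exact (h4 i hi).map _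

lemma ModuleScheme.IsDrinfeld.baseChange {A : CommRingCat.{u}}
    {M : ModuleScheme A S} {q : ℕ} {d : A → ℤ} {c : S ⟶ Spec A} (h : M.IsDrinfeld q d c)
    (f : S' ⟶ S) (c' : S' ⟶ Spec A) (hc : f ≫ c = c') :
    ((ModuleScheme.baseChange f).obj M).IsDrinfeld q d c' := by
  subst hc
  intro s
  obtain ⟨U, hs, -, ψ, hψ⟩ := h (f s)
  obtain ⟨U', hU', hs', hle⟩ := exists_isAffineOpen_mem_and_subset (U := f ⁻¹ᵁ U) hs
  exact ⟨U', hs', hU', ψ.baseChange f U' hle, hψ.baseChange f U' hle⟩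

end BaseChange

section Functor

/-- The data `(E', φ', α)` over an `S`-scheme `f : X ⟶ S` equipped with `c' : X ⟶ Spec A'`:
an `A'`-module scheme `N = (E', φ')` over `X` which is a Drinfeld module of characteristic `c'` and
degree function `d'`, and an isomorphism `α` of `A`-module schemes from `f^* M` to `N`
with scalars restricted along `ρ : A ⟶ A'`. -/
structure Triple {A A' : CommRingCat.{u}} (ρ : A ⟶ A') (q : ℕ) (d' : A' → ℤ)
    {S : Scheme.{u}} (M : ModuleScheme A S) {X : Scheme.{u}} (c' : X ⟶ Spec A') (f : X ⟶ S) where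
  N : ModuleScheme A' X
  isDrinfeld : N.IsDrinfeld q d' c'
  α : (ModuleScheme.baseChange f).obj M ≅ (ModuleScheme.restrictScalars ρ).obj N

namespace Triple

variable {A A' : CommRingCat.{u}} {ρ : A ⟶ A'} {q : ℕ} {d' : A' → ℤ}
  {S : Scheme.{u}} {M : ModuleScheme A S} {X Y Z : Scheme.{u}}
  {c' : X ⟶ Spec A'} {f : X ⟶ S} {cY : Y ⟶ Spec A'} {fY : Y ⟶ S} {cZ : Z ⟶ Spec A'} {fZ : Z ⟶ S}

/-- Two triples are isomorphic if there is an isomorphism `β : N₁ ≅ N₂` of `A'`-module schemes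
with `β ∘ α₁ = α₂`. -/
def Rel (t₁ t₂ : Triple ρ q d' M c' f) : Prop :=
  ∃ β : t₁.N ≅ t₂.N, t₁.α.hom ≫ (ModuleScheme.restrictScalars ρ).map β.hom = t₂.α.hom

lemma rel_refl (t : Triple ρ q d' M c' f) : Rel t t :=
  ⟨Iso.refl _, ModuleScheme.restrict_refl _⟩

lemma rel_symm {t₁ t₂ : Triple ρ q d' M c' f} (h : Rel t₁ t₂) : Rel t₂ t₁ := by
  obtain ⟨β, h⟩ := h
  exact ⟨β.symm, ModuleScheme.restrict_symm h⟩

lemma rel_trans {t₁ t₂ t₃ : Triple ρ q d' M c' f}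
    (h : Rel t₁ t₂) (h' : Rel t₂ t₃) : Rel t₁ t₃ := by
  obtain ⟨β, h⟩ := h
  obtain ⟨β', h'⟩ := h'
  exact ⟨β ≪≫ β', ModuleScheme.restrict_trans h h'⟩

variable (ρ q d' M c' f) in
/-- Isomorphism of triples. -/
def setoid : Setoid (Triple ρ q d' M c' f) where
  r := Rel
  iseqv := ⟨rel_refl, rel_symm, rel_trans⟩

/-- The pullback `(u^* E', u^* φ', u^* α)` of a triple along `u : Y ⟶ X`. -/
noncomputable def pullback (u : Y ⟶ X) (hc : u ≫ c' = cY) (hf : u ≫ f = fY)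
    (t : Triple ρ q d' M c' f) : Triple ρ q d' M cY fY where
  N := (ModuleScheme.baseChange u).obj t.N
  isDrinfeld := t.isDrinfeld.baseChange u cY hc
  α := ModuleScheme.pullbackIso u f fY hf t.α

lemma pullback_rel (u : Y ⟶ X) (hc : u ≫ c' = cY) (hf : u ≫ f = fY)
    {t₁ t₂ : Triple ρ q d' M c' f} (h : Rel t₁ t₂) :
    Rel (t₁.pullback u hc hf) (t₂.pullback u hc hf) := by
  obtain ⟨β, h⟩ := h
  exact ⟨(ModuleScheme.baseChange u).mapIso β, ModuleScheme.pullbackHom_comp u f fY hf h⟩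

lemma pullback_id (u : X ⟶ X) (hu : u = 𝟙 X) (hc : u ≫ c' = c') (hf : u ≫ f = f)
    (t : Triple ρ q d' M c' f) : Rel (t.pullback u hc hf) t :=
  ⟨ModuleScheme.baseChangeId u hu t.N, ModuleScheme.pullbackHom_id u hu f hf t.α⟩

lemma pullback_comp (v : Z ⟶ Y) (u : Y ⟶ X) (w : Z ⟶ X) (hw : v ≫ u = w)
    (hc : u ≫ c' = cY) (hf : u ≫ f = fY) (hcv : v ≫ cY = cZ) (hfv : v ≫ fY = fZ)
    (hcw : w ≫ c' = cZ) (hfw : w ≫ f = fZ) (t : Triple ρ q d' M c' f) :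
    Rel (t.pullback w hcw hfw) ((t.pullback u hc hf).pullback v hcv hfv) :=
  ⟨ModuleScheme.baseChangeComp v u w hw t.N,
    ModuleScheme.pullbackHom_pullbackHom v u w hw f fY fZ hf hfv hfw t.α⟩

end Triple

variable {A A' : CommRingCat.{u}} (ρ : A ⟶ A') (q : ℕ) (d' : A' → ℤ)
  {S : Scheme.{u}} (c : S ⟶ Spec A) (M : ModuleScheme A S)

/-- The contravariant functor on schemes over `Spec A' ×_{Spec A} S` which sends
`(c', f) : X ⟶ Spec A' ×_{Spec A} S` to the set of isomorphism classes of triples `(E', φ', α)`,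
and a morphism `u` to pullback along `u`. -/
noncomputable def tripleFunctor : (Over (pullback (Spec.map ρ) c))ᵒᵖ ⥤ Type (u + 1) where
  obj X := Quotient (Triple.setoid ρ q d' M (X.unop.hom ≫ pullback.fst (Spec.map ρ) c)
    (X.unop.hom ≫ pullback.snd (Spec.map ρ) c))
  map u := TypeCat.ofHom
    (Quotient.map (Triple.pullback u.unop.left (by rw [← Category.assoc, Over.w])
      (by rw [← Category.assoc, Over.w])) (fun _ _ h => Triple.pullback_rel _ _ _ h))
  map_id X := by
    ext x
    induction x using Quotient.inductionOn with
    | h t => exact Quotient.sound (Triple.pullback_id _ rfl _ _ t)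
  map_comp u v := by
    ext x
    induction x using Quotient.inductionOn with
    | h t => exact Quotient.sound (Triple.pullback_comp _ _ _ rfl _ _ _ _ _ _ t)

end Functor

section Curves

/-- A smooth projective geometrically irreducible curve `C` over a field `k` (for curves,
projective and proper mean the same), together with a closed point `pt`, the place `∞`. -/
structure PointedCurve (k : Type u) [Field k] where
  C : Scheme.{u}
  str : C ⟶ Spec (CommRingCat.of k)
  isProper : IsProper str
  smooth : SmoothOfRelativeDimension 1 str
  geometricallyIrreducible : GeometricallyIrreducible str
  isIntegral : IsIntegral C
  pt : C
  isClosed : IsClosed ({pt} : Set C)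

namespace PointedCurve

variable {k : Type u} [Field k]

instance (X : PointedCurve k) : IsProper X.str := X.isProper

instance (X : PointedCurve k) : IsIntegral X.C := X.isIntegral

instance (X : PointedCurve k) : IsLocallyNoetherian X.C :=
  LocallyOfFiniteType.isLocallyNoetherian X.str

/-- The open subscheme `C ∖ {∞}`. -/
def affinePart (X : PointedCurve k) : X.C.Opens := ⟨{X.pt}ᶜ, X.isClosed.isOpen_compl⟩

/-- The ring `A = Γ(C ∖ {∞}, 𝒪_C)`. -/
noncomputable def ring (X : PointedCurve k) : CommRingCat.{u} := Γ(X.C, X.affinePart)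

open scoped Classical in
/-- The normalized valuation `ord_∞(a)` of `a ∈ A`, regarded as a rational function on `C`
(the generic point of `C` always lies in `C ∖ {∞}`). -/
noncomputable def ord (X : PointedCurve k) (a : X.ring) : ℤ :=
  if h : genericPoint X.C ∈ X.affinePart then
    X.C.ord ((X.C.presheaf.germ X.affinePart (genericPoint X.C) h).hom a) X.pt
  else 0

/-- The map from `k` to the residue field `κ(∞)`. -/
noncomputable def toResidueField (X : PointedCurve k) : k →+* X.C.residueField X.pt :=
  (Spec.preimage (X.C.fromSpecResidueField X.pt ≫ X.str)).hom

/-- The degree `deg(∞) = [κ(∞) : k]`. -/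
noncomputable def deg (X : PointedCurve k) : ℕ :=
  @Module.finrank k (X.C.residueField X.pt) _ _ X.toResidueField.toAlgebra.toModule

/-- The function `d(a) = - r ord_∞(a) deg(∞)`. -/
noncomputable def degreeFunction (X : PointedCurve k) (r : ℕ) (a : X.ring) : ℤ :=
  -(r : ℤ) * X.ord a * (X.deg : ℤ)

/-- The ring homomorphism `π^* : A ⟶ A'` induced by a morphism `π : C' ⟶ C` for which `∞'` is the
only point above `∞`. -/
noncomputable def ringMap {X X' : PointedCurve k} (π : X'.C ⟶ X.C)
    (h : ∀ y : X'.C, π y = X.pt ↔ y = X'.pt) : X.ring ⟶ X'.ring :=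
  π.appLE X.affinePart X'.affinePart (fun y hy hy' => hy ((h y).1 hy'))

end PointedCurve

end Curves

end DrinfeldRestriction

open DrinfeldRestriction

/-!
Through `α`, a triple `(E', φ', α)` over `f : X ⟶ S` is the same, up to isomorphism, as an extension
of the action of `A` on the pullback of `E` to an action of `A'` which is locally of Drinfeld type
(`tripleEquiv`, `representableByEquiv`). Such extensions have no automorphisms and form a Zariski
sheaf (`extensionFunctor_separated`, `exists_extensionFunctor_glue`), so that it suffices to represent
their functor locally on `S` by schemes finite over `S`, and to glue (`exists_representableBy`,
`isFinite_of_representableBy`).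

Choose `a₀ ∈ A` with a pole at `∞`. Locally on `S`, there is a coordinate on `E` in which `φ(a₀)` is a
twisted polynomial of degree exactly `N = d(a₀) > 0` with a unit `v` as leading coefficient: its
nilpotent higher coefficients are removed by conjugation with twisted polynomials `1 - w τᵉ`, `w`
nilpotent (`exists_twConj_standard`, `ModuleScheme.IsDrinfeld.exists_standardForm`). In such a
coordinate every `φ'(a) = ∑ δᵢ τⁱ` commutes with `φ(a₀)`, and comparing coefficients has three
consequences:
* the `δᵢ` beyond the degree `d'(a)`, which are nilpotent, vanish (`coeff_eq_zero_of_commute`);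
* the leading one satisfies `δ ^ (q ^ N - 1) = v ^ (q ^ d'(a) - 1)`, an equation which forces it to be
  a unit (`unit_coeff_of_commute`);
* each `δᵢ` is a root of a monic equation, of degree `q ^ N`, over the ring generated by the higher
  ones (`TwistedExtension.isIntegral`).

So the extensions are described by equations between the `δᵢ`, hence by a ring that is universal for
them, and this ring is finite over the base because `A'` is of finite type over `A`
(`TwistedExtension.finite`, `StandardForm.existsUnique_hom`).

Riemann–Roch, which would provide `a₀`, is avoided. If some `a' ∈ A'` has a pole at `∞'`, then a
coefficient of its minimal polynomial over the function field of `C` lies in `A` and has a pole at `∞`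
(`PointedCurve.exists_pole`), and `A'` is a finitely generated ring, since the sets of functions with
a pole of bounded order at `∞'` are finite and their leading terms stabilize
(`PointedCurve.exists_finite_closure_eq_top_of_pole`).
Otherwise `A'` consists of constants, `A ⟶ A'` is an isomorphism, and each scheme over
`Spec A' ×_{Spec A} S` carries exactly one triple up to isomorphism
(`representable_and_finite_of_bijective`).
-/

namespace DrinfeldRestriction

/-! ### Twisted polynomials -/

section Frobenius

variable {k : Type*} [Field k] [Finite k] {R : Type*} [CommRing R]

lemma add_pow_card_pow (f : k →+* R) (i : ℕ) (x y : R) :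
    (x + y) ^ Nat.card k ^ i = x ^ Nat.card k ^ i + y ^ Nat.card k ^ i := by
  rcases subsingleton_or_nontrivial R with h | h
  · exact Subsingleton.elim _ _
  cases nonempty_fintype k
  obtain ⟨n, hp, hc⟩ := FiniteField.card k (ringChar k)
  have : Fact (ringChar k).Prime := ⟨hp⟩
  have : CharP R (ringChar k) := charP_of_injective_ringHom f.injective _
  rw [Nat.card_eq_fintype_card, hc, ← pow_mul]
  exact add_pow_char_pow x y _ _

/-- The `i`-th iterate of the `q`-th power Frobenius endomorphism of a ring containing a field
with `q` elements. -/
noncomputable def frobeniusPow (f : k →+* R) (i : ℕ) : R →+* R where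
  toFun x := x ^ Nat.card k ^ i
  map_one' := one_pow _
  map_mul' x y := mul_pow x y _
  map_zero' := zero_pow (pow_ne_zero _ Nat.card_pos.ne')
  map_add' := add_pow_card_pow f i

lemma frobeniusPow_apply (f : k →+* R) (i : ℕ) (x : R) :
    frobeniusPow f i x = x ^ Nat.card k ^ i := rfl

end Frobenius

section Twisted

open Polynomial

variable {B R : Type*} [CommRing B] [CommRing R]

/-- The value at `y` of the twisted polynomial `∑ bᵢ τⁱ`, where `τ` is the `q`-th power map. -/
noncomputable def twEval (q : ℕ) (g : B →+* R) (b : ℕ →₀ B) (y : R) : R :=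
  b.sum fun i c => g c * y ^ q ^ i

/-- The polynomial `∑ bᵢ X ^ qⁱ` attached to the twisted polynomial `∑ bᵢ τⁱ`. -/
noncomputable def twPoly (q : ℕ) (b : ℕ →₀ B) : B[X] :=
  b.sum fun i c => C c * X ^ q ^ i

/-- The product of twisted polynomials, determined by `τ c = c ^ q τ`. -/
noncomputable def twMul (q : ℕ) (b c : ℕ →₀ B) : ℕ →₀ B :=
  b.sum fun i x => c.sum fun j y => Finsupp.single (i + j) (x * y ^ q ^ i)

lemma eval₂_twPoly (q : ℕ) (g : B →+* R) (b : ℕ →₀ B) (y : R) :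
    (twPoly q b).eval₂ g y = twEval q g b y := by
  simp only [twPoly, twEval, Finsupp.sum, eval₂_finsetSum, eval₂_mul, eval₂_C, eval₂_X_pow]

lemma twPoly_coeff {q : ℕ} (hq : 1 < q) (b : ℕ →₀ B) (i : ℕ) :
    (twPoly q b).coeff (q ^ i) = b i := by
  simp only [twPoly, Finsupp.sum, finsetSum_coeff, coeff_C_mul, coeff_X_pow]
  rw [Finset.sum_eq_single i]
  · simp
  · intro j _ hj
    rw [if_neg (fun h => hj (Nat.pow_right_injective hq h).symm), mul_zero]
  · intro h
    simpa using h

lemma twPoly_coeff_of_ne {q : ℕ} (b : ℕ →₀ B) (m : ℕ) (hm : ∀ i, m ≠ q ^ i) :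
    (twPoly q b).coeff m = 0 := by
  simp only [twPoly, Finsupp.sum, finsetSum_coeff, coeff_C_mul, coeff_X_pow]
  exact Finset.sum_eq_zero fun i _ => by rw [if_neg (hm i), mul_zero]

lemma twEval_map {B' : Type*} [CommRing B'] (q : ℕ) (g : B →+* B') (h : B' →+* R) (b : ℕ →₀ B)
    (y : R) : twEval q h (b.mapRange g (map_zero g)) y = twEval q (h.comp g) b y := by
  rw [twEval, Finsupp.sum_mapRange_index (fun i => by rw [map_zero, zero_mul])]
  rfl

lemma map_twEval {R' : Type*} [CommRing R'] (q : ℕ) (g : B →+* R) (h : R →+* R') (b : ℕ →₀ B)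
    (y : R) : h (twEval q g b y) = twEval q (h.comp g) b (h y) := by
  simp only [twEval, Finsupp.sum, map_sum, map_mul, map_pow, RingHom.comp_apply]

lemma twEval_add_left (q : ℕ) (g : B →+* R) (b c : ℕ →₀ B) (y : R) :
    twEval q g (b + c) y = twEval q g b y + twEval q g c y :=
  Finsupp.sum_add_index' (fun i => by rw [map_zero, zero_mul])
    (fun i x y => by rw [map_add, add_mul])

lemma twEval_single (q : ℕ) (g : B →+* R) (i : ℕ) (c : B) (y : R) :
    twEval q g (Finsupp.single i c) y = g c * y ^ q ^ i :=
  Finsupp.sum_single_index (by rw [map_zero, zero_mul])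

lemma twMul_apply (q : ℕ) (hq : q ≠ 0) (b c : ℕ →₀ B) (n : ℕ) :
    twMul q b c n = ∑ p ∈ Finset.HasAntidiagonal.antidiagonal n, b p.1 * c p.2 ^ q ^ p.1 := by
  classical
  have h0 : ∀ i, q ^ i ≠ 0 := fun i => pow_ne_zero _ hq
  simp only [twMul, Finsupp.sum, Finsupp.finsetSum_apply, Finsupp.single_apply]
  rw [← Finset.sum_product', ← Finset.sum_filter]
  refine Finset.sum_subset_zero_on_sdiff (fun p hp => ?_) (fun p hp => ?_) (fun _ _ => rfl)
  · exact Finset.HasAntidiagonal.mem_antidiagonal.2 (Finset.mem_filter.1 hp).2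
  · rw [Finset.mem_sdiff, Finset.HasAntidiagonal.mem_antidiagonal, Finset.mem_filter, Finset.mem_product,
      Finsupp.mem_support_iff, Finsupp.mem_support_iff] at hp
    by_cases h1 : b p.1 = 0
    · rw [h1, zero_mul]
    · by_cases h2 : c p.2 = 0
      · rw [h2, zero_pow (h0 _), mul_zero]
      · exact absurd ⟨⟨h1, h2⟩, hp.1⟩ hp.2

lemma twMul_single_left (q : ℕ) (hq : q ≠ 0) (e : ℕ) (v : B) (b : ℕ →₀ B) (n : ℕ) :
    twMul q (Finsupp.single e v) b n = if e ≤ n then v * b (n - e) ^ q ^ e else 0 := by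
  classical
  rw [twMul_apply q hq]
  split_ifs with h
  · rw [Finset.sum_eq_single (e, n - e)]
    · simp
    · rintro ⟨i, j⟩ hp hne
      rw [Finset.HasAntidiagonal.mem_antidiagonal] at hp
      rw [Finsupp.single_apply, if_neg, zero_mul]
      rintro rfl
      exact hne (by ext <;> simp at hp ⊢; omega)
    · intro hp
      exact absurd (Finset.HasAntidiagonal.mem_antidiagonal.2 (by simp; omega)) hp
  · refine Finset.sum_eq_zero fun p hp => ?_
    rw [Finset.HasAntidiagonal.mem_antidiagonal] at hp
    rw [Finsupp.single_apply, if_neg (by omega), zero_mul]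

lemma twMul_single_right (q : ℕ) (hq : q ≠ 0) (e : ℕ) (v : B) (b : ℕ →₀ B) (n : ℕ) :
    twMul q b (Finsupp.single e v) n = if e ≤ n then b (n - e) * v ^ q ^ (n - e) else 0 := by
  classical
  rw [twMul_apply q hq]
  split_ifs with h
  · rw [Finset.sum_eq_single (n - e, e)]
    · simp
    · rintro ⟨i, j⟩ hp hne
      rw [Finset.HasAntidiagonal.mem_antidiagonal] at hp
      rw [Finsupp.single_apply, if_neg, zero_pow (pow_ne_zero _ hq), mul_zero]
      rintro rfl
      exact hne (by ext <;> simp at hp ⊢; omega)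
    · intro hp
      exact absurd (Finset.HasAntidiagonal.mem_antidiagonal.2 (by simp; omega)) hp
  · refine Finset.sum_eq_zero fun p hp => ?_
    rw [Finset.HasAntidiagonal.mem_antidiagonal] at hp
    rw [Finsupp.single_apply, if_neg (by omega), zero_pow (pow_ne_zero _ hq), mul_zero]

section FiniteField

variable {k : Type*} [Field k] [Finite k]

lemma twEval_add (f : k →+* R) (g : B →+* R) (b : ℕ →₀ B) (y z : R) :
    twEval (Nat.card k) g b (y + z) = twEval (Nat.card k) g b y + twEval (Nat.card k) g b z := by
  simp only [twEval, Finsupp.sum, ← Finset.sum_add_distrib, add_pow_card_pow f, mul_add]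

lemma twEval_twMul (f : k →+* R) (g : B →+* R) (b c : ℕ →₀ B) (y : R) :
    twEval (Nat.card k) g (twMul (Nat.card k) b c) y =
      twEval (Nat.card k) g b (twEval (Nat.card k) g c y) := by
  have key : ∀ d : ℕ →₀ B, twEval (Nat.card k) g d y =
      Finsupp.liftAddHom (fun i => (AddMonoidHom.mulRight (y ^ Nat.card k ^ i)).comp
        g.toAddMonoidHom) d := fun d => rfl
  rw [key, twMul, Finsupp.sum, map_sum, twEval, Finsupp.sum]
  refine Finset.sum_congr rfl fun i _ => ?_
  rw [Finsupp.sum, map_sum, ← frobeniusPow_apply f, twEval, Finsupp.sum, map_sum, Finset.mul_sum]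
  refine Finset.sum_congr rfl fun j _ => ?_
  rw [Finsupp.liftAddHom_apply_single]
  change g _ * y ^ _ = _ * (_ * y ^ _) ^ _
  rw [mul_pow, ← pow_mul, ← pow_add, add_comm j i, map_mul, map_pow, mul_assoc]

/-- The additive endomorphism of `B[X]` given by a twisted polynomial. Through these operators,
twisted polynomials form a ring. -/
noncomputable def twOp (f : k →+* B) (b : ℕ →₀ B) : AddMonoid.End B[X] :=
  AddMonoidHom.mk' (twEval (Nat.card k) C b) (twEval_add (C.comp f) C b)

variable (f : k →+* B)

lemma twOp_apply (b : ℕ →₀ B) (y : B[X]) : twOp f b y = twEval (Nat.card k) C b y := rfl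

lemma twOp_X (b : ℕ →₀ B) : twOp f b X = twPoly (Nat.card k) b := rfl

lemma twOp_injective : Function.Injective (twOp f) := fun b c h => by
  have h1 : twPoly (Nat.card k) b = twPoly (Nat.card k) c := by
    rw [← twOp_X f, ← twOp_X f, h]
  ext i
  rw [← twPoly_coeff (Finite.one_lt_card (α := k)) b, h1,
    twPoly_coeff (Finite.one_lt_card (α := k))]

lemma twOp_mul (b c : ℕ →₀ B) : twOp f (twMul (Nat.card k) b c) = twOp f b * twOp f c :=
  AddMonoidHom.ext fun y => twEval_twMul (C.comp f) C b c y

lemma twOp_add (b c : ℕ →₀ B) : twOp f (b + c) = twOp f b + twOp f c :=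
  AddMonoidHom.ext fun _ => twEval_add_left _ _ _ _ _

lemma twOp_one : twOp f (Finsupp.single 0 1) = 1 :=
  AddMonoidHom.ext fun y =>
    (twEval_single _ _ _ _ _).trans (by rw [map_one, one_mul, pow_zero, pow_one]; rfl)

lemma twOp_zero : twOp f 0 = 0 :=
  AddMonoidHom.ext fun y =>
  (twOp_apply f 0 y).trans (by rw [twEval, Finsupp.sum_zero_index]; rfl)

lemma twOp_neg (b : ℕ →₀ B) : twOp f (-b) = -twOp f b := by
  rw [eq_neg_iff_add_eq_zero, ← twOp_add, neg_add_cancel, twOp_zero]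

/-- The ring of twisted polynomials, as a ring of additive operators on `B[X]`. -/
def twSubring : Subring (AddMonoid.End B[X]) where
  carrier := Set.range (twOp f)
  mul_mem' := by
    rintro _ _ ⟨b, rfl⟩ ⟨c, rfl⟩
    exact ⟨_, twOp_mul f b c⟩
  one_mem' := ⟨_, twOp_one f⟩
  add_mem' := by
    rintro _ _ ⟨b, rfl⟩ ⟨c, rfl⟩
    exact ⟨_, twOp_add f b c⟩
  zero_mem' := ⟨_, twOp_zero f⟩
  neg_mem' := by
    rintro _ ⟨b, rfl⟩
    exact ⟨_, twOp_neg f b⟩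

lemma twOp_single_pow (e : ℕ) (v : B) (n : ℕ) :
    ∃ w : B, v ^ n ∣ w ∧ twOp f (Finsupp.single e v) ^ n = twOp f (Finsupp.single (n * e) w) := by
  induction n with
  | zero => exact ⟨1, by simp, by rw [pow_zero, zero_mul, twOp_one]⟩
  | succ n ih =>
    obtain ⟨w, hw, h⟩ := ih
    refine ⟨w * v ^ Nat.card k ^ (n * e), ?_, ?_⟩
    · rw [pow_succ]
      exact mul_dvd_mul hw (dvd_pow_self _ (pow_ne_zero _ Nat.card_pos.ne'))
    · rw [pow_succ, h, ← twOp_mul]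
      congr 1
      simp only [twMul]
      rw [Finsupp.sum_single_index, Finsupp.sum_single_index]
      · congr 1; ring
      · rw [zero_pow (pow_ne_zero _ Nat.card_pos.ne'), mul_zero, Finsupp.single_zero]
      · simp

lemma exists_inverse_one_sub (e : ℕ) (v : B) (hv : IsNilpotent v) :
    ∃ w : ℕ →₀ B, (1 - twOp f (Finsupp.single e v)) * twOp f w = 1 ∧
      twOp f w * (1 - twOp f (Finsupp.single e v)) = 1 := by
  obtain ⟨n, hn⟩ := hv
  let y : twSubring f := ⟨twOp f (Finsupp.single e v), ⟨_, rfl⟩⟩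
  have hy : IsNilpotent y := by
    refine ⟨n, Subtype.ext ?_⟩
    obtain ⟨w, hw, h⟩ := twOp_single_pow f e v n
    rw [hn, zero_dvd_iff] at hw
    change twOp f (Finsupp.single e v) ^ n = 0
    rw [h, hw, Finsupp.single_zero, twOp_zero]
  obtain ⟨x, hx⟩ := hy.isUnit_one_sub
  obtain ⟨w, hw⟩ := (x⁻¹ : (twSubring f)ˣ).1.2
  refine ⟨w, ?_, ?_⟩
  · rw [hw]
    have := congrArg Subtype.val x.mul_inv
    rw [hx] at this
    exact this
  · rw [hw]
    have := congrArg Subtype.val x.inv_mul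
    rw [hx] at this
    exact this

/-- Two twisted polynomials `b` and `c` are conjugate: `c = u b u⁻¹`. -/
def TwConj (b c : ℕ →₀ B) : Prop :=
  ∃ x y : ℕ →₀ B, twOp f x * twOp f y = 1 ∧ twOp f y * twOp f x = 1 ∧
    twOp f c = twOp f x * twOp f b * twOp f y

variable {f}

lemma TwConj.refl (b : ℕ →₀ B) : TwConj f b b :=
  ⟨Finsupp.single 0 1, Finsupp.single 0 1, by rw [twOp_one, one_mul], by rw [twOp_one, one_mul],
    by rw [twOp_one, one_mul, mul_one]⟩

lemma TwConj.trans {b c d : ℕ →₀ B} (h : TwConj f b c) (h' : TwConj f c d) : TwConj f b d := by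
  obtain ⟨x, y, h1, h2, h3⟩ := h
  obtain ⟨x', y', h1', h2', h3'⟩ := h'
  refine ⟨twMul (Nat.card k) x' x, twMul (Nat.card k) y y', ?_, ?_, ?_⟩ <;> rw [twOp_mul, twOp_mul]
  · rw [mul_assoc, ← mul_assoc (twOp f x), h1, one_mul, h1']
  · rw [mul_assoc, ← mul_assoc (twOp f y'), h2', one_mul, h2]
  · rw [h3', h3]; simp only [mul_assoc]

lemma eq_one_add_of_one_sub_mul {S : Type*} [Ring S] {y w : S} (h : (1 - y) * w = 1) :
    w = 1 + y + y * y * w := by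
  have h1 : w = 1 + y * w := by rw [← h]; noncomm_ring
  calc w = 1 + y * (1 + y * w) := by rw [← h1]; exact h1
    _ = 1 + y + y * y * w := by noncomm_ring

lemma one_sub_mul_mul {S : Type*} [Ring S] (y b w : S) :
    (1 - y) * b * (1 + y + y * y * w) =
      b - y * b + b * y - y * b * y + (b * (y * y * w) - y * (b * (y * y * w))) := by
  noncomm_ring

/-- One step towards a standard form. If the coefficients of `b` beyond `d` lie in a nil ideal `J`
and those beyond `m > d` lie in `J' ⊇ J²`, then conjugation by `1 - v τ ^ (m - d)`, with `v` chosen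
to kill the coefficient at `m` to first order, moves the coefficient at `m` into `J'` too. -/
lemma TwConj.step {J J' : Ideal B} (hJ : J ≤ nilradical B) (hJJ : J * J ≤ J') (hJ' : J' ≤ J)
    {d m : ℕ} (hd : 0 < d) (hm : d < m) (b : ℕ →₀ B) (hb : IsUnit (b d))
    (h1 : ∀ i, d < i → b i ∈ J) (h2 : ∀ i, m < i → b i ∈ J') :
    ∃ c, TwConj f b c ∧ IsUnit (c d) ∧ (∀ i, d < i → c i ∈ J) ∧ ∀ i, m ≤ i → c i ∈ J' := by
  set q := Nat.card k with hq
  have hq0 : q ≠ 0 := Nat.card_pos.ne'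
  have hq1 : 1 < q := Finite.one_lt_card
  set e := m - d with he
  obtain ⟨z, hz⟩ := (hb.pow (q ^ e)).exists_right_inv
  set v := b m * z with hv
  have hvJ : v ∈ J := J.mul_mem_right _ (h1 m hm)
  obtain ⟨w, hw1, hw2⟩ := exists_inverse_one_sub f e v (hJ hvJ)
  set y := Finsupp.single e v with hy
  -- `w = 1 + y + y² w`
  have hw := eq_one_add_of_one_sub_mul hw1
  -- Expanding `(1 - y) b w` gives `r + (s - y s)`, where `s = b y² w` has all its coefficients in
  -- `J'` since those of `y²` are multiples of `v ^ (1 + q ^ e)`.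
  set r : ℕ →₀ B := b - twMul q y b + twMul q b y - twMul q (twMul q y b) y with hr
  set s : ℕ →₀ B := twMul q b (twMul q (twMul q y y) w) with hs
  set c : ℕ →₀ B := r + (s - twMul q y s) with hc
  have twOp_sub : ∀ b c : ℕ →₀ B, twOp f (b - c) = twOp f b - twOp f c := fun b c => by
    rw [sub_eq_add_neg, twOp_add, twOp_neg, sub_eq_add_neg]
  have hcc : twOp f c = (1 - twOp f y) * twOp f b * twOp f w := by
    rw [hc, hr, hs]
    simp only [twOp_add, twOp_sub, hq, twOp_mul]
    rw [← one_sub_mul_mul, ← hw]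
  have hpow : ∀ {I : Ideal B} {x : B} (i : ℕ), x ∈ I → x ^ q ^ i ∈ I := fun i hx =>
    Ideal.pow_mem_of_mem _ hx _ (pow_pos (Nat.pos_of_ne_zero hq0) _)
  have hpow2 : ∀ {x : B} (i : ℕ), 0 < i → x ∈ J → x ^ q ^ i ∈ J' := fun {x} i hi hx => by
    have h2 : 2 ≤ q ^ i := le_trans hq1 (Nat.le_self_pow hi.ne' q)
    obtain ⟨t, ht⟩ := Nat.exists_eq_add_of_le h2
    rw [ht, pow_add, pow_two]
    exact J'.mul_mem_right _ (hJJ (Ideal.mul_mem_mul hx hx))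
  have hleft : ∀ {I : Ideal B} (g x : ℕ →₀ B) , (∀ i, x i ∈ I) → ∀ n, twMul q g x n ∈ I :=
    fun {I} g x hx n => by
      rw [twMul_apply q hq0]
      exact I.sum_mem fun p _ => I.mul_mem_left _ (hpow _ (hx _))
  have hright : ∀ {I : Ideal B} (g x : ℕ →₀ B) , (∀ i, x i ∈ I) → ∀ n, twMul q x g n ∈ I :=
    fun {I} g x hx n => by
      rw [twMul_apply q hq0]
      exact I.sum_mem fun p _ => I.mul_mem_right _ (hx _)
  have hyy : ∀ n, twMul q y y n ∈ J' := fun n => by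
    rw [twMul_single_left q hq0]
    split_ifs
    · refine hJJ (Ideal.mul_mem_mul hvJ (hpow _ ?_))
      rw [hy, Finsupp.single_apply]
      split_ifs
      exacts [hvJ, J.zero_mem]
    · exact J'.zero_mem
  have hsJ : ∀ n, s n ∈ J' := fun n => hleft _ _ (hright _ _ hyy) n
  have hysJ : ∀ n, twMul q y s n ∈ J' := fun n => hleft _ _ hsJ n
  have hyby : ∀ n, twMul q (twMul q y b) y n ∈ J' := fun n => by
    rw [twMul_single_right q hq0]
    split_ifs
    · refine hJJ (Ideal.mul_mem_mul ?_ (hpow _ hvJ))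
      rw [twMul_single_left q hq0]
      split_ifs
      exacts [J.mul_mem_right _ hvJ, J.zero_mem]
    · exact J'.zero_mem
  have hybJ : ∀ n, twMul q y b n ∈ J := fun n => by
    rw [twMul_single_left q hq0]
    split_ifs
    exacts [J.mul_mem_right _ hvJ, J.zero_mem]
  have hbyJ : ∀ n, twMul q b y n ∈ J := fun n => by
    rw [twMul_single_right q hq0]
    split_ifs
    exacts [J.mul_mem_left _ (hpow _ hvJ), J.zero_mem]
  have hcn : ∀ n, c n = b n - twMul q y b n + twMul q b y n - twMul q (twMul q y b) y n +
      (s n - twMul q y s n) := fun n => rfl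
  refine ⟨c, ⟨Finsupp.single 0 1 - y, w, ?_, ?_, ?_⟩, ?_, fun n hn => ?_, fun n hn => ?_⟩
  · rw [twOp_sub, twOp_one, hw1]
  · rw [twOp_sub, twOp_one, hw2]
  · rw [twOp_sub, twOp_one, hcc]
  · have : IsNilpotent (c d - b d) := by
      refine hJ ?_
      rw [hcn]
      have := J.add_mem (J.sub_mem (J.sub_mem (hbyJ d) (hybJ d)) (hJ' (hyby d)))
        (J.sub_mem (hJ' (hsJ d)) (hJ' (hysJ d)))
      convert! this using 1
      ring
    have := this.isUnit_add_left_of_commute hb (Commute.all _ _)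
    rwa [add_sub_cancel] at this
  · rw [hcn]
    exact J.add_mem (J.sub_mem (J.add_mem (J.sub_mem (h1 n hn) (hybJ n)) (hbyJ n)) (hJ' (hyby n)))
      (J.sub_mem (hJ' (hsJ n)) (hJ' (hysJ n)))
  -- Modulo `J'` only `b - y b + b y` remains. In degree `m` the first two terms cancel by the choice
  -- of `v`, and the coefficients of `b y` involve `v ^ q ^ (n - e)` with `n - e ≥ d > 0`.
  · rw [hcn]
    refine J'.add_mem (J'.sub_mem (J'.add_mem ?_ ?_) (hyby n)) (J'.sub_mem (hsJ n) (hysJ n))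
    · rw [twMul_single_left q hq0, if_pos (by omega)]
      rcases hn.eq_or_lt with rfl | hn
      · rw [show m - e = d by omega, hv, mul_assoc, mul_comm z, hz, mul_one, sub_self]
        exact J'.zero_mem
      · exact J'.sub_mem (h2 n hn) (hJJ (Ideal.mul_mem_mul hvJ (hpow _ (h1 _ (by omega)))))
    · rw [twMul_single_right q hq0, if_pos (by omega)]
      exact J'.mul_mem_left _ (hpow2 _ (by omega) hvJ)

/-- Every twisted polynomial with unit coefficient at `d > 0` and nilpotent coefficients beyond
is conjugate to one of degree exactly `d`. -/
theorem exists_twConj_standard {d : ℕ} (hd : 0 < d) (b : ℕ →₀ B) (hb : IsUnit (b d))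
    (hn : ∀ i, d < i → IsNilpotent (b i)) :
    ∃ c, TwConj f b c ∧ IsUnit (c d) ∧ ∀ i, d < i → c i = 0 := by
  classical
  let s : Finset B := (b.support.filter (d < ·)).image b
  let J₀ : Ideal B := Ideal.span s
  have hJ₀ : J₀ ≤ nilradical B := by
    refine Ideal.span_le.2 fun x hx => ?_
    obtain ⟨i, hi, rfl⟩ := Finset.mem_image.1 (Finset.mem_coe.1 hx)
    exact hn i (Finset.mem_filter.1 hi).2
  obtain ⟨N, hN⟩ := (Ideal.FG.isNilpotent_iff_le_nilradical ⟨s, rfl⟩).2 hJ₀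
  have hb0 : ∀ i, d < i → b i ∈ J₀ := fun i hi => by
    by_cases h : b i = 0
    · rw [h]; exact J₀.zero_mem
    · exact Ideal.subset_span (Finset.mem_coe.2 (Finset.mem_image_of_mem _
        (Finset.mem_filter.2 ⟨Finsupp.mem_support_iff.2 h, hi⟩)))
  -- Lowering the degree beyond which the coefficients lie in `J'`, one step at a time.
  have inner : ∀ (J J' : Ideal B), J ≤ nilradical B → J * J ≤ J' → J' ≤ J →
      ∀ (t : ℕ) (b : ℕ →₀ B), IsUnit (b d) → (∀ i, d < i → b i ∈ J) →
        (∀ i, d + t < i → b i ∈ J') →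
        ∃ c, TwConj f b c ∧ IsUnit (c d) ∧ ∀ i, d < i → c i ∈ J' := by
    intro J J' h1 h2 h3 t
    induction t with
    | zero => exact fun b hb _ h => ⟨b, .refl b, hb, h⟩
    | succ t ih =>
      intro b hb hbJ h
      obtain ⟨c, hc1, hc2, hc3, hc4⟩ :=
        TwConj.step (f := f) h1 h2 h3 hd (show d < d + (t + 1) by omega) b hb hbJ h
      obtain ⟨c', h1', h2', h3'⟩ := ih c hc2 hc3 (fun i hi => hc4 i (by omega))
      exact ⟨c', hc1.trans h1', h2', h3'⟩
  -- The high coefficients lie in a finitely generated nil ideal, hence a nilpotent one, and each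
  -- round squares the ideal which contains them.
  have outer : ∀ n : ℕ, ∃ c, TwConj f b c ∧ IsUnit (c d) ∧ ∀ i, d < i → c i ∈ J₀ ^ 2 ^ n := by
    intro n
    induction n with
    | zero => exact ⟨b, .refl b, hb, fun i hi => by simpa using hb0 i hi⟩
    | succ n ih =>
      obtain ⟨c, hc1, hc2, hc3⟩ := ih
      obtain ⟨c', h1, h2, h3⟩ := inner (J₀ ^ 2 ^ n) (J₀ ^ 2 ^ (n + 1))
        ((Ideal.pow_le_self (pow_ne_zero _ two_ne_zero)).trans hJ₀)
        (by rw [← pow_add, pow_succ 2 n, mul_two])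
        (Ideal.pow_le_pow_right (Nat.pow_le_pow_right two_pos (Nat.le_succ n)))
        (c.support.sup id) c hc2 hc3 (fun i hi => by
          have : c i = 0 := by
            by_contra h
            have := Finset.le_sup (f := id) (Finsupp.mem_support_iff.2 h)
            simp only [id] at this
            omega
          rw [this]; exact Ideal.zero_mem _)
      exact ⟨c', hc1.trans h1, h2, h3⟩
  obtain ⟨c, h1, h2, h3⟩ := outer N
  refine ⟨c, h1, h2, fun i hi => ?_⟩
  have h4 : J₀ ^ 2 ^ N ≤ J₀ ^ N := Ideal.pow_le_pow_right Nat.lt_two_pow_self.le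
  have := h4 (h3 i hi)
  rw [hN] at this
  exact this

end FiniteField

end Twisted

/-! ### Additive polynomials and changes of coordinate -/

section Transition

open Polynomial

variable {B : Type*} [CommRing B]

lemma coeff_one_comp (P Q : B[X]) (hQ : Q.coeff 0 = 0) :
    (P.comp Q).coeff 1 = P.coeff 1 * Q.coeff 1 := by
  have h : ∀ F : B[X], F.coeff 1 = (derivative F).eval 0 := fun F => by
    rw [← coeff_zero_eq_eval_zero, coeff_derivative]; simp
  rw [h, derivative_comp, eval_mul, eval_comp, ← coeff_zero_eq_eval_zero Q, hQ, ← h, ← h, mul_comm]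

lemma exists_eq_C_mul_X_of_comp_eq {D : Type*} [CommRing D] [IsDomain D] {Q Q' : D[X]}
    (h : Q.comp Q' = X) (h0 : Q.coeff 0 = 0) : ∃ c, Q = C c * X := by
  have h1 : Q.natDegree * Q'.natDegree = 1 := by rw [← natDegree_comp, h, natDegree_X]
  have h2 : Q.natDegree = 1 := Nat.eq_one_of_mul_eq_one_right h1
  refine ⟨Q.coeff 1, ?_⟩
  have := Q.as_sum_range_C_mul_X_pow
  rw [h2] at this
  rw [this]
  simp [Finset.sum_range_succ, h0]

/-- Modulo a prime ideal, mutually inverse polynomials `Q` and `Q'` without constant term are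
linear, so conjugation by `Q` multiplies coefficients by units. -/
lemma exists_unit_coeff_comp_mem {Q Q' : B[X]} (h : Q.comp Q' = X) (h' : Q'.comp Q = X)
    (h0 : Q.coeff 0 = 0) (h0' : Q'.coeff 0 = 0) (P : B[X]) (m : ℕ) (p : Ideal B) [p.IsPrime] :
    (Q.comp (P.comp Q')).coeff m ∈ p ↔ P.coeff m ∈ p := by
  let g := Ideal.Quotient.mk p
  have hmap : ∀ F G : B[X], (F.comp G).map g = (F.map g).comp (G.map g) := fun F G =>
    Polynomial.map_comp _ _ _
  obtain ⟨c, hc⟩ := exists_eq_C_mul_X_of_comp_eq (Q := Q.map g) (Q' := Q'.map g)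
    (by rw [← hmap, h, map_X]) (by rw [coeff_map, h0, map_zero])
  obtain ⟨c', hc'⟩ := exists_eq_C_mul_X_of_comp_eq (Q := Q'.map g) (Q' := Q.map g)
    (by rw [← hmap, h', map_X]) (by rw [coeff_map, h0', map_zero])
  have hcc : c * c' = 1 := by
    have := congrArg (fun F => (F.map g).coeff 1) h
    simpa [hmap, hc, hc'] using this
  have hc0 : c ≠ 0 := left_ne_zero_of_mul_eq_one hcc
  have hc0' : c' ≠ 0 := right_ne_zero_of_mul_eq_one hcc
  rw [← Ideal.Quotient.eq_zero_iff_mem, ← Ideal.Quotient.eq_zero_iff_mem]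
  change g _ = 0 ↔ g _ = 0
  rw [← coeff_map, hmap, hmap, hc, hc', mul_comp, C_comp, X_comp, coeff_C_mul,
    comp_C_mul_X_coeff, coeff_map]
  simp [hc0, hc0']

lemma isNilpotent_coeff_comp_iff {Q Q' : B[X]} (h : Q.comp Q' = X) (h' : Q'.comp Q = X)
    (h0 : Q.coeff 0 = 0) (h0' : Q'.coeff 0 = 0) (P : B[X]) (m : ℕ) :
    IsNilpotent ((Q.comp (P.comp Q')).coeff m) ↔ IsNilpotent (P.coeff m) := by
  rw [← mem_nilradical, ← mem_nilradical, nilradical_eq_sInf]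
  simp only [Ideal.mem_sInf, Set.mem_ofPred_eq]
  exact forall_congr' fun p => forall_congr' fun (hp : p.IsPrime) =>
    exists_unit_coeff_comp_mem h h' h0 h0' P m p

lemma isUnit_coeff_comp_iff {Q Q' : B[X]} (h : Q.comp Q' = X) (h' : Q'.comp Q = X)
    (h0 : Q.coeff 0 = 0) (h0' : Q'.coeff 0 = 0) (P : B[X]) (m : ℕ) :
    IsUnit ((Q.comp (P.comp Q')).coeff m) ↔ IsUnit (P.coeff m) := by
  have key : ∀ x : B, IsUnit x ↔ ∀ p : Ideal B, p.IsMaximal → x ∉ p := fun x =>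
    ⟨fun hx p hp hxp => hp.ne_top (Ideal.eq_top_of_isUnit_mem _ hxp hx), fun H => by
      by_contra hx
      obtain ⟨p, hp, hxp⟩ := exists_max_ideal_of_mem_nonunits hx
      exact H p hp hxp⟩
  rw [key, key]
  refine forall_congr' fun p => forall_congr' fun hp => not_congr ?_
  have := hp.isPrime
  exact exists_unit_coeff_comp_mem h h' h0 h0' P m p

lemma coeff_one_comp_comp {Q Q' : B[X]} (h : Q.comp Q' = X)
    (h0' : Q'.coeff 0 = 0) (P : B[X]) (hP : P.coeff 0 = 0) :
    (Q.comp (P.comp Q')).coeff 1 = P.coeff 1 := by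
  have h1 : Q.coeff 1 * Q'.coeff 1 = 1 := by rw [← coeff_one_comp _ _ h0', h, coeff_X_one]
  rw [coeff_one_comp, coeff_one_comp _ _ h0', mul_left_comm, h1, mul_one]
  rw [coeff_zero_eq_eval_zero, eval_comp, ← coeff_zero_eq_eval_zero Q', h0',
    ← coeff_zero_eq_eval_zero, hP]

end Transition

section Additive

open Polynomial

variable {k : Type*} [Field k] [Finite k] {B : Type*} [CommRing B]

lemma exists_eq_pow_of_choose_eq_zero (p : ℕ) [Fact p.Prime] {m : ℕ} (hm : m ≠ 0)
    (h : ∀ i, 0 < i → i < m → p ∣ m.choose i) : ∃ v, m = p ^ v := by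
  have hp : p.Prime := Fact.out
  obtain ⟨v, s, hs, rfl⟩ := Nat.exists_eq_pow_mul_and_not_dvd hm p hp.ne_one
  refine ⟨v, ?_⟩
  by_contra hne
  have hs0 : s ≠ 0 := by rintro rfl; exact hs (dvd_zero _)
  have hs1 : 1 < s := by
    rcases Nat.lt_or_ge 1 s with h1 | h1
    · exact h1
    · exact absurd (by rw [show s = 1 by omega, mul_one]) hne
  have hpv : 0 < p ^ v := pow_pos hp.pos _
  have h1 := h (p ^ v) hpv (by nlinarith)
  have h2 : ((p ^ v * s).choose (p ^ v * 1)) ≡ s.choose 1 [MOD p] :=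
    Choose.choose_pow_mul_pow_mul_modEq_choose_nat
  rw [mul_one, Nat.choose_one_right] at h2
  exact hs ((Nat.modEq_zero_iff_dvd).1 (h2.symm.trans ((Nat.modEq_zero_iff_dvd).2 h1)))

/-- An additive and `k`-linear polynomial over a `k`-algebra is a linear combination of the
monomials `X ^ qⁱ` with `q` the cardinality of `k`. -/
theorem exists_eq_twPoly (f : k →+* B) (P : B[X])
    (hadd : (P.map C).comp (X + C X) = P.map C + C P)
    (hlin : ∀ t : k, P.comp (C (f t) * X) = C (f t) * P) :
    ∃ b : ℕ →₀ B, P = twPoly (Nat.card k) b := by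
  classical
  rcases subsingleton_or_nontrivial B with hB | hB
  · exact ⟨0, Subsingleton.elim _ _⟩
  cases nonempty_fintype k
  obtain ⟨n, hp, hc⟩ := FiniteField.card k (ringChar k)
  set p := ringChar k
  have : Fact p.Prime := ⟨hp⟩
  have : CharP B p := charP_of_injective_ringHom f.injective _
  have hq : Nat.card k = p ^ (n : ℕ) := by rw [Nat.card_eq_fintype_card, hc]
  -- the binomial coefficients kill the coefficients whose index is not a power of `p`
  have h1 : ∀ m i, 0 < i → i < m → (m.choose i : B) * P.coeff m = 0 := fun m i hi hm => by
    have e1 : (taylor (X : B[X]) (P.map C)).coeff i = C (P.coeff i) := by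
      rw [taylor_apply, hadd, coeff_add, coeff_map, coeff_C, if_neg hi.ne', add_zero]
    rw [taylor_coeff] at e1
    have e2 : (hasseDeriv i (P.map C)).eval (X : B[X]) = hasseDeriv i P := by
      have : hasseDeriv i (P.map C) = (hasseDeriv i P).map C := by
        ext1 j
        simp only [hasseDeriv_coeff, coeff_map, map_mul, map_natCast]
      rw [this, Polynomial.eval_map]
      exact eval₂_C_X
    rw [e2] at e1
    have e3 := congrArg (coeff · (m - i)) e1
    simp only [hasseDeriv_coeff, coeff_C] at e3
    rwa [if_neg (by omega), Nat.sub_add_cancel hm.le] at e3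
  have h2 : ∀ m, P.coeff m ≠ 0 → ∃ v, m = p ^ v := fun m hm => by
    have hm0 : m ≠ 0 := by
      rintro rfl
      have := congrArg (fun F => (F.coeff 0).coeff 0) hadd
      have e : (((P.map C).comp (X + C X)).coeff 0).coeff 0 = P.coeff 0 := by
        rw [← taylor_apply, taylor_coeff_zero, Polynomial.eval_map, eval₂_C_X]
      simp only [e, coeff_add, coeff_map, coeff_C_zero] at this
      exact hm (by simpa using this)
    refine exists_eq_pow_of_choose_eq_zero p hm0 fun i hi him => ?_
    by_contra hnd
    have hu : IsUnit ((m.choose i : ℕ) : B) := by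
      have : ((m.choose i : ℕ) : B) = f ((m.choose i : ℕ) : k) := (map_natCast f _).symm
      rw [this]
      refine (IsUnit.mk0 _ fun h0 => hnd ?_).map f
      exact (CharP.cast_eq_zero_iff k p _).1 h0
    exact hm ((hu.mul_right_eq_zero).1 (h1 m i hi him))
  -- linearity over a generator of `kˣ` leaves only the powers of `q`
  obtain ⟨g, hg⟩ := IsCyclic.exists_generator (α := kˣ)
  have h3 : ∀ m, P.coeff m ≠ 0 → (g : k) ^ m = g := fun m hm => by
    have e := congrArg (coeff · m) (hlin g)
    simp only [comp_C_mul_X_coeff, coeff_C_mul] at e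
    by_contra hne
    have hu : IsUnit (f ((g : k) ^ m - g)) := (IsUnit.mk0 _ (sub_ne_zero.2 hne)).map f
    refine hm ((hu.mul_right_eq_zero).1 ?_)
    rw [map_sub, map_pow, sub_mul, sub_eq_zero, mul_comm, e]
  have h4 : ∀ m, P.coeff m ≠ 0 → ∃ i, m = Nat.card k ^ i := fun m hm => by
    obtain ⟨v, rfl⟩ := h2 m hm
    have e := h3 _ hm
    have hord : orderOf g = p ^ (n : ℕ) - 1 := by
      rw [orderOf_eq_card_of_forall_mem_zpowers hg, Nat.card_units, hq]
    have e' : g ^ (p ^ v - 1) = 1 := by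
      have : g ^ (p ^ v - 1) * g = 1 * g := by
        rw [← pow_succ, Nat.sub_add_cancel (Nat.one_le_pow _ _ hp.pos), one_mul]
        exact Units.ext (by simpa using e)
      exact mul_right_cancel this
    have hdvd : p ^ (n : ℕ) - 1 ∣ p ^ v - 1 := hord ▸ orderOf_dvd_of_pow_eq_one e'
    have hg' := Nat.pow_sub_one_gcd_pow_sub_one p n v
    rw [Nat.gcd_eq_left hdvd] at hg'
    have h5 : p ^ (n : ℕ) = p ^ Nat.gcd n v := by
      have a1 := Nat.one_le_pow (n : ℕ) p hp.pos
      have a2 := Nat.one_le_pow (Nat.gcd n v) p hp.pos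
      omega
    have h6 : (n : ℕ) = Nat.gcd n v := Nat.pow_right_injective hp.two_le h5
    obtain ⟨j, rfl⟩ : (n : ℕ) ∣ v := h6 ▸ Nat.gcd_dvd_right _ _
    exact ⟨j, by rw [hq, ← pow_mul]⟩
  have hinj : Function.Injective fun i : ℕ => Nat.card k ^ i :=
    Nat.pow_right_injective (Finite.one_lt_card (α := k))
  refine ⟨P.toFinsupp.coeff.comapDomain (fun i : ℕ => Nat.card k ^ i) hinj.injOn, ?_⟩
  ext m
  by_cases hm : ∃ i, m = Nat.card k ^ i
  · obtain ⟨i, rfl⟩ := hm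
    rw [twPoly_coeff (Finite.one_lt_card (α := k)), Finsupp.comapDomain_apply]
    rfl
  · push Not at hm
    rw [twPoly_coeff_of_ne _ _ hm]
    by_contra h
    obtain ⟨i, hi⟩ := h4 m h
    exact hm i hi

end Additive

/-! ### The ring of extensions of a twisted action -/

section Commuting

open Finset.HasAntidiagonal

variable {B : Type*} [CommRing B]

lemma eq_zero_of_eq_mul_pow {x w : B} {n : ℕ} (hn : 1 < n) (h : x = w * x ^ n)
    (hx : IsNilpotent x) : x = 0 := by
  obtain ⟨m, rfl⟩ := Nat.exists_eq_add_of_lt hn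
  have hu : IsUnit (1 - w * x ^ (m + 1)) :=
    ((Commute.all _ _).isNilpotent_mul_left (hx.pow_of_pos (Nat.succ_ne_zero m))).isUnit_one_sub
  have e : (1 - w * x ^ (m + 1)) * x = 0 := by
    have : w * x ^ (1 + m + 1) = w * x ^ (m + 1) * x := by ring
    rw [sub_mul, one_mul, ← this, ← h, sub_self]
  exact (hu.mul_right_eq_zero).1 e

/-- The top coefficient of a twisted polynomial commuting with a twisted polynomial of degree
exactly `N`. -/
lemma top_coeff_of_commute {q : ℕ} (hq : q ≠ 0) {N : ℕ} {b c : ℕ →₀ B}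
    (hc : ∀ i, N < i → c i = 0) (hbc : twMul q b c = twMul q c b) {i : ℕ}
    (hi : ∀ j, i < j → b j = 0) : b i * c N ^ q ^ i = c N * b i ^ q ^ N := by
  have e := congrArg (fun f : ℕ →₀ B => f (N + i)) hbc
  simp only [twMul_apply q hq] at e
  have h0 : ∀ j, q ^ j ≠ 0 := fun j => pow_ne_zero _ hq
  rw [Finset.sum_eq_single (i, N), Finset.sum_eq_single (N, i)] at e
  · exact e
  · rintro ⟨s, t⟩ hp hne
    rw [mem_antidiagonal] at hp
    simp only at hp
    rcases lt_trichotomy s N with h | h | h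
    · rw [hi t (by omega), zero_pow (h0 _), mul_zero]
    · exact absurd (by rw [h, show t = i by omega]) hne
    · rw [hc s h, zero_mul]
  · exact fun h => absurd (mem_antidiagonal.2 (rfl : N + i = N + i)) h
  · rintro ⟨s, t⟩ hp hne
    rw [mem_antidiagonal] at hp
    simp only at hp
    rcases lt_trichotomy s i with h | h | h
    · rw [hc t (by omega), zero_pow (h0 _), mul_zero]
    · exact absurd (by rw [h, show t = N by omega]) hne
    · rw [hi s h, zero_mul]
  · exact fun h => absurd (mem_antidiagonal.2 (add_comm i N)) h

/-- Nilpotent high coefficients vanish in a twisted polynomial which commutes with one of degree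
exactly `N > 0` with unit leading coefficient `u`: the top one satisfies `b u ^ q ^ m = u b ^ q ^ N`. -/
lemma coeff_eq_zero_of_commute {q : ℕ} (hq : 1 < q) {N : ℕ} (hN : 0 < N) {b c : ℕ →₀ B}
    (hcN : IsUnit (c N)) (hc : ∀ i, N < i → c i = 0) (hbc : twMul q b c = twMul q c b) {D : ℤ}
    (hb : ∀ i : ℕ, D < i → IsNilpotent (b i)) (i : ℕ) (hi : D < i) : b i = 0 := by
  by_contra hne
  have hmem : i ∈ b.support := Finsupp.mem_support_iff.2 hne
  set m := b.support.max' ⟨i, hmem⟩ with hm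
  have him : i ≤ m := Finset.le_max' _ _ hmem
  have hbm : b m ≠ 0 := Finsupp.mem_support_iff.1 (Finset.max'_mem _ _)
  have htop : ∀ j, m < j → b j = 0 := fun j hj => by
    by_contra h
    exact absurd (Finset.le_max' _ _ (Finsupp.mem_support_iff.2 h)) (not_le.2 hj)
  have e := top_coeff_of_commute (by omega) hc hbc htop
  obtain ⟨z, hz⟩ := (hcN.pow (q ^ m)).exists_right_inv
  refine hbm (eq_zero_of_eq_mul_pow (w := z * c N) (n := q ^ N) (Nat.one_lt_pow hN.ne' hq) ?_
    (hb m (by omega)))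
  rw [mul_assoc, ← e, mul_left_comm, mul_comm z, hz, mul_one]

/-- If the leading coefficient is a unit, commutation determines its `q ^ N - 1`-st power. Unlike being
a unit, this is an equation. -/
lemma unit_coeff_of_commute {q : ℕ} (hq : 1 < q) {N : ℕ} {b c : ℕ →₀ B}
    (hcN : IsUnit (c N)) (hc : ∀ i, N < i → c i = 0) (hbc : twMul q b c = twMul q c b) {i : ℕ}
    (hb : ∀ j, i < j → b j = 0) (hu : IsUnit (b i)) : b i ^ (q ^ N - 1) = c N ^ (q ^ i - 1) := by
  have e := top_coeff_of_commute (by omega) hc hbc hb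
  obtain ⟨m, hm⟩ := Nat.exists_eq_add_of_lt (Nat.pow_pos (n := i) (show 0 < q by omega))
  obtain ⟨m', hm'⟩ := Nat.exists_eq_add_of_lt (Nat.pow_pos (n := N) (show 0 < q by omega))
  rw [hm, hm', zero_add, zero_add, pow_succ, pow_succ] at e
  rw [hm, hm', zero_add, zero_add, Nat.add_sub_cancel, Nat.add_sub_cancel]
  refine (hu.mul hcN).mul_left_cancel ?_
  calc b i * c N * b i ^ m' = c N * (b i ^ m' * b i) := by ring
    _ = b i * (c N ^ m * c N) := e.symm
    _ = b i * c N * c N ^ m := by ring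

end Commuting

section Universal

open Finset.HasAntidiagonal

variable {A A' B : Type u} [CommRing A] [CommRing A'] [CommRing B]

/-- The relations on a family of coefficients `δ a i` expressing that `a ↦ ∑ δ a i τⁱ` is a ring
homomorphism on `A'` which extends `a ↦ ∑ Φ a i τⁱ` on `A` and in which a nonzero `a` has degree at
most `d' a`, with a unit as coefficient at `d' a`. The last condition is stated as the equation
that it is equivalent to, given that the image of `A` has an element of degree exactly `N` and
leading coefficient the unit `v`. -/
structure TwistedExtension (q : ℕ) (ρ : A →+* A') (Φ : A → ℕ →₀ B) (d' : A' → ℤ) (N : ℕ) (v : B)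
    {R : Type u} [CommRing R] (g : B →+* R) (δ : A' → ℕ → R) : Prop where
  one : ∀ i, δ 1 i = if i = 0 then 1 else 0
  add : ∀ a b i, δ (a + b) i = δ a i + δ b i
  mul : ∀ a b n, δ (a * b) n = ∑ p ∈ antidiagonal n, δ a p.1 * δ b p.2 ^ q ^ p.1
  restrict : ∀ a i, δ (ρ a) i = g (Φ a i)
  degree_le : ∀ a (i : ℕ), a ≠ 0 → d' a < i → δ a i = 0
  leading : ∀ a (i : ℕ), a ≠ 0 → (i : ℤ) = d' a → δ a i ^ (q ^ N - 1) = g v ^ (q ^ i - 1)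

variable {q : ℕ} {ρ : A →+* A'} {Φ : A → ℕ →₀ B} {d' : A' → ℤ} {N : ℕ} {v : B}

namespace TwistedExtension

variable {R : Type u} [CommRing R] {g : B →+* R} {δ : A' → ℕ → R}

lemma zero (h : TwistedExtension q ρ Φ d' N v g δ) (i : ℕ) : δ 0 i = 0 := by
  have := h.add 0 0 i
  rwa [add_zero, left_eq_add] at this

lemma isUnit_leading (h : TwistedExtension q ρ Φ d' N v g δ) (hq : 1 < q) (hN : 0 < N)
    (hv : IsUnit v) (a : A') (i : ℕ) (ha : a ≠ 0) (hi : (i : ℤ) = d' a) : IsUnit (δ a i) := by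
  have h1 : 1 < q ^ N := Nat.one_lt_pow hN.ne' hq
  exact (isUnit_pow_iff (n := q ^ N - 1) (by omega)).1
    ((h.leading a i ha hi) ▸ ((hv.map g).pow _))

lemma eq_zero_of_toNat_lt (h : TwistedExtension q ρ Φ d' N v g δ) (a : A') (i : ℕ)
    (hi : (d' a).toNat < i) : δ a i = 0 := by
  by_cases ha : a = 0
  · rw [ha, h.zero]
  · exact h.degree_le a i ha (by omega)

/-- The coefficients as a finitely supported family. -/
noncomputable def coeffs (h : TwistedExtension q ρ Φ d' N v g δ) (a : A') : ℕ →₀ R :=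
  Finsupp.onFinset (Finset.range ((d' a).toNat + 1)) (δ a) fun i hi => by
    by_contra hn
    rw [Finset.mem_range] at hn
    exact hi (h.eq_zero_of_toNat_lt a i (by omega))

lemma coeffs_apply (h : TwistedExtension q ρ Φ d' N v g δ) (a : A') (i : ℕ) :
    h.coeffs a i = δ a i := rfl

lemma coeffs_one (h : TwistedExtension q ρ Φ d' N v g δ) : h.coeffs 1 = Finsupp.single 0 1 := by
  classical
  ext i
  rw [coeffs_apply, h.one, Finsupp.single_apply]
  simp only [eq_comm]

lemma coeffs_add (h : TwistedExtension q ρ Φ d' N v g δ) (a b : A') :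
    h.coeffs (a + b) = h.coeffs a + h.coeffs b := Finsupp.ext fun i => h.add a b i

lemma coeffs_mul (h : TwistedExtension q ρ Φ d' N v g δ) (hq : q ≠ 0) (a b : A') :
    h.coeffs (a * b) = twMul q (h.coeffs a) (h.coeffs b) := Finsupp.ext fun i => by
  rw [twMul_apply q hq]; exact h.mul a b i

lemma coeffs_restrict (h : TwistedExtension q ρ Φ d' N v g δ) (a : A) :
    h.coeffs (ρ a) = (Φ a).mapRange g (map_zero g) := Finsupp.ext fun i => by
  rw [Finsupp.mapRange_apply]; exact h.restrict a i

/-- The constant coefficients form a ring homomorphism. -/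
noncomputable def constantCoeff (h : TwistedExtension q ρ Φ d' N v g δ) : A' →+* R where
  toFun a := δ a 0
  map_one' := by rw [h.one, if_pos rfl]
  map_zero' := h.zero 0
  map_add' a b := h.add a b 0
  map_mul' a b := by
    rw [h.mul, Finset.Nat.antidiagonal_zero, Finset.sum_singleton, pow_zero, pow_one]

end TwistedExtension

lemma mem_integralClosure_of_pow_eq {R : Type*} [CommRing R] [Algebra B R] {x a b : R} {n : ℕ}
    (hn : 1 < n) (ha : a ∈ integralClosure B R) (hb : b ∈ integralClosure B R)
    (h : x ^ n = a * x + b) : x ∈ integralClosure B R := by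
  refine isIntegral_trans (A := integralClosure B R) x ?_
  let α : integralClosure B R := ⟨a, ha⟩
  let β : integralClosure B R := ⟨b, hb⟩
  refine ⟨Polynomial.X ^ n - (Polynomial.C α * Polynomial.X + Polynomial.C β), ?_, ?_⟩
  · exact Polynomial.monic_X_pow_sub ((Polynomial.degree_linear_le).trans_lt
      (by exact_mod_cast hn))
  · simp only [Polynomial.eval₂_sub, Polynomial.eval₂_pow, Polynomial.eval₂_X,
      Polynomial.eval₂_add, Polynomial.eval₂_mul, Polynomial.eval₂_C]
    exact sub_eq_zero.2 h

/-- Comparing coefficients in `δ a · φ(a₀) = φ(a₀) · δ a` from the top, each coefficient satisfies a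
monic equation over the ring generated by the previous ones. -/
theorem TwistedExtension.isIntegral {R : Type u} [CommRing R] [Algebra B R] {δ : A' → ℕ → R}
    (h : TwistedExtension q ρ Φ d' N v (algebraMap B R) δ) (hq : 1 < q) (hN : 0 < N)
    (hv : IsUnit v) {a₀ : A} (h₀ : Φ a₀ N = v) (h₀' : ∀ i, N < i → Φ a₀ i = 0)
    (a : A') (j : ℕ) : IsIntegral B (δ a j) := by
  have hq0 : q ≠ 0 := by omega
  have hpow : ∀ j, q ^ j ≠ 0 := fun j => pow_ne_zero _ hq0
  set S₀ := integralClosure B R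
  have hB : ∀ x : B, algebraMap B R x ∈ S₀ := fun x => S₀.algebraMap_mem x
  -- Descending induction on `j`, starting beyond the degree of `δ a`.
  suffices H : ∀ t j, (d' a).toNat < j + t → δ a j ∈ S₀ from H ((d' a).toNat + 1) j (by omega)
  intro t
  induction t with
  | zero => exact fun j hj => by rw [h.eq_zero_of_toNat_lt a j hj]; exact S₀.zero_mem
  | succ t ih =>
    intro j hj
    replace ih : ∀ i, j < i → δ a i ∈ S₀ := fun i hi => ih i (by omega)
    -- In degree `N + j` the terms `δ a j · v ^ q ^ j` and `v · (δ a j) ^ q ^ N` stand out: all others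
    -- vanish or involve only coefficients of `δ a` beyond `j`.
    have e : δ (a * ρ a₀) (N + j) = δ (ρ a₀ * a) (N + j) := by rw [mul_comm]
    rw [h.mul, h.mul] at e
    simp only [h.restrict] at e
    rw [← Finset.add_sum_erase _ _ (show (j, N) ∈ antidiagonal (N + j) from
        mem_antidiagonal.2 (add_comm _ _)),
      ← Finset.add_sum_erase _ (fun p : ℕ × ℕ => algebraMap B R (Φ a₀ p.1) * δ a p.2 ^ q ^ p.1)
        (show (N, j) ∈ antidiagonal (N + j) from mem_antidiagonal.2 rfl)] at e
    set s := ∑ p ∈ (antidiagonal (N + j)).erase (j, N),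
      δ a p.1 * (algebraMap B R (Φ a₀ p.2)) ^ q ^ p.1 with hs
    set s' := ∑ p ∈ (antidiagonal (N + j)).erase (N, j),
      algebraMap B R (Φ a₀ p.1) * δ a p.2 ^ q ^ p.1 with hs'
    have hsS : s ∈ S₀ := S₀.sum_mem fun p hp => by
      obtain ⟨hne, hp⟩ := Finset.mem_erase.1 hp
      rw [mem_antidiagonal] at hp
      rcases lt_trichotomy p.1 j with h1 | h1 | h1
      · rw [h₀' _ (by omega), map_zero, zero_pow (hpow _), mul_zero]
        exact S₀.zero_mem
      · exact absurd (Prod.ext h1 (by simp; omega)) hne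
      · exact S₀.mul_mem (ih _ h1) (S₀.pow_mem (hB _) _)
    have hsS' : s' ∈ S₀ := S₀.sum_mem fun p hp => by
      obtain ⟨hne, hp⟩ := Finset.mem_erase.1 hp
      rw [mem_antidiagonal] at hp
      rcases lt_trichotomy p.1 N with h1 | h1 | h1
      · exact S₀.mul_mem (hB _) (S₀.pow_mem (ih _ (by omega)) _)
      · exact absurd (Prod.ext h1 (by simp; omega)) hne
      · rw [h₀' _ (by omega), map_zero, zero_mul]
        exact S₀.zero_mem
    obtain ⟨z, hz⟩ := hv.exists_right_inv
    have hz' : algebraMap B R v * algebraMap B R z = 1 := by rw [← map_mul, hz, map_one]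
    simp only [h₀] at e
    refine mem_integralClosure_of_pow_eq (B := B) (n := q ^ N)
      (a := algebraMap B R z * algebraMap B R v ^ q ^ j) (b := algebraMap B R z * (s - s'))
      (Nat.one_lt_pow hN.ne' hq) (S₀.mul_mem (hB _) (S₀.pow_mem (hB _) _))
      (S₀.mul_mem (hB _) (S₀.sub_mem hsS hsS')) ?_
    calc δ a j ^ q ^ N = algebraMap B R v * algebraMap B R z * δ a j ^ q ^ N := by
          rw [hz', one_mul]
      _ = algebraMap B R z * (algebraMap B R v * δ a j ^ q ^ N + s') -
          algebraMap B R z * s' := by ring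
      _ = _ := by rw [← e]; ring

/-- A ring generated by the coefficients of a twisted extension is finite. -/
theorem TwistedExtension.finite {R : Type u} [CommRing R] [Algebra B R] {δ : A' → ℕ → R}
    (h : TwistedExtension q ρ Φ d' N v (algebraMap B R) δ) (hq : 1 < q) (hN : 0 < N)
    (hv : IsUnit v) {a₀ : A} (h₀ : Φ a₀ N = v) (h₀' : ∀ i, N < i → Φ a₀ i = 0)
    (hρ : ρ.FiniteType)
    (hgen : Algebra.adjoin B (Set.range fun p : A' × ℕ => δ p.1 p.2) = ⊤) :
    Module.Finite B R := by
  classical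
  algebraize [ρ]
  obtain ⟨G, hG⟩ := (inferInstance : Algebra.FiniteType A A').1
  -- The coefficients of finitely many generators of `A'`, of index at most their degree, suffice.
  let F : Set R := ⋃ x ∈ G, (fun i => δ x i) '' (Set.Iic (d' x).toNat)
  have hF : F.Finite := Set.Finite.biUnion G.finite_toSet fun x _ => (Set.finite_Iic _).image _
  set S₁ := Algebra.adjoin B F
  have hG' : ∀ x ∈ G, ∀ i, δ x i ∈ S₁ := fun x hx i => by
    by_cases hi : i ≤ (d' x).toNat
    · exact Algebra.subset_adjoin (Set.mem_biUnion (Finset.mem_coe.2 hx) ⟨i, hi, rfl⟩)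
    · rw [h.eq_zero_of_toNat_lt x i (by omega)]; exact S₁.zero_mem
  have hall : ∀ a i, δ a i ∈ S₁ := fun a => by
    have ha : a ∈ Algebra.adjoin A (G : Set A') := hG ▸ Algebra.mem_top
    induction ha using Algebra.adjoin_induction with
    | mem x hx => exact hG' x hx
    | algebraMap r =>
      intro i
      rw [show algebraMap A A' r = ρ r from rfl, h.restrict r i]
      exact S₁.algebraMap_mem _
    | add x y _ _ hx hy => exact fun i => by rw [h.add]; exact S₁.add_mem (hx i) (hy i)
    | mul x y _ _ hx hy =>
        intro i
        rw [h.mul]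
        exact S₁.sum_mem fun p _ => S₁.mul_mem (hx _) (S₁.pow_mem (hy _) _)
  have htop : S₁ = ⊤ := top_le_iff.1 (hgen ▸ Algebra.adjoin_le (by
    rintro _ ⟨p, rfl⟩
    exact hall p.1 p.2))
  refine ⟨?_⟩
  have := fg_adjoin_of_finite (R := B) hF (by
    intro x hx
    obtain ⟨y, hy, i, -, rfl⟩ := Set.mem_iUnion₂.1 hx
    exact h.isIntegral hq hN hv h₀ h₀' y i)
  change (Subalgebra.toSubmodule S₁).FG at this
  rwa [htop, Algebra.top_toSubmodule] at this

variable (q ρ Φ d' N v) in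
/-- The ideal of all polynomial relations between the coefficients of twisted extensions. -/
noncomputable def twistedExtensionIdeal : Ideal (MvPolynomial (A' × ℕ) B) :=
  sInf {I | ∃ (R : CommRingCat.{u}) (g : B →+* R) (δ : A' → ℕ → R),
    TwistedExtension q ρ Φ d' N v g δ ∧
      I = RingHom.ker (MvPolynomial.eval₂Hom g fun p : A' × ℕ => δ p.1 p.2)}

variable (q ρ Φ d' N v) in
/-- The ring carrying the universal twisted extension. -/
abbrev twistedExtensionRing : Type u :=
  MvPolynomial (A' × ℕ) B ⧸ twistedExtensionIdeal q ρ Φ d' N v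

variable (q ρ Φ d' N v) in
/-- The coefficients of the universal twisted extension. -/
noncomputable def universalCoeff (a : A') (i : ℕ) : twistedExtensionRing q ρ Φ d' N v :=
  Ideal.Quotient.mk _ (MvPolynomial.X (a, i))

variable (q ρ Φ d' N v) in
/-- The structure map of the ring of twisted extensions. -/
noncomputable def universalBase : B →+* twistedExtensionRing q ρ Φ d' N v :=
  (Ideal.Quotient.mk _).comp MvPolynomial.C

lemma twistedExtension_mk_eq {x y : MvPolynomial (A' × ℕ) B}
    (h : ∀ (R : CommRingCat.{u}) (g : B →+* R) (δ : A' → ℕ → R),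
      TwistedExtension q ρ Φ d' N v g δ →
        MvPolynomial.eval₂Hom g (fun p : A' × ℕ => δ p.1 p.2) x =
          MvPolynomial.eval₂Hom g (fun p : A' × ℕ => δ p.1 p.2) y) :
    Ideal.Quotient.mk (twistedExtensionIdeal q ρ Φ d' N v) x = Ideal.Quotient.mk _ y := by
  rw [Ideal.Quotient.eq, twistedExtensionIdeal, Ideal.mem_sInf]
  rintro I ⟨R, g, δ, hδ, rfl⟩
  rw [RingHom.mem_ker, map_sub, h R g δ hδ, sub_self]

/-- Every defining relation holds universally, since `twistedExtensionIdeal` contains all polynomials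
that vanish on all twisted extensions. That ideal is therefore also the one generated by the defining
relations. -/
lemma universal_twistedExtension :
    TwistedExtension q ρ Φ d' N v (universalBase q ρ Φ d' N v) (universalCoeff q ρ Φ d' N v) where
  one i := by
    have h1 : (if i = 0 then 1 else 0 : twistedExtensionRing q ρ Φ d' N v) =
        Ideal.Quotient.mk _ (if i = 0 then 1 else 0) := by split_ifs <;> simp
    rw [h1]
    exact twistedExtension_mk_eq fun R g δ hδ => by
      rw [MvPolynomial.coe_eval₂Hom, MvPolynomial.eval₂_X, hδ.one]
      split_ifs <;> simp
  add a b i := by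
    simp only [universalCoeff]
    rw [← map_add]
    exact twistedExtension_mk_eq fun R g δ hδ => by simp [hδ.add]
  mul a b n := by
    simp only [universalCoeff, ← map_pow, ← map_mul, ← map_sum]
    exact twistedExtension_mk_eq fun R g δ hδ => by
      rw [map_sum]; simp [hδ.mul]
  restrict a i := by
    simp only [universalCoeff, universalBase, RingHom.comp_apply]
    exact twistedExtension_mk_eq fun R g δ hδ => by simp [hδ.restrict]
  degree_le a i ha hi := by
    simp only [universalCoeff]
    rw [← map_zero (Ideal.Quotient.mk _)]
    exact twistedExtension_mk_eq fun R g δ hδ => by simp [hδ.degree_le a i ha hi]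
  leading a i ha hi := by
    simp only [universalCoeff, universalBase, RingHom.comp_apply, ← map_pow]
    exact twistedExtension_mk_eq fun R g δ hδ => by
      rw [map_pow, map_pow]; simp [hδ.leading a i ha hi]

/-- The homomorphism classifying a twisted extension. -/
noncomputable def TwistedExtension.lift {R : Type u} [CommRing R] {g : B →+* R} {δ : A' → ℕ → R}
    (h : TwistedExtension q ρ Φ d' N v g δ) : twistedExtensionRing q ρ Φ d' N v →+* R :=
  Ideal.Quotient.lift _ (MvPolynomial.eval₂Hom g fun p : A' × ℕ => δ p.1 p.2) fun _ hx =>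
    (Ideal.mem_sInf.1 hx) ⟨CommRingCat.of R, g, δ, h, rfl⟩

lemma TwistedExtension.lift_coeff {R : Type u} [CommRing R] {g : B →+* R} {δ : A' → ℕ → R}
    (h : TwistedExtension q ρ Φ d' N v g δ) (a : A') (i : ℕ) :
    h.lift (universalCoeff q ρ Φ d' N v a i) = δ a i :=
  (Ideal.Quotient.lift_mk _ _ _).trans (MvPolynomial.eval₂_X _ _ _)

lemma TwistedExtension.lift_base {R : Type u} [CommRing R] {g : B →+* R} {δ : A' → ℕ → R}
    (h : TwistedExtension q ρ Φ d' N v g δ) : h.lift.comp (universalBase q ρ Φ d' N v) = g := by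
  ext b
  exact MvPolynomial.eval₂_C g _ b

lemma twistedExtensionRing_hom_ext {R : Type u} [CommRing R]
    {e e' : twistedExtensionRing q ρ Φ d' N v →+* R}
    (h : e.comp (universalBase q ρ Φ d' N v) = e'.comp (universalBase q ρ Φ d' N v))
    (h' : ∀ a i, e (universalCoeff q ρ Φ d' N v a i) = e' (universalCoeff q ρ Φ d' N v a i)) :
    e = e' := by
  refine Ideal.Quotient.ringHom_ext (MvPolynomial.ringHom_ext (fun b => ?_) (fun p => h' p.1 p.2))
  exact RingHom.congr_fun h b

lemma universalBase_finite (hq : 1 < q) (hN : 0 < N)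
    (hv : IsUnit v) {a₀ : A} (h₀ : Φ a₀ N = v) (h₀' : ∀ i, N < i → Φ a₀ i = 0)
    (hρ : ρ.FiniteType) : (universalBase q ρ Φ d' N v).Finite := by
  let := (universalBase q ρ Φ d' N v).toAlgebra
  refine TwistedExtension.finite (δ := universalCoeff q ρ Φ d' N v)
    universal_twistedExtension hq hN hv h₀ h₀' hρ (top_le_iff.1 fun x _ => ?_)
  obtain ⟨x, rfl⟩ := Ideal.Quotient.mk_surjective x
  induction x using MvPolynomial.induction_on with
  | C b => exact Subalgebra.algebraMap_mem _ b
  | add x y hx hy =>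
    rw [map_add]
    exact Subalgebra.add_mem _ (hx trivial) (hy trivial)
  | mul_X x p hx =>
    rw [map_mul]
    exact Subalgebra.mul_mem _ (hx trivial) (Algebra.subset_adjoin ⟨p, rfl⟩)

end Universal

/-! ### Coordinates over affine schemes -/

open scoped MonObj

section Gamma

variable {T T' : Scheme.{u}} {B B' : CommRingCat.{u}}

/-- The ring homomorphism `B → Γ(T, 𝒪_T)` corresponding to `t : T ⟶ Spec B`. -/
noncomputable def toGamma (t : T ⟶ Spec B) : B →+* Γ(T, ⊤) :=
  ((Scheme.ΓSpecIso B).inv ≫ t.appTop).hom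

lemma toGamma_comp (h : T' ⟶ T) (t : T ⟶ Spec B) :
    toGamma (h ≫ t) = h.appTop.hom.comp (toGamma t) := by
  rw [toGamma, toGamma, Scheme.Hom.comp_appTop, ← Category.assoc, CommRingCat.hom_comp]

lemma toGamma_comp_map (t : T ⟶ Spec B') (g : B ⟶ B') :
    toGamma (t ≫ Spec.map g) = (toGamma t).comp g.hom := by
  rw [toGamma, toGamma, Scheme.Hom.comp_appTop, ← Category.assoc,
    ← Scheme.ΓSpecIso_inv_naturality, Category.assoc, CommRingCat.hom_comp]

lemma toGamma_map (g : B ⟶ B') :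
    toGamma (Spec.map g) = (Scheme.ΓSpecIso B').inv.hom.comp g.hom := by
  rw [toGamma, ← Scheme.ΓSpecIso_inv_naturality, CommRingCat.hom_comp]

/-- The morphism `T ⟶ Spec B` corresponding to a ring homomorphism `B → Γ(T, 𝒪_T)`. -/
noncomputable def ofGamma (g : B →+* Γ(T, ⊤)) : T ⟶ Spec B :=
  T.toSpecΓ ≫ Spec.map (CommRingCat.ofHom g)

lemma toGamma_ofGamma (g : B →+* Γ(T, ⊤)) : toGamma (ofGamma g) = g := by
  rw [ofGamma, toGamma_comp_map, toGamma, Scheme.toSpecΓ_appTop, Iso.inv_hom_id]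
  rfl

lemma toGamma_injective {t t' : T ⟶ Spec B} (h : toGamma t = toGamma t') : t = t' := by
  apply ext_of_isAffine
  have := CommRingCat.hom_ext h
  exact (cancel_epi _).1 this

lemma toGamma_preimage (t : T ⟶ Spec B') (h : Spec B' ⟶ Spec B) :
    toGamma (t ≫ h) = (toGamma t).comp (Spec.preimage h).hom := by
  rw [← toGamma_comp_map, Spec.map_preimage]

end Gamma

section Points

variable {S : Scheme.{u}} {B B' : CommRingCat.{u}} {j : Spec B ⟶ S}

/-- The ring homomorphism `B → Γ(T, 𝒪_T)` corresponding to an `S`-morphism `t : T ⟶ Spec B`. -/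
noncomputable def scalarHom {T : Over S} (t : T ⟶ Over.mk j) : B →+* Γ(T.left, ⊤) :=
  toGamma (T := T.left) t.left

lemma scalarHom_comp {T T' : Over S} (g : T' ⟶ T) (t : T ⟶ Over.mk j) :
    scalarHom (g ≫ t) = g.left.appTop.hom.comp (scalarHom t) :=
  toGamma_comp _ _

section SpecOver

variable (j) {R : Type u} [CommRing R] (g : B →+* R)

/-- The affine `S`-scheme `Spec R` for a `B`-algebra `R`, where `Spec B` is an `S`-scheme by `j`. -/
noncomputable def specOver : Over S := Over.mk (Spec.map (CommRingCat.ofHom g) ≫ j)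

/-- The structure morphism of `specOver`. -/
noncomputable def specOverMap : specOver j g ⟶ Over.mk j :=
  Over.homMk (Spec.map (CommRingCat.ofHom g)) rfl

/-- The identification of `R` with the functions on `Spec R`. -/
noncomputable def specOverEquiv : R ≃+* Γ((specOver j g).left, ⊤) :=
  (Scheme.ΓSpecIso (CommRingCat.of R)).symm.commRingCatIsoToRingEquiv

lemma scalarHom_specOverMap :
    scalarHom (specOverMap j g) = (specOverEquiv j g).toRingHom.comp g :=
  toGamma_map (CommRingCat.ofHom g)

lemma eval₂_specOver (F : Polynomial B) (x : R) :
    F.eval₂ (scalarHom (specOverMap j g)) (specOverEquiv j g x) =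
      specOverEquiv j g (F.eval₂ g x) := by
  rw [scalarHom_specOverMap]
  exact (Polynomial.hom_eval₂ F g (specOverEquiv j g).toRingHom x).symm

end SpecOver

open Polynomial

/-- An operation on functions, given for all `T ⟶ Spec B` and natural in `T`, is given by
a polynomial with coefficients in `B`: its value at the variable of `B[X]`. -/
theorem exists_polynomial (θ : ∀ T : Over S, (T ⟶ Over.mk j) → Γ(T.left, ⊤) → Γ(T.left, ⊤))
    (hθ : ∀ (T T' : Over S) (g : T' ⟶ T) (t : T ⟶ Over.mk j) (z : Γ(T.left, ⊤)),
      θ T' (g ≫ t) (g.left.appTop.hom z) = g.left.appTop.hom (θ T t z)) :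
    ∃ Q : B[X], ∀ (T : Over S) (t : T ⟶ Over.mk j) (z : Γ(T.left, ⊤)),
      θ T t z = Q.eval₂ (scalarHom t) z := by
  let e := specOverEquiv j (C : B →+* B[X])
  refine ⟨e.symm (θ _ (specOverMap j C) (e X)), fun T t z => ?_⟩
  let h : B[X] →+* Γ(T.left, ⊤) := eval₂RingHom (scalarHom t) z
  let r : T.left ⟶ Spec (CommRingCat.of B[X]) := ofGamma (B := CommRingCat.of B[X]) h
  have hr : r ≫ Spec.map (CommRingCat.ofHom C) = t.left := by
    apply toGamma_injective
    rw [toGamma_comp_map, toGamma_ofGamma]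
    ext b
    exact eval₂_C _ _
  let r' : T ⟶ specOver j C := Over.homMk r (by
    change r ≫ Spec.map (CommRingCat.ofHom C) ≫ j = T.hom
    rw [← Category.assoc, hr]
    exact Over.w t)
  have hr' : r' ≫ specOverMap j C = t := Over.OverMorphism.ext hr
  have key : ∀ x : B[X], r'.left.appTop.hom (e x) = h x := fun x =>
    RingHom.congr_fun (toGamma_ofGamma (B := CommRingCat.of B[X]) h) x
  have := hθ _ _ r' (specOverMap j C) (e X)
  rw [hr', key, show h X = z from eval₂_X _ _] at this
  rw [this, ← e.apply_symm_apply (θ _ (specOverMap j C) (e X)), key, e.symm_apply_apply]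
  rfl

lemma polynomial_unique {Q Q' : B[X]}
    (h : ∀ (T : Over S) (t : T ⟶ Over.mk j) (z : Γ(T.left, ⊤)),
      Q.eval₂ (scalarHom t) z = Q'.eval₂ (scalarHom t) z) : Q = Q' := by
  have := h _ (specOverMap j C) (specOverEquiv j C X)
  rw [eval₂_specOver, eval₂_specOver, eval₂_C_X, eval₂_C_X] at this
  exact (specOverEquiv j C).injective this

/-- A polynomial which acts additively on functions is additive. -/
lemma polynomial_additive {Q : B[X]}
    (h : ∀ (T : Over S) (t : T ⟶ Over.mk j) (y z : Γ(T.left, ⊤)),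
      Q.eval₂ (scalarHom t) (y + z) = Q.eval₂ (scalarHom t) y + Q.eval₂ (scalarHom t) z) :
    (Q.map C).comp (X + C X) = Q.map C + C Q := by
  let g : B →+* B[X][X] := C.comp C
  have := h _ (specOverMap j g) (specOverEquiv j g X) (specOverEquiv j g (C X))
  rw [← map_add, eval₂_specOver, eval₂_specOver, eval₂_specOver, ← map_add] at this
  have h2 := (specOverEquiv j g).injective this
  have h3 : Q.eval₂ g (C X) = C Q := by rw [← hom_eval₂, eval₂_C_X]
  rw [h3] at h2
  rw [comp, eval₂_map]
  exact h2

end Points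

/-- A coordinate on the restriction of a commutative group scheme `E` over `S` to an affine scheme
`j : Spec B ⟶ S`, that is an isomorphism of this restriction with `𝔾ₐ`, given on points. -/
structure Coordinate {S : Scheme.{u}} (E : CommGrp (Over S)) {B : CommRingCat.{u}}
    (j : Spec B ⟶ S) where
  equiv : ∀ {T : Over S}, (T ⟶ Over.mk j) → ((T ⟶ E.X) ≃ Γ(T.left, ⊤))
  map_mul : ∀ {T : Over S} (t : T ⟶ Over.mk j) (x y : T ⟶ E.X),
    equiv t (x * y) = equiv t x + equiv t y
  naturality : ∀ {T T' : Over S} (g : T' ⟶ T) (t : T ⟶ Over.mk j) (x : T ⟶ E.X),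
    equiv (g ≫ t) (g ≫ x) = g.left.appTop.hom (equiv t x)

/-- An operation on the points of `E` with values in schemes over `j : Spec B ⟶ S`. -/
structure PointOperation {S : Scheme.{u}} (E : CommGrp (Over S)) {B : CommRingCat.{u}}
    (j : Spec B ⟶ S) where
  app : ∀ {T : Over S}, (T ⟶ Over.mk j) → (T ⟶ E.X) → (T ⟶ E.X)
  naturality : ∀ {T T' : Over S} (g : T' ⟶ T) (t : T ⟶ Over.mk j) (x : T ⟶ E.X),
    app (g ≫ t) (g ≫ x) = g ≫ app t x

namespace Coordinate

open Polynomial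

variable {S : Scheme.{u}} {E : CommGrp (Over S)} {B : CommRingCat.{u}} {j : Spec B ⟶ S}
  (χ χ' : Coordinate E j)

lemma map_one {T : Over S} (t : T ⟶ Over.mk j) : χ.equiv t 1 = 0 := by
  have := χ.map_mul t 1 1
  rwa [mul_one, left_eq_add] at this

lemma symm_naturality {T T' : Over S} (g : T' ⟶ T) (t : T ⟶ Over.mk j) (z : Γ(T.left, ⊤)) :
    (χ.equiv (g ≫ t)).symm (g.left.appTop.hom z) = g ≫ (χ.equiv t).symm z := by
  rw [Equiv.symm_apply_eq, χ.naturality, Equiv.apply_symm_apply]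

/-- In the coordinate `χ`, the operation `θ` is given by the polynomial `P`. -/
def Represents (θ : PointOperation E j) (P : B[X]) : Prop :=
  ∀ (T : Over S) (t : T ⟶ Over.mk j) (x : T ⟶ E.X),
    χ.equiv t (θ.app t x) = P.eval₂ (scalarHom t) (χ.equiv t x)

lemma exists_represents (θ : PointOperation E j) : ∃ P, χ.Represents θ P := by
  obtain ⟨Q, hQ⟩ := exists_polynomial (j := j)
    (fun T t z => χ.equiv t (θ.app t ((χ.equiv t).symm z)))
    (fun T T' g t z => by rw [symm_naturality, θ.naturality, χ.naturality])
  exact ⟨Q, fun T t x => by rw [← hQ, Equiv.symm_apply_apply]⟩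

variable {χ χ'}

lemma Represents.unique {θ : PointOperation E j} {P P' : B[X]} (h : χ.Represents θ P)
    (h' : χ.Represents θ P') : P = P' :=
  polynomial_unique (j := j) fun T t z => by
    have e := (h T t ((χ.equiv t).symm z)).symm.trans (h' T t _)
    rwa [Equiv.apply_symm_apply] at e

lemma Represents.app_eq {θ θ' : PointOperation E j} {P : B[X]} (h : χ.Represents θ P)
    (h' : χ.Represents θ' P) {T : Over S} (t : T ⟶ Over.mk j) (x : T ⟶ E.X) :
    θ.app t x = θ'.app t x :=
  (χ.equiv t).injective ((h T t x).trans (h' T t x).symm)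

lemma Represents.mul {θ θ' θ'' : PointOperation E j} {P P' : B[X]} (h : χ.Represents θ P)
    (h' : χ.Represents θ' P')
    (e : ∀ (T : Over S) (t : T ⟶ Over.mk j) (x : T ⟶ E.X), θ''.app t x = θ.app t (θ'.app t x)) :
    χ.Represents θ'' (P.comp P') := fun T t x => by
  rw [e, h, h', eval₂_comp]

lemma Represents.additive {θ : PointOperation E j} {P : B[X]} (h : χ.Represents θ P)
    (e : ∀ (T : Over S) (t : T ⟶ Over.mk j) (x y : T ⟶ E.X),
      θ.app t (x * y) = θ.app t x * θ.app t y) :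
    (P.map C).comp (X + C X) = P.map C + C P :=
  polynomial_additive (j := j) fun T t y z => by
    have e := congrArg (χ.equiv t) (e T t ((χ.equiv t).symm y) ((χ.equiv t).symm z))
    rwa [χ.map_mul, h, h, h, χ.map_mul, Equiv.apply_symm_apply, Equiv.apply_symm_apply] at e

variable (χ χ')

/-- The change of coordinates from `χ` to `χ'`. -/
lemma exists_transition : ∃ Q : B[X], Q.coeff 0 = 0 ∧
    ∀ (T : Over S) (t : T ⟶ Over.mk j) (x : T ⟶ E.X),
      χ'.equiv t x = Q.eval₂ (scalarHom t) (χ.equiv t x) := by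
  obtain ⟨Q, hQ⟩ := exists_polynomial (j := j)
    (fun T t z => χ'.equiv t ((χ.equiv t).symm z))
    (fun T T' g t z => by rw [symm_naturality, χ'.naturality])
  refine ⟨Q, ?_, fun T t x => by rw [← hQ, Equiv.symm_apply_apply]⟩
  have := hQ _ (specOverMap j (RingHom.id B)) (specOverEquiv j (RingHom.id B) 0)
  rw [eval₂_specOver, map_zero, ← χ.map_one (specOverMap j (RingHom.id B)),
    Equiv.symm_apply_apply, map_one] at this
  rw [coeff_zero_eq_eval_zero]
  exact (specOverEquiv j (RingHom.id B)).injective (by rw [map_zero]; exact this.symm)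

variable {χ χ'}

/-- The coefficients of an operation in two coordinates are related as follows. -/
lemma Represents.coeff_compare {θ : PointOperation E j} {P P' : B[X]} (h : χ.Represents θ P)
    (h' : χ'.Represents θ P') (hP : P.coeff 0 = 0) :
    P'.coeff 1 = P.coeff 1 ∧ ∀ m, (IsNilpotent (P'.coeff m) ↔ IsNilpotent (P.coeff m)) ∧
      (IsUnit (P'.coeff m) ↔ IsUnit (P.coeff m)) := by
  obtain ⟨Q, hQ0, hQ⟩ := exists_transition χ χ'
  obtain ⟨Q', hQ0', hQ'⟩ := exists_transition χ' χ
  have comp_eval : ∀ (F G : B[X]) (T : Over S) (t : T ⟶ Over.mk j) (z : Γ(T.left, ⊤)),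
      (F.comp G).eval₂ (scalarHom t) z = F.eval₂ (scalarHom t) (G.eval₂ (scalarHom t) z) :=
    fun F G T t z => eval₂_comp _
  have h1 : Q.comp Q' = X := polynomial_unique (j := j) fun T t z => by
    obtain ⟨x, rfl⟩ := (χ'.equiv t).surjective z
    rw [comp_eval, ← hQ', ← hQ, eval₂_X]
  have h2 : Q'.comp Q = X := polynomial_unique (j := j) fun T t z => by
    obtain ⟨x, rfl⟩ := (χ.equiv t).surjective z
    rw [comp_eval, ← hQ, ← hQ', eval₂_X]
  have h3 : P' = Q.comp (P.comp Q') := polynomial_unique (j := j) fun T t z => by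
    obtain ⟨x, rfl⟩ := (χ'.equiv t).surjective z
    rw [comp_eval, comp_eval, ← hQ', ← h, ← hQ, h']
  rw [h3]
  exact ⟨coeff_one_comp_comp h1 hQ0' P hP, fun m =>
    ⟨isNilpotent_coeff_comp_iff h1 h2 hQ0 hQ0' P m, isUnit_coeff_comp_iff h1 h2 hQ0 hQ0' P m⟩⟩

variable (χ) {B' : CommRingCat.{u}} {j' : Spec B' ⟶ S} (h : Spec B' ⟶ Spec B) (hj : h ≫ j = j')

/-- The restriction of a coordinate along `Spec B' ⟶ Spec B`. -/
noncomputable def restrict : Coordinate E j' where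
  equiv t := χ.equiv (t ≫ Over.homMk h hj)
  map_mul t x y := χ.map_mul _ x y
  naturality g t x := by rw [Category.assoc, χ.naturality]

lemma restrict_equiv {T : Over S} (t : T ⟶ Over.mk j') (x : T ⟶ E.X) :
    (χ.restrict h hj).equiv t x = χ.equiv (t ≫ Over.homMk h hj) x := rfl

lemma scalarHom_restrict {T : Over S} (t : T ⟶ Over.mk j') :
    scalarHom (t ≫ (Over.homMk h hj : Over.mk j' ⟶ Over.mk j)) =
      (scalarHom t).comp (Spec.preimage h).hom :=
  toGamma_preimage (T := T.left) t.left h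

end Coordinate

/-! ### Drinfeld modules in terms of coordinates over affine schemes -/

namespace PointOperation

variable {S : Scheme.{u}} {E : CommGrp (Over S)} {B B' : CommRingCat.{u}} {j : Spec B ⟶ S}
  {j' : Spec B' ⟶ S}

/-- The restriction of an operation along `Spec B' ⟶ Spec B`. -/
noncomputable def restrict (θ : PointOperation E j) (h : Spec B' ⟶ Spec B) (hj : h ≫ j = j') :
    PointOperation E j' where
  app t := θ.app (t ≫ Over.homMk h hj)
  naturality g t x := by rw [Category.assoc, θ.naturality]

end PointOperation

namespace Coordinate

variable {S : Scheme.{u}} {E : CommGrp (Over S)} {B B' : CommRingCat.{u}} {j : Spec B ⟶ S}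
  {j' : Spec B' ⟶ S} {χ : Coordinate E j}

lemma represents_twPoly_iff {q : ℕ} {θ : PointOperation E j} {b : ℕ →₀ B} :
    χ.Represents θ (twPoly q b) ↔ ∀ (T : Over S) (t : T ⟶ Over.mk j) (x : T ⟶ E.X),
      χ.equiv t (θ.app t x) = twEval q (scalarHom t) b (χ.equiv t x) := by
  simp only [Represents, eval₂_twPoly]

lemma Represents.restrict {q : ℕ} {θ : PointOperation E j} {b : ℕ →₀ B}
    (h : χ.Represents θ (twPoly q b)) (g : Spec B' ⟶ Spec B) (hj : g ≫ j = j') :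
    (χ.restrict g hj).Represents (θ.restrict g hj)
      (twPoly q (b.mapRange (Spec.preimage g).hom (map_zero _))) := by
  rw [represents_twPoly_iff] at h ⊢
  intro T t x
  rw [twEval_map, ← scalarHom_restrict g hj]
  exact h _ _ _

/-- In the coordinate `χ`, a nonzero `a` acts by a polynomial in the Frobenius endomorphism with
constant term `ch a` and degree `d a` up to nilpotents. -/
def HasDegree {A : Type*} [CommRing A] (χ : Coordinate E j) (q : ℕ) (d : A → ℤ) (ch : A → B)
    (θ : A → PointOperation E j) : Prop :=
  ∀ a : A, a ≠ 0 → ∃ δ : ℕ →₀ B, χ.Represents (θ a) (twPoly q δ) ∧ δ 0 = ch a ∧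
    (∀ i : ℕ, (i : ℤ) = d a → IsUnit (δ i)) ∧ (∀ i : ℕ, d a < (i : ℤ) → IsNilpotent (δ i))

lemma HasDegree.restrict {A : Type*} [CommRing A] {q : ℕ} {d : A → ℤ} {ch : A → B}
    {θ : A → PointOperation E j} (h : χ.HasDegree q d ch θ) (g : Spec B' ⟶ Spec B)
    (hj : g ≫ j = j') :
    (χ.restrict g hj).HasDegree q d (fun a => (Spec.preimage g).hom (ch a))
      (fun a => (θ a).restrict g hj) := by
  intro a ha
  obtain ⟨δ, h1, h2, h3, h4⟩ := h a ha
  refine ⟨_, h1.restrict g hj, ?_, fun i hi => ?_, fun i hi => ?_⟩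
  · rw [Finsupp.mapRange_apply, h2]
  · rw [Finsupp.mapRange_apply]; exact (h3 i hi).map _
  · rw [Finsupp.mapRange_apply]; exact (h4 i hi).map _

end Coordinate

/-- The action of `a` on the points of `M` over an affine scheme. -/
noncomputable def ModuleScheme.operation {A : CommRingCat.{u}} {S : Scheme.{u}}
    (M : ModuleScheme A S) {B : CommRingCat.{u}} (j : Spec B ⟶ S) (a : A) :
    PointOperation M.E j where
  app _ x := x ≫ toSchemeHom (M.φ a)
  naturality _ _ _ := Category.assoc _ _ _

section Compare

variable {S : Scheme.{u}} {B : CommRingCat.{u}} (j : Spec B ⟶ S) [IsOpenImmersion j] (U : S.Opens)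

lemma top_le_preimage_of_opensRange_eq (hU : j.opensRange = U) : ⊤ ≤ j ⁻¹ᵁ U := by
  rw [← hU, Scheme.Hom.preimage_opensRange]

lemma top_le_of_opensRange_eq (hU : j.opensRange = U) {T : Over S} (t : T ⟶ Over.mk j) : ⊤ ≤ T.hom ⁻¹ᵁ U := by
  have h : t.left ≫ j = T.hom := Over.w t
  rw [← h, Scheme.Hom.comp_preimage]
  exact (Scheme.Hom.preimage_mono t.left (top_le_preimage_of_opensRange_eq j U hU))

variable (hU : j.opensRange = U)

/-- The isomorphism between the functions on the range of an open immersion `j : Spec B ⟶ S`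
and `B`. -/
noncomputable def sectionsEquiv : Γ(S, U) ≃+* B :=
  have : IsIso (j.app U) := Scheme.Hom.isIso_app _ _ hU.ge
  have : IsIso (j.appLE U ⊤ (top_le_preimage_of_opensRange_eq j U hU)) := by
    rw [Scheme.Hom.appLE]
    have : IsIso (homOfLE (top_le_preimage_of_opensRange_eq j U hU)) :=
      ⟨homOfLE le_top, Subsingleton.elim _ _, Subsingleton.elim _ _⟩
    infer_instance
  (asIso (j.appLE U ⊤ (top_le_preimage_of_opensRange_eq j U hU) ≫
    (Scheme.ΓSpecIso B).hom)).commRingCatIsoToRingEquiv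

lemma scalarHom_sectionsEquiv {T : Over S} (t : T ⟶ Over.mk j) (x : Γ(S, U)) :
    scalarHom t (sectionsEquiv j U hU x) =
      (T.hom.appLE U ⊤ (top_le_of_opensRange_eq j U hU t)).hom x := by
  have h : t.left ≫ j = T.hom := Over.w t
  have h1 := Scheme.Hom.appLE_comp_appLE (X := T.left) t.left j U ⊤ ⊤
    (top_le_preimage_of_opensRange_eq j U hU) le_top
  have h2 : T.hom.appLE U ⊤ (top_le_of_opensRange_eq j U hU t) =
      (t.left ≫ j).appLE U ⊤ (by rw [h]; exact top_le_of_opensRange_eq j U hU t) := by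
    simp only [h]
  rw [h2]
  refine Eq.trans ?_ (ConcreteCategory.congr_hom h1 x)
  have h3 := ConcreteCategory.congr_hom (Scheme.ΓSpecIso B).hom_inv_id
    ((j.appLE U ⊤ (top_le_preimage_of_opensRange_eq j U hU)).hom x)
  change (Scheme.Hom.appTop (X := T.left) t.left).hom
    ((Scheme.ΓSpecIso B).inv.hom ((Scheme.ΓSpecIso B).hom.hom _)) = _
  refine (congrArg (Scheme.Hom.appTop (X := T.left) t.left).hom h3).trans ?_
  rw [Scheme.Hom.appTop, Scheme.Hom.app_eq_appLE]
  rfl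

lemma sectionsEquiv_pullbackScalar {A : CommRingCat.{u}} (c : S ⟶ Spec A) (a : A) :
    sectionsEquiv j U hU (pullbackScalar c U a) = (Spec.preimage (j ≫ c)).hom a := by
  have h1 := Scheme.Hom.appLE_comp_appLE j c ⊤ U ⊤ le_top
    (top_le_preimage_of_opensRange_eq j U hU)
  refine (congrArg (Scheme.ΓSpecIso B).hom.hom (ConcreteCategory.congr_hom h1 _)).trans ?_
  have h : (Scheme.ΓSpecIso A).inv ≫ (j ≫ c).appLE ⊤ ⊤ le_top ≫ (Scheme.ΓSpecIso B).hom =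
      Spec.preimage (j ≫ c) := by
    rw [Iso.inv_comp_eq, ← Scheme.ΓSpecIso_naturality, Spec.map_preimage, Scheme.Hom.appTop,
      Scheme.Hom.app_eq_appLE]
    rfl
  exact ConcreteCategory.congr_hom h a

variable {A : CommRingCat.{u}} {M : ModuleScheme A S} {q : ℕ} {d : A → ℤ} {c : S ⟶ Spec A}

/-- A coordinate over an affine open subscheme, as a coordinate over an affine scheme. -/
noncomputable def AdditiveCoordinate.toCoordinate {E : CommGrp (Over S)}
    (ψ : AdditiveCoordinate E U) : Coordinate E j where
  equiv t := ψ.equiv _ (top_le_of_opensRange_eq j U hU t)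
  map_mul _ x y := ψ.map_mul _ _ x y
  naturality g _ x := ψ.naturality _ _ _ _ g x

lemma AdditiveCoordinate.IsDrinfeld.hasDegree {ψ : AdditiveCoordinate M.E U}
    (h : ψ.IsDrinfeld q d c) :
    (ψ.toCoordinate j U hU).HasDegree q d (Spec.preimage (j ≫ c)).hom (M.operation j) := by
  intro a ha
  obtain ⟨δ, h1, h2, h3, h4⟩ := h a ha
  refine ⟨δ.mapRange (sectionsEquiv j U hU) (map_zero _), ?_, ?_, fun i hi => ?_, fun i hi => ?_⟩
  · rw [Coordinate.represents_twPoly_iff]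
    intro T t x
    refine (h1 T _ x).trans ?_
    rw [twEval, Finsupp.sum_mapRange_index (fun i => by rw [map_zero, zero_mul])]
    exact Finset.sum_congr rfl fun i _ =>
      congrArg (· * _) (scalarHom_sectionsEquiv j U hU t (δ i)).symm
  · rw [Finsupp.mapRange_apply, h2, sectionsEquiv_pullbackScalar]
  · rw [Finsupp.mapRange_apply]; exact (h3 i hi).map _
  · rw [Finsupp.mapRange_apply]; exact (h4 i hi).map _

/-- The morphism to `Spec B` of an `S`-scheme which lies over the range of `Spec B ⟶ S`. -/
noncomputable def liftRange {T : Over S} (hT : ⊤ ≤ T.hom ⁻¹ᵁ U) : T ⟶ Over.mk j :=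
  Over.homMk (IsOpenImmersion.lift j T.hom (by
    rintro _ ⟨x, rfl⟩
    have : T.hom x ∈ U := hT (x := x) trivial
    rw [← hU] at this
    exact this)) (IsOpenImmersion.lift_fac _ _ _)

/-- A coordinate over an affine scheme which is open in `S`, as a coordinate over an open
subscheme. -/
noncomputable def Coordinate.toAdditive {E : CommGrp (Over S)} (χ : Coordinate E j) :
    AdditiveCoordinate E U where
  equiv T hT := χ.equiv (liftRange j U hU hT)
  map_mul T hT x y := χ.map_mul _ _ _
  naturality T T' hT hT' g x := by
    rw [← χ.naturality]
    congr 2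
    apply Over.OverMorphism.ext
    rw [← cancel_mono j]
    exact (Over.w (liftRange j U hU hT')).trans (Over.w (g ≫ liftRange j U hU hT)).symm

lemma Coordinate.HasDegree.isDrinfeld {χ : Coordinate M.E j}
    (h : χ.HasDegree q d (Spec.preimage (j ≫ c)).hom (M.operation j)) :
    (χ.toAdditive j U hU).IsDrinfeld q d c := by
  intro a ha
  obtain ⟨δ, h1, h2, h3, h4⟩ := h a ha
  refine ⟨δ.mapRange (sectionsEquiv j U hU).symm (map_zero _), fun T hT x => ?_, ?_, fun i hi => ?_,
    fun i hi => ?_⟩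
  · rw [Coordinate.represents_twPoly_iff] at h1
    refine (h1 T (liftRange j U hU hT) x).trans ?_
    rw [Finsupp.sum_mapRange_index (fun i => by rw [map_zero, zero_mul])]
    refine Finset.sum_congr rfl fun i _ => ?_
    have := scalarHom_sectionsEquiv j U hU (liftRange j U hU hT) ((sectionsEquiv j U hU).symm (δ i))
    rw [RingEquiv.apply_symm_apply] at this
    exact congrArg (· * _) this
  · rw [Finsupp.mapRange_apply, h2, RingEquiv.symm_apply_eq, sectionsEquiv_pullbackScalar]
  · rw [Finsupp.mapRange_apply]; exact (h3 i hi).map _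
  · rw [Finsupp.mapRange_apply]; exact (h4 i hi).map _

end Compare

/-- Being a Drinfeld module, in terms of affine schemes `Spec B` open in `S`. -/
lemma ModuleScheme.isDrinfeld_iff {S : Scheme.{u}} {A : CommRingCat.{u}} {M : ModuleScheme A S}
    {q : ℕ} {d : A → ℤ} {c : S ⟶ Spec A} :
    M.IsDrinfeld q d c ↔ ∀ s : S, ∃ (B : CommRingCat.{u}) (j : Spec B ⟶ S),
      IsOpenImmersion j ∧ s ∈ Set.range j ∧ ∃ χ : Coordinate M.E j,
        χ.HasDegree q d (Spec.preimage (j ≫ c)).hom (M.operation j) := by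
  refine forall_congr' fun s => ⟨?_, ?_⟩
  · rintro ⟨U, hs, hU, ψ, hψ⟩
    exact ⟨_, hU.fromSpec, inferInstance, by rwa [hU.range_fromSpec],
      _, hψ.hasDegree (j := hU.fromSpec) (U := U) hU.opensRange_fromSpec⟩
  · rintro ⟨B, j, hj, hs, χ, hχ⟩
    exact ⟨j.opensRange, hs, isAffineOpen_opensRange j, _, hχ.isDrinfeld j _ rfl⟩

/-! ### Standard coordinates -/

section TwEval

variable {k : Type*} [Field k] [Finite k] {B R : Type*} [CommRing B] [CommRing R] {f : k →+* B}

lemma twMul_eq_of_twOp_mul_eq_one {x y : ℕ →₀ B} (h : twOp f x * twOp f y = 1) :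
    twMul (Nat.card k) x y = Finsupp.single 0 1 := by
  apply twOp_injective f
  rw [twOp_mul, h, twOp_one]

lemma twEval_twEval_of_twOp_mul_eq_one {x y : ℕ →₀ B} (h : twOp f x * twOp f y = 1)
    (g : B →+* R) (z : R) : twEval (Nat.card k) g x (twEval (Nat.card k) g y z) = z := by
  rw [← twEval_twMul (g.comp f), twMul_eq_of_twOp_mul_eq_one h, twEval_single, map_one, one_mul,
    pow_zero, pow_one]

end TwEval

namespace ModuleScheme

variable {A : CommRingCat.{u}} {S : Scheme.{u}} (M : ModuleScheme A S)

lemma toSchemeHom_mul {E E' : CommGrp (Over S)} (f : E ⟶ E') {T : Over S} (x y : T ⟶ E.X) :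
    (x * y) ≫ toSchemeHom f = (x ≫ toSchemeHom f) * (y ≫ toSchemeHom f) :=
  have : IsMonHom (toSchemeHom f) := f.hom.hom.isMonHom_hom
  MonObj.mul_comp x y (toSchemeHom f)

variable {T : Over S} (x : T ⟶ M.E.X)

lemma comp_φ_one : x ≫ toSchemeHom (M.φ 1) = x := by
  rw [M.isAction.map_one]; exact Category.comp_id x

lemma comp_φ_mul (a b : A) :
    x ≫ toSchemeHom (M.φ (a * b)) = (x ≫ toSchemeHom (M.φ b)) ≫ toSchemeHom (M.φ a) := by
  rw [M.isAction.map_mul]; exact (Category.assoc _ _ _).symm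

lemma comp_φ_add (a b : A) :
    x ≫ toSchemeHom (M.φ (a + b)) = (x ≫ toSchemeHom (M.φ a)) * (x ≫ toSchemeHom (M.φ b)) := by
  rw [M.isAction.map_add]; exact MonObj.comp_mul _ _ _

lemma comp_φ_zero : x ≫ toSchemeHom (M.φ 0) = 1 := by
  have := M.comp_φ_add x 0 0
  rwa [add_zero, left_eq_mul] at this

end ModuleScheme

namespace Coordinate

open Polynomial

variable {k : Type*} [Field k] [Finite k] {S : Scheme.{u}} {E : CommGrp (Over S)}
  {B : CommRingCat.{u}} {j : Spec B ⟶ S} {χ : Coordinate E j} {f : k →+* B}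
  {θ θ' θ'' : PointOperation E j} {b c : ℕ →₀ B}

lemma Represents.twMul (f : k →+* B) (h : χ.Represents θ (twPoly (Nat.card k) b))
    (h' : χ.Represents θ' (twPoly (Nat.card k) c))
    (e : ∀ (T : Over S) (t : T ⟶ Over.mk j) (x : T ⟶ E.X), θ''.app t x = θ.app t (θ'.app t x)) :
    χ.Represents θ'' (twPoly (Nat.card k) (twMul (Nat.card k) b c)) := by
  rw [represents_twPoly_iff] at *
  intro T t x
  rw [e, h, h', twEval_twMul ((scalarHom t).comp f)]

lemma Represents.twAdd {q : ℕ} (h : χ.Represents θ (twPoly q b))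
    (h' : χ.Represents θ' (twPoly q c))
    (e : ∀ (T : Over S) (t : T ⟶ Over.mk j) (x : T ⟶ E.X),
      θ''.app t x = θ.app t x * θ'.app t x) :
    χ.Represents θ'' (twPoly q (b + c)) := by
  rw [represents_twPoly_iff] at *
  intro T t x
  rw [e, χ.map_mul, h, h', twEval_add_left]

lemma Represents.twId {q : ℕ}
    (e : ∀ (T : Over S) (t : T ⟶ Over.mk j) (x : T ⟶ E.X), θ.app t x = x) :
    χ.Represents θ (twPoly q (Finsupp.single 0 1)) := by
  rw [represents_twPoly_iff]
  intro T t x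
  rw [e, twEval_single, RingHom.map_one, one_mul, pow_zero, pow_one]

lemma Represents.twZero {q : ℕ}
    (e : ∀ (T : Over S) (t : T ⟶ Over.mk j) (x : T ⟶ E.X), θ.app t x = 1) :
    χ.Represents θ (twPoly q 0) := by
  rw [represents_twPoly_iff]
  intro T t x
  rw [e, χ.map_one]
  exact Finsupp.sum_zero_index.symm

lemma twPoly_injective {q : ℕ} (hq : 1 < q) {b c : ℕ →₀ B} (h : twPoly q b = twPoly q c) :
    b = c := Finsupp.ext fun i => by
  rw [← twPoly_coeff hq, h, twPoly_coeff hq]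

lemma Represents.twUnique {q : ℕ} (hq : 1 < q) (h : χ.Represents θ (twPoly q b))
    (h' : χ.Represents θ (twPoly q c)) : b = c :=
  twPoly_injective hq (h.unique h')

lemma twPoly_coeff_zero {q : ℕ} (hq : 1 < q) (b : ℕ →₀ B) : (twPoly q b).coeff 0 = 0 :=
  twPoly_coeff_of_ne b 0 fun i => (pow_ne_zero i (by omega : q ≠ 0)).symm

/-- The coefficients of an operation in two coordinates in which it is given by polynomials in
the Frobenius endomorphism. -/
lemma Represents.twCompare {q : ℕ} (hq : 1 < q) {χ' : Coordinate E j}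
    (h : χ.Represents θ (twPoly q b)) (h' : χ'.Represents θ (twPoly q c)) :
    c 0 = b 0 ∧ ∀ i, (IsNilpotent (c i) ↔ IsNilpotent (b i)) ∧ (IsUnit (c i) ↔ IsUnit (b i)) := by
  obtain ⟨h1, h2⟩ := h.coeff_compare h' (twPoly_coeff_zero hq b)
  rw [← pow_zero q, twPoly_coeff hq, twPoly_coeff hq] at h1
  refine ⟨h1, fun i => ?_⟩
  have := h2 (q ^ i)
  rwa [twPoly_coeff hq, twPoly_coeff hq] at this

variable (χ)

/-- The coordinate obtained from `χ` by an automorphism of `𝔾ₐ` which is a polynomial `x` in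
the Frobenius endomorphism, with inverse `y`. -/
noncomputable def twist {x y : ℕ →₀ B} (hxy : twOp f x * twOp f y = 1)
    (hyx : twOp f y * twOp f x = 1) : Coordinate E j where
  equiv t := (χ.equiv t).trans
    { toFun := twEval (Nat.card k) (scalarHom t) x
      invFun := twEval (Nat.card k) (scalarHom t) y
      left_inv := twEval_twEval_of_twOp_mul_eq_one hyx _
      right_inv := twEval_twEval_of_twOp_mul_eq_one hxy _ }
  map_mul t z w := by
    change twEval _ _ _ _ = twEval _ _ _ _ + twEval _ _ _ _
    rw [χ.map_mul, twEval_add ((scalarHom t).comp f)]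
  naturality g t z := by
    change twEval _ _ _ _ = g.left.appTop.hom (twEval _ _ _ _)
    rw [map_twEval, χ.naturality, scalarHom_comp]

variable {χ}

lemma Represents.twist {x y : ℕ →₀ B} (hxy : twOp f x * twOp f y = 1)
    (hyx : twOp f y * twOp f x = 1) (h : χ.Represents θ (twPoly (Nat.card k) b)) :
    (χ.twist hxy hyx).Represents θ
      (twPoly (Nat.card k) (DrinfeldRestriction.twMul (Nat.card k) x
        (DrinfeldRestriction.twMul (Nat.card k) b y))) := by
  rw [represents_twPoly_iff] at *
  intro T t z
  rw [twEval_twMul ((scalarHom t).comp f), twEval_twMul ((scalarHom t).comp f)]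
  change twEval _ _ _ (χ.equiv t (θ.app t z)) = twEval _ _ _ (twEval _ _ _ (twEval _ _ _
    (twEval _ _ _ (χ.equiv t z))))
  rw [h, twEval_twEval_of_twOp_mul_eq_one hyx]

end Coordinate

/-- A coordinate for the `A`-module scheme `M` over `j : Spec B ⟶ S` in which all elements of `A`
act by polynomials in the Frobenius endomorphism, those of the finite field `k` by scalars, and
in which `a₀` acts by a polynomial of degree exactly `N` with invertible leading coefficient. -/
structure StandardForm {k : Type u} [Field k] {A : CommRingCat.{u}} {S : Scheme.{u}}
    (M : ModuleScheme A S) (c : S ⟶ Spec A) (κ : k →+* A) (a₀ : A) {B : CommRingCat.{u}}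
    (j : Spec B ⟶ S) where
  χ : Coordinate M.E j
  Φ : A → ℕ →₀ B
  N : ℕ
  represents : ∀ a, χ.Represents (M.operation j a) (twPoly (Nat.card k) (Φ a))
  constant : ∀ a, Φ a 0 = (Spec.preimage (j ≫ c)).hom a
  scalar : ∀ t, Φ (κ t) = Finsupp.single 0 ((Spec.preimage (j ≫ c)).hom (κ t))
  pos : 0 < N
  unit : IsUnit (Φ a₀ N)
  bound : ∀ i, N < i → Φ a₀ i = 0

section

variable {k : Type u} [Field k] [Finite k] {A : CommRingCat.{u}} {S : Scheme.{u}}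
  {M : ModuleScheme A S} {c : S ⟶ Spec A} {κ : k →+* A} {a₀ : A} {B : CommRingCat.{u}}
  {j : Spec B ⟶ S}

lemma twMul_comm_of_represents (f : k →+* B) {χ : Coordinate M.E j} {Φ : A → ℕ →₀ B}
    (h : ∀ a, χ.Represents (M.operation j a) (twPoly (Nat.card k) (Φ a))) (a b : A) :
    Φ (a * b) = twMul (Nat.card k) (Φ a) (Φ b) :=
  (h (a * b)).twUnique Finite.one_lt_card
    ((h a).twMul f (h b) fun _ _ x => M.comp_φ_mul x a b)

/-- Drinfeld modules have standard coordinates locally. -/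
theorem ModuleScheme.IsDrinfeld.exists_standardForm {d : A → ℤ} (hM : M.IsDrinfeld (Nat.card k) d c)
    (hκ : ∀ t : k, t ≠ 0 → d (κ t) = 0) (ha₀ : a₀ ≠ 0) (hd : 0 < d a₀) (s : S) :
    ∃ (B : CommRingCat.{u}) (j : Spec B ⟶ S), IsOpenImmersion j ∧ s ∈ Set.range j ∧
      Nonempty (StandardForm M c κ a₀ j) := by
  classical
  have hq : 1 < Nat.card k := Finite.one_lt_card
  obtain ⟨B, j, hj, hs, χ, hχ⟩ := ModuleScheme.isDrinfeld_iff.1 hM s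
  refine ⟨B, j, hj, hs, ?_⟩
  let f : k →+* B := (Spec.preimage (j ≫ c)).hom.comp κ
  choose! δ h1 h2 h3 h4 using hχ
  -- The definition of Drinfeld modules is silent about the action of `0`.
  let δ' : A → ℕ →₀ B := fun a => if a = 0 then 0 else δ a
  have h1' : ∀ a, χ.Represents (M.operation j a) (twPoly (Nat.card k) (δ' a)) := fun a => by
    by_cases ha : a = 0
    · simp only [δ', if_pos ha]
      refine Coordinate.Represents.twZero fun T t x => ?_
      rw [ha]; exact M.comp_φ_zero x
    · simp only [δ', if_neg ha]
      exact h1 a ha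
  have hδ : ∀ a, a ≠ 0 → δ' a = δ a := fun a ha => if_neg ha
  have hc : ∀ a, δ' a 0 = (Spec.preimage (j ≫ c)).hom a := fun a => by
    by_cases ha : a = 0
    · rw [show δ' a = 0 from if_pos ha, ha]; exact (RingHom.map_zero _).symm
    · rw [hδ a ha, h2 a ha]
  obtain ⟨N, hN⟩ := Int.eq_ofNat_of_zero_le hd.le
  have hN0 : 0 < N := by omega
  -- The change of coordinate which gives `a₀` the exact degree `N = d a₀`.
  obtain ⟨e, ⟨x, y, hxy, hyx, he⟩, hu, hb⟩ := exists_twConj_standard (f := f) hN0 (δ a₀)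
    (h3 a₀ ha₀ N hN.symm) (fun i hi => h4 a₀ ha₀ i (by omega))
  let Φ : A → ℕ →₀ B := fun a => twMul (Nat.card k) x (twMul (Nat.card k) (δ' a) y)
  have hΦ : ∀ a, (χ.twist hxy hyx).Represents (M.operation j a) (twPoly (Nat.card k) (Φ a)) :=
    fun a => (h1' a).twist hxy hyx
  have hΦ₀ : Φ a₀ = e := by
    apply twOp_injective f
    rw [he, twOp_mul, twOp_mul, hδ a₀ ha₀, mul_assoc]
  have hΦc : ∀ a, Φ a 0 = (Spec.preimage (j ≫ c)).hom a := fun a => by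
    rw [← hc a]; exact ((h1' a).twCompare hq (hΦ a)).1
  refine ⟨⟨χ.twist hxy hyx, Φ, N, hΦ, hΦc, fun t => ?_, hN0, hΦ₀ ▸ hu, fun i hi => ?_⟩⟩
  · by_cases ht : t = 0
    · rw [ht, map_zero, map_zero, Finsupp.single_zero]
      exact (hΦ 0).twUnique hq (Coordinate.Represents.twZero fun T t x => M.comp_φ_zero x)
    -- A constant has degree `0` up to nilpotents and commutes with `φ(a₀)`, so it acts by a scalar.
    have hκt : κ t ≠ 0 := (map_ne_zero_iff _ ?_).2 ht
    · ext i
      rcases Nat.eq_zero_or_pos i with rfl | hi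
      · rw [hΦc, Finsupp.single_eq_same]
      · rw [Finsupp.single_eq_of_ne (by omega)]
        refine coeff_eq_zero_of_commute hq hN0 (hΦ₀ ▸ hu) (fun i hi => hΦ₀ ▸ hb i hi) (D := 0)
          (b := Φ (κ t)) (c := Φ a₀) ?_ (fun i hi => ?_) i (by omega)
        · rw [← twMul_comm_of_represents f hΦ, ← twMul_comm_of_represents f hΦ, mul_comm]
        · rw [(((h1' (κ t)).twCompare hq (hΦ (κ t))).2 i).1, hδ _ hκt]
          exact h4 _ hκt i (by rw [hκ t ht]; exact hi)
    · have : Nontrivial A := ⟨a₀, 0, ha₀⟩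
      exact κ.injective
  · rw [hΦ₀]; exact hb i hi

end

open scoped MonObj MonoidalCategory
open CartesianMonoidalCategory

/-! ### Extensions of an action -/

section Act

variable {S : Scheme.{u}} {E : CommGrp (Over S)} {Z Z' T T' : Over S}

/-- The operation on points of `E` given by a morphism `Z × E ⟶ E` and a point of `Z`. -/
noncomputable def act (e : Z ⊗ E.X ⟶ E.X) (x : T ⟶ Z) (y : T ⟶ E.X) : T ⟶ E.X :=
  lift x y ≫ e

lemma comp_act (e : Z ⊗ E.X ⟶ E.X) (g : T' ⟶ T) (x : T ⟶ Z) (y : T ⟶ E.X) :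
    act e (g ≫ x) (g ≫ y) = g ≫ act e x y := by
  rw [act, act, ← Category.assoc, comp_lift]

lemma act_fst_snd (e : Z ⊗ E.X ⟶ E.X) : act e (fst Z E.X) (snd Z E.X) = e := by
  rw [act, lift_fst_snd, Category.id_comp]

lemma act_ext {e e' : Z ⊗ E.X ⟶ E.X}
    (h : ∀ (T : Over S) (x : T ⟶ Z) (y : T ⟶ E.X), act e x y = act e' x y) : e = e' := by
  rw [← act_fst_snd e, h, act_fst_snd]

/-- The restriction of a morphism `Z × E ⟶ E` along `Z' ⟶ Z`. -/
noncomputable def restrictAct (u : Z' ⟶ Z) (e : Z ⊗ E.X ⟶ E.X) : Z' ⊗ E.X ⟶ E.X :=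
  act e (fst Z' E.X ≫ u) (snd Z' E.X)

lemma act_restrictAct (u : Z' ⟶ Z) (e : Z ⊗ E.X ⟶ E.X) (x : T ⟶ Z') (y : T ⟶ E.X) :
    act (restrictAct u e) x y = act e (x ≫ u) y := by
  rw [act, restrictAct, ← comp_act, ← Category.assoc, lift_fst, lift_snd]

/-- The operations given by a morphism `Z × E ⟶ E` over an affine scheme over `Z`. -/
noncomputable def actOperation (e : Z ⊗ E.X ⟶ E.X) {B : CommRingCat.{u}} {j' : Spec B ⟶ S}
    (j : Over.mk j' ⟶ Z) : PointOperation E j' where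
  app t y := act e (t ≫ j) y
  naturality g t y := by rw [Category.assoc, comp_act]

end Act

section Extension

variable {A A' : CommRingCat.{u}} (ρ : A ⟶ A') (q : ℕ) (d' : A' → ℤ) {S : Scheme.{u}}
  (M : ModuleScheme A S)

/-- The morphisms `e a : Z × E ⟶ E`, for `a ∈ A'`, extend the action of `A` on the pullback of
`M = (E, φ)` to `Z` to an action of `A'` which makes it a Drinfeld module of characteristic `c'` and
degree function `d'`. These are the triples `(E', φ', α)` over `Z` in which `α` is the identity. -/
structure IsExtension (Z : Over S) (c' : Z.left ⟶ Spec A') (e : A' → (Z ⊗ M.E.X ⟶ M.E.X)) :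
    Prop where
  act_mul : ∀ (a : A') {T : Over S} (x : T ⟶ Z) (y z : T ⟶ M.E.X),
    act (e a) x (y * z) = act (e a) x y * act (e a) x z
  one_act : ∀ {T : Over S} (x : T ⟶ Z) (y : T ⟶ M.E.X), act (e 1) x y = y
  mul_act : ∀ (a b : A') {T : Over S} (x : T ⟶ Z) (y : T ⟶ M.E.X),
    act (e (a * b)) x y = act (e a) x (act (e b) x y)
  add_act : ∀ (a b : A') {T : Over S} (x : T ⟶ Z) (y : T ⟶ M.E.X),
    act (e (a + b)) x y = act (e a) x y * act (e b) x y
  restrict_act : ∀ (a : A) {T : Over S} (x : T ⟶ Z) (y : T ⟶ M.E.X),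
    act (e (ρ.hom a)) x y = y ≫ toSchemeHom (M.φ a)
  exists_coordinate : ∀ z : Z.left, ∃ (B : CommRingCat.{u}) (j : Spec B ⟶ Z.left),
    IsOpenImmersion j ∧ z ∈ Set.range j ∧ ∃ χ : Coordinate M.E (j ≫ Z.hom),
      χ.HasDegree q d' (Spec.preimage (j ≫ c')).hom
        (fun a => actOperation (e a) (Over.homMk j : Over.mk (j ≫ Z.hom) ⟶ Z))

variable {ρ q d' M}

lemma IsExtension.zero_act {Z : Over S} {c' : Z.left ⟶ Spec A'} {e : A' → (Z ⊗ M.E.X ⟶ M.E.X)}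
    (h : IsExtension ρ q d' M Z c' e) {T : Over S} (x : T ⟶ Z) (y : T ⟶ M.E.X) :
    act (e 0) x y = 1 := by
  have := h.add_act 0 0 x y
  rwa [add_zero, left_eq_mul] at this

/-- Coordinates with the required properties restrict to open subschemes of `Z`. -/
lemma IsExtension.restrict_coordinate {Z Z' : Over S} {c' : Z.left ⟶ Spec A'}
    {e : A' → (Z ⊗ M.E.X ⟶ M.E.X)} (u : Z' ⟶ Z) {B : CommRingCat.{u}} (j : Spec B ⟶ Z.left)
    {χ : Coordinate M.E (j ≫ Z.hom)}
    (hχ : χ.HasDegree q d' (Spec.preimage (j ≫ c')).hom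
        (fun a => actOperation (e a) (Over.homMk j : Over.mk (j ≫ Z.hom) ⟶ Z)))
    {B' : CommRingCat.{u}} (j' : Spec B' ⟶ Z'.left) (h : Spec B' ⟶ Spec B)
    (hh : h ≫ j = j' ≫ u.left) :
    ∃ χ' : Coordinate M.E (j' ≫ Z'.hom),
      χ'.HasDegree q d' (Spec.preimage (j' ≫ u.left ≫ c')).hom
        (fun a => actOperation (restrictAct u (e a))
          (Over.homMk j' : Over.mk (j' ≫ Z'.hom) ⟶ Z')) := by
  have hj : h ≫ j ≫ Z.hom = j' ≫ Z'.hom := by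
    rw [← Category.assoc, hh, Category.assoc, Over.w]
  refine ⟨χ.restrict h hj, ?_⟩
  have h1 := hχ.restrict h hj
  have h2 : ∀ a, (Spec.preimage h).hom ((Spec.preimage (j ≫ c')).hom a) =
      (Spec.preimage (j' ≫ u.left ≫ c')).hom a := fun a => by
    rw [← CommRingCat.comp_apply]
    congr 2
    apply Spec.map_injective
    rw [Spec.map_comp, Spec.map_preimage, Spec.map_preimage, Spec.map_preimage,
      ← Category.assoc, hh, Category.assoc]
  have h3 : ∀ a, (actOperation (e a) (Over.homMk j : Over.mk (j ≫ Z.hom) ⟶ Z)).restrict h hj =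
      actOperation (restrictAct u (e a)) (Over.homMk j' : Over.mk (j' ≫ Z'.hom) ⟶ Z') := fun a => by
    have : ∀ (T : Over S) (t : T ⟶ Over.mk (j' ≫ Z'.hom)),
        (t ≫ (Over.homMk h hj : _ ⟶ Over.mk (j ≫ Z.hom))) ≫ (Over.homMk j : _ ⟶ Z) =
          (t ≫ (Over.homMk j' : _ ⟶ Z')) ≫ u := fun T t => by
      rw [Category.assoc, Category.assoc]
      refine congrArg (t ≫ ·) (Over.OverMorphism.ext hh)
    simp only [PointOperation.restrict, actOperation, act_restrictAct, this]
  simp only [h2, h3] at h1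
  exact h1

lemma IsExtension.restrict {Z Z' : Over S} {c' : Z.left ⟶ Spec A'}
    {e : A' → (Z ⊗ M.E.X ⟶ M.E.X)} (h : IsExtension ρ q d' M Z c' e) (u : Z' ⟶ Z)
    {c₁ : Z'.left ⟶ Spec A'} (hc : u.left ≫ c' = c₁) :
    IsExtension ρ q d' M Z' c₁ (fun a => restrictAct u (e a)) where
  act_mul a T x y z := by simp only [act_restrictAct, h.act_mul]
  one_act x y := by rw [act_restrictAct, h.one_act]
  mul_act a b T x y := by simp only [act_restrictAct, h.mul_act]
  add_act a b T x y := by simp only [act_restrictAct, h.add_act]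
  restrict_act a T x y := by rw [act_restrictAct, h.restrict_act]
  exists_coordinate z := by
    obtain ⟨B, j, hj, hz, χ, hχ⟩ := h.exists_coordinate (u.left z)
    obtain ⟨V, hV, hzV, hle⟩ := exists_isAffineOpen_mem_and_subset
      (U := u.left ⁻¹ᵁ j.opensRange) (x := z) hz
    let l : Spec Γ(Z'.left, V) ⟶ Spec B := IsOpenImmersion.lift j (hV.fromSpec ≫ u.left) (by
      rintro _ ⟨x, rfl⟩
      have : hV.fromSpec x ∈ V := by
        have := hV.range_fromSpec
        rw [← SetLike.mem_coe, ← this]; exact ⟨x, rfl⟩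
      exact hle this)
    obtain ⟨χ', hχ'⟩ := IsExtension.restrict_coordinate u j hχ hV.fromSpec l
      (IsOpenImmersion.lift_fac _ _ _)
    rw [hc] at hχ'
    exact ⟨_, hV.fromSpec, inferInstance, by rwa [hV.range_fromSpec], χ', hχ'⟩

variable (ρ q d' M)

/-- The functor of extensions of the action of `A` on `M` to an action of `A'`, on schemes over a
scheme `P` with given morphisms to `Spec A'` and `S`. -/
noncomputable def extensionFunctor {P : Scheme.{u}} (cP : P ⟶ Spec A') (p : P ⟶ S) :
    (Over P)ᵒᵖ ⥤ Type u where
  obj X := {e : A' → ((Over.map p).obj X.unop ⊗ M.E.X ⟶ M.E.X) //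
    IsExtension ρ q d' M ((Over.map p).obj X.unop) (X.unop.hom ≫ cP) e}
  map {X Y} v := TypeCat.ofHom fun e => ⟨fun a => restrictAct ((Over.map p).map v.unop) (e.1 a),
    e.2.restrict ((Over.map p).map v.unop) (by
      change v.unop.left ≫ X.unop.hom ≫ cP = _
      rw [← Category.assoc, Over.w])⟩
  map_id X := by
    refine ConcreteCategory.hom_ext _ _ fun e => Subtype.ext (funext fun a => act_ext fun T x y => ?_)
    refine (act_restrictAct _ _ _ _).trans ?_
    exact congrArg (fun x => act (e.1 a) x y)
      ((congrArg (x ≫ ·) ((Over.map p).map_id X.unop)).trans (Category.comp_id x))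
  map_comp v w := by
    refine ConcreteCategory.hom_ext _ _ fun e => Subtype.ext (funext fun a => act_ext fun T x y => ?_)
    refine (act_restrictAct _ _ _ _).trans ?_
    refine Eq.trans ?_ (act_restrictAct _ _ _ _).symm
    refine Eq.trans ?_ (act_restrictAct _ _ _ _).symm
    exact congrArg (fun x => act (e.1 a) x y)
      ((congrArg (x ≫ ·) ((Over.map p).map_comp w.unop v.unop)).trans (Category.assoc _ _ _).symm)

variable {ρ q d' M} in
lemma act_extensionFunctor_map {P : Scheme.{u}} {cP : P ⟶ Spec A'} {p : P ⟶ S} {X Y : Over P}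
    (v : Y ⟶ X) (e : (extensionFunctor ρ q d' M cP p).obj (op X)) (a : A') {T : Over S}
    (x : T ⟶ (Over.map p).obj Y) (y : T ⟶ M.E.X) :
    act (((extensionFunctor ρ q d' M cP p).map v.op e).1 a) x y =
      act (e.1 a) (x ≫ (Over.map p).map v) y :=
  act_restrictAct _ _ _ _

end Extension

/-! ### Triples as extensions of the action -/

section BasePoint

variable {S X : Scheme.{u}} {f : X ⟶ S} {T T' : Over S}

/-- An `S`-scheme over `X`, as an `X`-scheme. -/
noncomputable def overTop (x : T ⟶ Over.mk f) : Over X := Over.mk (Y := T.left) x.left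

/-- An `S`-scheme over `X` is obtained by composition from the corresponding `X`-scheme. -/
noncomputable def overTopMap (x : T ⟶ Over.mk f) : (Over.map f).obj (overTop x) ⟶ T :=
  Over.homMk (𝟙 _) ((Category.id_comp T.hom).trans (Over.w x).symm)

/-- The inverse of `overTopMap`. -/
noncomputable def overTopInv (x : T ⟶ Over.mk f) : T ⟶ (Over.map f).obj (overTop x) :=
  Over.homMk (𝟙 _) ((Category.id_comp _).trans (Over.w x))

lemma overTopInv_overTopMap (x : T ⟶ Over.mk f) : overTopInv x ≫ overTopMap x = 𝟙 _ :=
  Over.OverMorphism.ext (Category.id_comp _)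

lemma overTopMap_overTopInv (x : T ⟶ Over.mk f) : overTopMap x ≫ overTopInv x = 𝟙 _ :=
  Over.OverMorphism.ext (Category.id_comp _)

/-- The functoriality of `overTop`. -/
noncomputable def overTopComp (g : T' ⟶ T) {x : T ⟶ Over.mk f} {x' : T' ⟶ Over.mk f}
    (h : g ≫ x = x') : overTop x' ⟶ overTop x :=
  Over.homMk g.left (congrArg Over.Hom.left h)

lemma overTopMap_comp (g : T' ⟶ T) {x : T ⟶ Over.mk f} {x' : T' ⟶ Over.mk f} (h : g ≫ x = x') :
    overTopMap x' ≫ g = (Over.map f).map (overTopComp g h) ≫ overTopMap x :=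
  Over.OverMorphism.ext ((Category.id_comp g.left).trans (Category.comp_id g.left).symm)

end BasePoint

namespace Triple

variable {A A' : CommRingCat.{u}} {ρ : A ⟶ A'} {q : ℕ} {d' : A' → ℤ}
  {S : Scheme.{u}} {M : ModuleScheme A S} {X : Scheme.{u}}
  {c' : X ⟶ Spec A'} {f : X ⟶ S} (t t₁ t₂ : Triple ρ q d' M c' f) {T T' : Over S}

/-- The morphism of schemes underlying `α`. -/
noncomputable def homα : ((groupPullback f).obj M.E).X ⟶ t.N.E.X := ModuleScheme.und t.α.hom

/-- The morphism of schemes underlying `α⁻¹`. -/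
noncomputable def invα : t.N.E.X ⟶ ((groupPullback f).obj M.E).X := ModuleScheme.und t.α.inv

lemma homα_invα : t.homα ≫ t.invα = 𝟙 _ :=
  congrArg ModuleScheme.und t.α.hom_inv_id

lemma invα_homα : t.invα ≫ t.homα = 𝟙 _ :=
  congrArg ModuleScheme.und t.α.inv_hom_id

lemma comp_homα (a : A) : toSchemeHom ((groupPullback f).map (M.φ a)) ≫ t.homα =
    t.homα ≫ toSchemeHom (t.N.φ (ρ.hom a)) :=
  congrArg toSchemeHom (t.α.hom.comm a)

lemma mul_homα {T : Over X} (y z : T ⟶ ((groupPullback f).obj M.E).X) :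
    (y * z) ≫ t.homα = (y ≫ t.homα) * (z ≫ t.homα) :=
  ModuleScheme.toSchemeHom_mul t.α.hom.hom y z

/-- Through `α`, the points of `E` with values in schemes over `X` are points of `E'`. -/
noncomputable def pointEquiv (x : T ⟶ Over.mk f) : (T ⟶ M.E.X) ≃ (overTop x ⟶ t.N.E.X) where
  toFun y := (pointsEquiv f M.E (overTop x)).symm (overTopMap x ≫ y) ≫ t.homα
  invFun z := overTopInv x ≫ pointsEquiv f M.E (overTop x) (z ≫ t.invα)
  left_inv y := by
    simp only [Category.assoc, homα_invα, Category.comp_id, Equiv.apply_symm_apply]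
    rw [← Category.assoc, overTopInv_overTopMap, Category.id_comp]
  right_inv z := by
    dsimp only
    rw [← Category.assoc (overTopMap x), overTopMap_overTopInv, Category.id_comp,
      Equiv.symm_apply_apply, Category.assoc, invα_homα, Category.comp_id]

lemma pointEquiv_apply (x : T ⟶ Over.mk f) (y : T ⟶ M.E.X) : t.pointEquiv x y =
    (pointsEquiv f M.E (overTop x)).symm (overTopMap x ≫ y) ≫ t.homα := rfl

lemma pointEquiv_comp (g : T' ⟶ T) {x : T ⟶ Over.mk f} {x' : T' ⟶ Over.mk f}
    (h : g ≫ x = x') (y : T ⟶ M.E.X) :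
    t.pointEquiv x' (g ≫ y) = overTopComp g h ≫ t.pointEquiv x y := by
  rw [pointEquiv_apply, pointEquiv_apply, ← Category.assoc, ← Category.assoc]
  congr 1
  rw [Equiv.symm_apply_eq, pointsEquiv_comp, Equiv.apply_symm_apply, overTopMap_comp,
    Category.assoc]

lemma pointEquiv_mul (x : T ⟶ Over.mk f) (y z : T ⟶ M.E.X) :
    t.pointEquiv x (y * z) = t.pointEquiv x y * t.pointEquiv x z := by
  rw [pointEquiv_apply, MonObj.comp_mul, pointsEquiv_symm_mul, mul_homα]
  rfl

lemma pointEquiv_act (x : T ⟶ Over.mk f) (y : T ⟶ M.E.X) (a : A) :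
    t.pointEquiv x (y ≫ toSchemeHom (M.φ a)) =
      t.pointEquiv x y ≫ toSchemeHom (t.N.φ (ρ.hom a)) := by
  rw [pointEquiv_apply, pointEquiv_apply, Category.assoc, ← comp_homα, ← Category.assoc,
    ← Category.assoc]
  congr 1
  rw [Equiv.symm_apply_eq, pointsEquiv_comp_map, Equiv.apply_symm_apply]

/-- The action of `A'` on `E'`, transported to `E` through `α`. -/
noncomputable def action (a : A') : Over.mk f ⊗ M.E.X ⟶ M.E.X :=
  (t.pointEquiv (fst _ _)).symm (t.pointEquiv (fst _ _) (snd _ _) ≫ toSchemeHom (t.N.φ a))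

lemma pointEquiv_act_action (a : A') (x : T ⟶ Over.mk f) (y : T ⟶ M.E.X) :
    t.pointEquiv x (act (t.action a) x y) = t.pointEquiv x y ≫ toSchemeHom (t.N.φ a) := by
  rw [act, t.pointEquiv_comp (lift x y) (lift_fst x y), action, Equiv.apply_symm_apply,
    ← Category.assoc, ← t.pointEquiv_comp (lift x y) (lift_fst x y), lift_snd]

/-- The coordinate on `E` induced by a coordinate on `E'`. -/
noncomputable def coordinate {B : CommRingCat.{u}} {j : Spec B ⟶ X} (χ : Coordinate t.N.E j) :
    Coordinate M.E (j ≫ f) where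
  equiv {T} s := (t.pointEquiv (s ≫ (Over.homMk j : Over.mk (j ≫ f) ⟶ Over.mk f))).trans
    (χ.equiv (Over.homMk s.left rfl))
  map_mul s y z := (congrArg _ (t.pointEquiv_mul _ y z)).trans (χ.map_mul _ _ _)
  naturality g s y := (congrArg _ (t.pointEquiv_comp g (Category.assoc _ _ _).symm y)).trans
    (χ.naturality (overTopComp g (Category.assoc _ _ _).symm) (Over.homMk s.left rfl) _)

/-- The transported action extends the given one because `α` is `A`-linear, and coordinates on `E'`
yield coordinates on `E` in which it is of Drinfeld type. -/
lemma isExtension_action : IsExtension ρ q d' M (Over.mk f) c' t.action where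
  act_mul a T x y z := by
    apply (t.pointEquiv x).injective
    rw [pointEquiv_act_action, pointEquiv_mul, pointEquiv_mul, pointEquiv_act_action,
      pointEquiv_act_action, ModuleScheme.toSchemeHom_mul]
  one_act x y := by
    apply (t.pointEquiv x).injective
    rw [pointEquiv_act_action, t.N.comp_φ_one]
  mul_act a b T x y := by
    apply (t.pointEquiv x).injective
    rw [pointEquiv_act_action, pointEquiv_act_action, pointEquiv_act_action, t.N.comp_φ_mul]
  add_act a b T x y := by
    apply (t.pointEquiv x).injective
    rw [pointEquiv_act_action, pointEquiv_mul, pointEquiv_act_action, pointEquiv_act_action,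
      t.N.comp_φ_add]
  restrict_act a T x y := by
    apply (t.pointEquiv x).injective
    rw [pointEquiv_act_action, pointEquiv_act]
  exists_coordinate z := by
    obtain ⟨B, j, hj, hz, χ, hχ⟩ := ModuleScheme.isDrinfeld_iff.1 t.isDrinfeld z
    refine ⟨B, j, hj, hz, t.coordinate χ, fun a ha => ?_⟩
    obtain ⟨δ, h1, h2⟩ := hχ a ha
    refine ⟨δ, fun T s y => ?_, h2⟩
    refine (congrArg _ (t.pointEquiv_act_action a _ y)).trans ?_
    exact h1 _ _ _

variable {t₁ t₂} in
/-- Triples which induce the same action are isomorphic. -/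
lemma rel_of_action_eq (h : ∀ a, t₁.action a = t₂.action a) : Rel t₁ t₂ := by
  let β : t₁.N.E ≅ t₂.N.E :=
    { hom := t₁.α.inv.hom ≫ t₂.α.hom.hom
      inv := t₂.α.inv.hom ≫ t₁.α.hom.hom
      hom_inv_id := congrArg ModuleScheme.Hom.hom
        (show (t₁.α.inv ≫ t₂.α.hom) ≫ (t₂.α.inv ≫ t₁.α.hom) = 𝟙 _ by simp)
      inv_hom_id := congrArg ModuleScheme.Hom.hom
        (show (t₂.α.inv ≫ t₁.α.hom) ≫ (t₁.α.inv ≫ t₂.α.hom) = 𝟙 _ by simp) }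
  have hβ : t₁.homα ≫ toSchemeHom β.hom = t₂.homα :=
    congrArg ModuleScheme.und (show t₁.α.hom ≫ (t₁.α.inv ≫ t₂.α.hom) = t₂.α.hom by simp)
  have hp : ∀ (T : Over S) (x : T ⟶ Over.mk f) (y : T ⟶ M.E.X),
      t₂.pointEquiv x y = t₁.pointEquiv x y ≫ toSchemeHom β.hom := fun T x y => by
    rw [pointEquiv_apply, pointEquiv_apply, Category.assoc, hβ]
  refine ⟨ModuleScheme.mkIso β fun a => ?_, ?_⟩
  · let T : Over S := (Over.map f).obj t₁.N.E.X
    let x : T ⟶ Over.mk f := Over.homMk t₁.N.E.X.hom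
    let i : overTop x ⟶ t₁.N.E.X := 𝟙 _
    have h1 := t₂.pointEquiv_act_action a x ((t₁.pointEquiv x).symm i)
    rw [← h, hp, hp, t₁.pointEquiv_act_action, Equiv.apply_symm_apply] at h1
    have h2 : toSchemeHom (t₁.N.φ a) ≫ toSchemeHom β.hom =
        toSchemeHom β.hom ≫ toSchemeHom (t₂.N.φ a) := by
      have e1 := (Category.assoc _ _ _).symm.trans (h1.trans (Category.assoc _ _ _))
      exact (Category.id_comp _).symm.trans (e1.trans (Category.id_comp _))
    exact CommGrp.hom_ext _ _ h2
  · exact ModuleScheme.und_ext hβ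

end Triple

namespace Triple

variable {A A' : CommRingCat.{u}} {ρ : A ⟶ A'} {q : ℕ} {d' : A' → ℤ}
  {S : Scheme.{u}} {M : ModuleScheme A S} {X Y : Scheme.{u}}
  {c' : X ⟶ Spec A'} {f : X ⟶ S} {cY : Y ⟶ Spec A'} {fY : Y ⟶ S}

lemma pointsEquiv_symm_left_toBase (f : X ⟶ S) (E : CommGrp (Over S)) (T : Over X)
    (y : (Over.map f).obj T ⟶ E.X) :
    ((pointsEquiv f E T).symm y).left ≫ toBase f E.X = y.left := by
  change ((Over.mapPullbackAdj f).homEquiv T E.X y).left ≫ toBase f E.X = y.left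
  rw [Over.mapPullbackAdj, Adjunction.mkOfHomEquiv_homEquiv]
  exact pullback.lift_fst _ _ _

lemma pointsEquiv_symm_overTopMap_left {E : CommGrp (Over S)} {T : Over S} (x : T ⟶ Over.mk f)
    (y : T ⟶ E.X) :
    ((pointsEquiv f E (overTop x)).symm (overTopMap x ≫ y)).left ≫ toBase f E.X = y.left :=
  (pointsEquiv_symm_left_toBase f E (overTop x) _).trans (Category.id_comp y.left)

lemma comp_pullbackCompHom_map_left {u : Y ⟶ X} {g : Y ⟶ S} (h : u ≫ f = g) {Z : Over S}
    {W : Scheme.{u}} {a : W ⟶ Y} {b : W ⟶ X} (hab : a ≫ u = b)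
    (y₁ : Over.mk a ⟶ (Over.pullback g).obj Z) (y₂ : Over.mk b ⟶ (Over.pullback f).obj Z)
    (hy : y₁.left ≫ toBase g Z = y₂.left ≫ toBase f Z) {N : Over X}
    (m : (Over.pullback f).obj Z ⟶ N) :
    (y₁ ≫ pullbackCompHom u f g h Z ≫ (Over.pullback u).map m).left ≫ toBase u N =
      (y₂ ≫ m).left := by
  have key : y₁.left ≫ (pullbackCompHom u f g h Z).left ≫ toBase u _ = y₂.left := by
    refine pullback.hom_ext ?_ ?_
    · change (_ ≫ _ ≫ _) ≫ toBase f Z = _ ≫ toBase f Z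
      rw [Category.assoc, Category.assoc, pullbackCompHom_left, hy]
    · change (_ ≫ _ ≫ _) ≫ ((Over.pullback f).obj Z).hom = _ ≫ ((Over.pullback f).obj Z).hom
      rw [Category.assoc, Category.assoc, toBase_comp_hom,
        ← Category.assoc (Over.Hom.left (pullbackCompHom u f g h Z)), Over.w, ← Category.assoc]
      exact (congrArg (· ≫ u) (Over.w y₁)).trans (hab.trans (Over.w y₂).symm)
  rw [Over.comp_left, Over.comp_left, Over.comp_left, Category.assoc, Category.assoc,
    map_left_toBase, ← key]
  simp only [Category.assoc]

/-- The points of a triple and of its pullback. -/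
lemma pointEquiv_pullback (t : Triple ρ q d' M c' f) (u : Y ⟶ X) (hc : u ≫ c' = cY)
    (hf : u ≫ f = fY) {T : Over S} (x : T ⟶ Over.mk fY) (x' : T ⟶ Over.mk f)
    (hx : x.left ≫ u = x'.left) (y : T ⟶ M.E.X) :
    ((t.pullback u hc hf).pointEquiv x y).left ≫ toBase u t.N.E.X = (t.pointEquiv x' y).left := by
  have h0 : (t.pullback u hc hf).homα =
      pullbackCompHom u f fY hf M.E.X ≫ (Over.pullback u).map t.homα :=
    ModuleScheme.und_pullbackIso u f fY hf t.α
  rw [pointEquiv_apply, h0]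
  have h1 := (pointsEquiv_symm_overTopMap_left x y).trans
    (pointsEquiv_symm_overTopMap_left x' y).symm
  exact comp_pullbackCompHom_map_left (f := f) (g := fY) hf (Z := M.E.X) (W := T.left)
    (a := x.left) (b := x'.left) hx _ _ h1 (N := t.N.E.X) t.homα

/-- The action of a pullback is the restriction of the action. -/
lemma action_pullback (t : Triple ρ q d' M c' f) (u : Y ⟶ X) (hc : u ≫ c' = cY)
    (hf : u ≫ f = fY) (u' : Over.mk fY ⟶ Over.mk f) (hu : u'.left = u) (a : A') :
    (t.pullback u hc hf).action a = restrictAct u' (t.action a) := by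
  refine act_ext fun T x y => ?_
  rw [act_restrictAct]
  apply ((t.pullback u hc hf).pointEquiv x).injective
  have hx : x.left ≫ u = (x ≫ u').left := by rw [← hu]; rfl
  rw [pointEquiv_act_action]
  apply pullback_hom_ext
  refine Eq.trans ?_ (t.pointEquiv_pullback u hc hf x (x ≫ u') hx _).symm
  rw [pointEquiv_act_action]
  have h1 : (toSchemeHom ((t.pullback u hc hf).N.φ a)).left ≫ toBase u t.N.E.X =
    toBase u t.N.E.X ≫ (toSchemeHom (t.N.φ a)).left := map_left_toBase u _
  have h2 := t.pointEquiv_pullback u hc hf x (x ≫ u') hx y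
  exact (Category.assoc _ _ _).trans ((congrArg (_ ≫ ·) h1).trans
    ((Category.assoc _ _ _).symm.trans (congrArg (· ≫ _) h2)))

end Triple

namespace IsExtension

variable {A A' : CommRingCat.{u}} {ρ : A ⟶ A'} {q : ℕ} {d' : A' → ℤ}
  {S : Scheme.{u}} {M : ModuleScheme A S} {X : Scheme.{u}}
  {c' : X ⟶ Spec A'} {f : X ⟶ S} {e : A' → (Over.mk f ⊗ M.E.X ⟶ M.E.X)}

/-- The structure morphism of an `X`-scheme, as a morphism of `S`-schemes. -/
noncomputable def structureMap (f : X ⟶ S) (T : Over X) : (Over.map f).obj T ⟶ Over.mk f :=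
  Over.homMk T.hom

lemma map_structureMap (f : X ⟶ S) {T T' : Over X} (g : T' ⟶ T) :
    (Over.map f).map g ≫ structureMap f T = structureMap f T' :=
  Over.OverMorphism.ext (Over.w g)

/-- The endomorphism of the pullback of `E` to `X` given by `a ∈ A'`. -/
noncomputable def endo (e : A' → (Over.mk f ⊗ M.E.X ⟶ M.E.X)) (a : A') :
    ((groupPullback f).obj M.E).X ⟶ ((groupPullback f).obj M.E).X :=
  (pointsEquiv f M.E _).symm (act (e a) (structureMap f _) (pointsEquiv f M.E _ (𝟙 _)))

lemma pointsEquiv_comp_endo (a : A') {T : Over X} (z : T ⟶ ((groupPullback f).obj M.E).X) :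
    pointsEquiv f M.E T (z ≫ endo e a) =
      act (e a) (structureMap f T) (pointsEquiv f M.E T z) := by
  rw [pointsEquiv_comp, endo, Equiv.apply_symm_apply, ← comp_act, map_structureMap,
    ← pointsEquiv_comp, Category.comp_id]

lemma mul_comp_endo (h : IsExtension ρ q d' M (Over.mk f) c' e) (a : A') {T : Over X}
    (y z : T ⟶ ((groupPullback f).obj M.E).X) :
    (y * z) ≫ endo e a = (y ≫ endo e a) * (z ≫ endo e a) := by
  apply (pointsEquiv f M.E T).injective
  rw [pointsEquiv_mul, pointsEquiv_comp_endo, pointsEquiv_comp_endo, pointsEquiv_comp_endo,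
    pointsEquiv_mul, h.act_mul]

lemma isMonHom_endo (h : IsExtension ρ q d' M (Over.mk f) c' e) (a : A') :
    IsMonHom (endo e a) where
  one_hom := by
    have h1 : (1 : 𝟙_ (Over X) ⟶ ((groupPullback f).obj M.E).X) ≫ endo e a = 1 := by
      have := h.mul_comp_endo a (1 : 𝟙_ (Over X) ⟶ ((groupPullback f).obj M.E).X) 1
      rwa [mul_one, left_eq_mul] at this
    rwa [← MonObj.one_eq_one] at h1
  mul_hom := by
    rw [MonObj.mul_eq_mul, h.mul_comp_endo, MonObj.comp_mul, tensorHom_fst, tensorHom_snd]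

/-- The endomorphism of the group scheme given by `a ∈ A'`. -/
noncomputable def groupEndo (h : IsExtension ρ q d' M (Over.mk f) c' e) (a : A') :
    (groupPullback f).obj M.E ⟶ (groupPullback f).obj M.E :=
  have := h.isMonHom_endo a
  InducedCategory.homMk (Grp.homMk (endo e a))

/-- The `A'`-module scheme given by an extension of the action. -/
noncomputable def moduleScheme (h : IsExtension ρ q d' M (Over.mk f) c' e) : ModuleScheme A' X where
  E := (groupPullback f).obj M.E
  φ := h.groupEndo
  isAction :=
    { map_one := CommGrp.hom_ext _ _ <| (pointsEquiv f M.E _).injective <| by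
        have := pointsEquiv_comp_endo (e := e) 1 (𝟙 ((groupPullback f).obj M.E).X)
        rw [h.one_act, Category.id_comp] at this
        exact this
      map_mul := fun a b => CommGrp.hom_ext _ _ <| (pointsEquiv f M.E _).injective <| by
        have h1 := pointsEquiv_comp_endo (e := e) (a * b) (𝟙 ((groupPullback f).obj M.E).X)
        rw [h.mul_act, ← pointsEquiv_comp_endo, ← pointsEquiv_comp_endo, Category.id_comp,
          Category.id_comp] at h1
        exact h1
      map_add := fun a b => (pointsEquiv f M.E _).injective <| by
        have h1 := pointsEquiv_comp_endo (e := e) (a + b) (𝟙 ((groupPullback f).obj M.E).X)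
        rw [h.add_act, ← pointsEquiv_comp_endo, ← pointsEquiv_comp_endo, ← pointsEquiv_mul,
          Category.id_comp, Category.id_comp, Category.id_comp] at h1
        exact h1 }

/-- A morphism of `X`-schemes to `Spec B`, as a morphism of `S`-schemes. -/
noncomputable def mapLift (f : X ⟶ S) {B : CommRingCat.{u}} {j : Spec B ⟶ X} {T : Over X}
    (s : T ⟶ Over.mk j) : (Over.map f).obj T ⟶ Over.mk (j ≫ f) :=
  Over.homMk s.left ((Category.assoc s.left j f).symm.trans (congrArg (· ≫ f) (Over.w s)))

lemma mapLift_comp (f : X ⟶ S) {B : CommRingCat.{u}} {j : Spec B ⟶ X} {T T' : Over X}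
    (g : T' ⟶ T) (s : T ⟶ Over.mk j) : mapLift f (g ≫ s) = (Over.map f).map g ≫ mapLift f s :=
  Over.OverMorphism.ext rfl

/-- The coordinate on the pullback of `E` to `X` induced by a coordinate on `E`. -/
noncomputable def coordinate (M : ModuleScheme A S) (f : X ⟶ S) {B : CommRingCat.{u}}
    {j : Spec B ⟶ X} (χ : Coordinate M.E (j ≫ f)) :
    Coordinate ((groupPullback f).obj M.E) j where
  equiv {T} s := (pointsEquiv f M.E T).trans
    (χ.equiv (mapLift f s))
  map_mul s y z := (congrArg _ (pointsEquiv_mul f M.E _ y z)).trans (χ.map_mul _ _ _)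
  naturality g s y := by
    have h := χ.naturality ((Over.map f).map g) (mapLift f s) (pointsEquiv f M.E _ y)
    rw [← mapLift_comp, ← pointsEquiv_comp] at h
    exact h

lemma isDrinfeld_moduleScheme (h : IsExtension ρ q d' M (Over.mk f) c' e) :
    h.moduleScheme.IsDrinfeld q d' c' := by
  rw [ModuleScheme.isDrinfeld_iff]
  intro x
  obtain ⟨B, j, hj, hx, χ, hχ⟩ := h.exists_coordinate x
  refine ⟨B, j, hj, hx, coordinate M f χ, fun a ha => ?_⟩
  obtain ⟨δ, h1, h2⟩ := hχ a ha
  refine ⟨δ, fun T s y => ?_, h2⟩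
  have h3 := h1 ((Over.map f).obj T) (mapLift f s) (pointsEquiv f M.E T y)
  refine Eq.trans ?_ h3
  refine congrArg (χ.equiv (mapLift f s)) ((pointsEquiv_comp_endo a y).trans ?_)
  exact congrArg (fun x => act (e a) x _) (Over.OverMorphism.ext (Over.w s).symm)

/-- The triple given by an extension of the action. -/
noncomputable def triple (h : IsExtension ρ q d' M (Over.mk f) c' e) : Triple ρ q d' M c' f where
  N := h.moduleScheme
  isDrinfeld := h.isDrinfeld_moduleScheme
  α := ModuleScheme.mkIso (Iso.refl _) fun a => by
    refine (Category.comp_id _).trans (Eq.trans ?_ (Category.id_comp _).symm)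
    refine CommGrp.hom_ext _ _ ((pointsEquiv f M.E _).injective ?_)
    have h1 := pointsEquiv_comp_endo (e := e) (ρ.hom a) (𝟙 ((groupPullback f).obj M.E).X)
    have h2 := pointsEquiv_comp_map f (M.φ a) (𝟙 ((groupPullback f).obj M.E).X)
    rw [h.restrict_act, ← h2, Category.id_comp, Category.id_comp] at h1
    exact h1.symm

lemma triple_homα (h : IsExtension ρ q d' M (Over.mk f) c' e) :
    h.triple.homα = 𝟙 ((groupPullback f).obj M.E).X := rfl

lemma triple_action (h : IsExtension ρ q d' M (Over.mk f) c' e) (a : A') :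
    h.triple.action a = e a := by
  refine act_ext fun T x y => ?_
  apply (h.triple.pointEquiv x).injective
  rw [Triple.pointEquiv_act_action]
  have hp : ∀ y, h.triple.pointEquiv x y = (pointsEquiv f M.E (overTop x)).symm (overTopMap x ≫ y) :=
    fun y => by
      rw [Triple.pointEquiv_apply, triple_homα]
      exact Category.comp_id _
  rw [hp, hp]
  apply (pointsEquiv f M.E (overTop x)).injective
  refine (pointsEquiv_comp_endo a _).trans ?_
  rw [Equiv.apply_symm_apply, Equiv.apply_symm_apply, ← comp_act]
  exact congrArg (fun x => act (e a) x _) (Over.OverMorphism.ext (Category.id_comp _).symm)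

end IsExtension

namespace Triple

variable {A A' : CommRingCat.{u}} {ρ : A ⟶ A'} {q : ℕ} {d' : A' → ℤ}
  {S : Scheme.{u}} {M : ModuleScheme A S} {X : Scheme.{u}}
  {c' : X ⟶ Spec A'} {f : X ⟶ S} {t₁ t₂ : Triple ρ q d' M c' f}

lemma Rel.action_eq (h : Rel t₁ t₂) (a : A') : t₁.action a = t₂.action a := by
  obtain ⟨β, h⟩ := h
  have hβ : t₁.homα ≫ toSchemeHom β.hom.hom = t₂.homα := congrArg ModuleScheme.und h
  have hp : ∀ (T : Over S) (x : T ⟶ Over.mk f) (y : T ⟶ M.E.X),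
      t₂.pointEquiv x y = t₁.pointEquiv x y ≫ toSchemeHom β.hom.hom := fun T x y => by
    rw [pointEquiv_apply, pointEquiv_apply, Category.assoc, hβ]
  have h1 : toSchemeHom (t₁.N.φ a) ≫ toSchemeHom β.hom.hom =
      toSchemeHom β.hom.hom ≫ toSchemeHom (t₂.N.φ a) := congrArg toSchemeHom (β.hom.comm a)
  refine act_ext fun T x y => (t₂.pointEquiv x).injective ?_
  rw [pointEquiv_act_action, hp, hp, pointEquiv_act_action, Category.assoc, Category.assoc, h1]

end Triple

section Representable

variable {A A' : CommRingCat.{u}} (ρ : A ⟶ A') (q : ℕ) (d' : A' → ℤ)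
  {S : Scheme.{u}} (c : S ⟶ Spec A) (M : ModuleScheme A S)

/-- The action of `A'` given by an isomorphism class of triples. -/
noncomputable def tripleAction (X : Over (pullback (Spec.map ρ) c))
    (t : (tripleFunctor ρ q d' c M).obj (op X)) :
    (extensionFunctor ρ q d' M (pullback.fst (Spec.map ρ) c)
      (pullback.snd (Spec.map ρ) c)).obj (op X) :=
  Quotient.lift (s := Triple.setoid ρ q d' M (X.hom ≫ pullback.fst (Spec.map ρ) c)
    (X.hom ≫ pullback.snd (Spec.map ρ) c)) (fun t => ⟨t.action, t.isExtension_action⟩)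
    (fun _ _ h => Subtype.ext (funext h.action_eq)) t

/-- Isomorphism classes of triples are the same as extensions of the action. -/
noncomputable def tripleEquiv (X : Over (pullback (Spec.map ρ) c)) :
    (tripleFunctor ρ q d' c M).obj (op X) ≃
      (extensionFunctor ρ q d' M (pullback.fst (Spec.map ρ) c)
        (pullback.snd (Spec.map ρ) c)).obj (op X) :=
  Equiv.ofBijective (tripleAction ρ q d' c M X) <| by
    refine ⟨fun t₁ t₂ h => ?_, fun e => ?_⟩
    · induction t₁ using Quotient.inductionOn with | h t₁ => ?_
      induction t₂ using Quotient.inductionOn with | h t₂ => ?_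
      exact Quotient.sound (Triple.rel_of_action_eq fun a => congrFun (congrArg Subtype.val h) a)
    · obtain ⟨e, he⟩ := e
      exact ⟨Quotient.mk _ (IsExtension.triple he), Subtype.ext (funext he.triple_action)⟩

lemma tripleEquiv_naturality {X Y : Over (pullback (Spec.map ρ) c)} (v : Y ⟶ X)
    (t : (tripleFunctor ρ q d' c M).obj (op X)) :
    tripleEquiv ρ q d' c M Y ((tripleFunctor ρ q d' c M).map v.op t) =
      (extensionFunctor ρ q d' M _ _).map v.op (tripleEquiv ρ q d' c M X t) := by
  induction t using Quotient.inductionOn with | h t => ?_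
  exact Subtype.ext (funext fun a => t.action_pullback v.left _ _
    ((Over.map (pullback.snd (Spec.map ρ) c)).map v) rfl a)

variable {ρ q d' c M}

/-- The functors of triples and of extensions of the action are represented by the same
schemes. -/
noncomputable def representableByEquiv {T : Over (pullback (Spec.map ρ) c)} :
    (tripleFunctor ρ q d' c M).RepresentableBy T ≃
      (extensionFunctor ρ q d' M (pullback.fst (Spec.map ρ) c)
        (pullback.snd (Spec.map ρ) c)).RepresentableBy T where
  toFun r :=
    { homEquiv := r.homEquiv.trans (tripleEquiv ρ q d' c M _)
      homEquiv_comp := fun f g => by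
        simp only [Equiv.trans_apply]
        rw [r.homEquiv_comp, tripleEquiv_naturality] }
  invFun r :=
    { homEquiv := r.homEquiv.trans (tripleEquiv ρ q d' c M _).symm
      homEquiv_comp := fun f g => by
        simp only [Equiv.trans_apply]
        rw [r.homEquiv_comp, Equiv.symm_apply_eq, tripleEquiv_naturality, Equiv.apply_symm_apply] }
  left_inv r := by
    ext
    simp
  right_inv r := by
    ext
    simp

end Representable

/-! ### Extensions of an action form a Zariski sheaf -/

section Covering

variable {S : Scheme.{u}} {J : Type*} {Z : Over S} {V : J → Over S}

/-- The morphisms `u i : V i ⟶ Z` of `S`-schemes are open immersions whose images cover `Z`. -/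
structure IsOpenCovering (u : ∀ i, V i ⟶ Z) : Prop where
  isOpenImmersion : ∀ i, IsOpenImmersion (u i).left
  exists_mem : ∀ z : Z.left, ∃ i, z ∈ Set.range (u i).left

variable {u : ∀ i, V i ⟶ Z}

/-- The open cover given by a covering family of open immersions. -/
def IsOpenCovering.cover (hu : IsOpenCovering u) : Z.left.OpenCover where
  I₀ := J
  X i := (V i).left
  f i := (u i).left
  mem₀ := by
    rw [Scheme.presieve₀_mem_precoverage_iff]
    exact ⟨hu.exists_mem, hu.isOpenImmersion⟩

variable {T Y : Over S}

/-- The inclusion into `T` of the part of `T` lying over `V i`. -/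
noncomputable def overPart (u : ∀ i, V i ⟶ Z) (x : T ⟶ Z) (i : J) :
    Over.mk (pullback.fst x.left (u i).left ≫ T.hom) ⟶ T :=
  Over.homMk (pullback.fst x.left (u i).left) rfl

/-- The morphism to `V i` from the part of `T` lying over `V i`. -/
noncomputable def overPartTo (u : ∀ i, V i ⟶ Z) (x : T ⟶ Z) (i : J) :
    Over.mk (pullback.fst x.left (u i).left ≫ T.hom) ⟶ V i :=
  Over.homMk (pullback.snd x.left (u i).left) (by
    change _ = _ ≫ T.hom
    rw [← Over.w (u i), ← Category.assoc, ← pullback.condition, Category.assoc, Over.w])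

lemma overPart_comp (u : ∀ i, V i ⟶ Z) (x : T ⟶ Z) (i : J) :
    overPart u x i ≫ x = overPartTo u x i ≫ u i :=
  Over.OverMorphism.ext pullback.condition

lemma exists_overPart (u : ∀ i, V i ⟶ Z) (x : T ⟶ Z) (i : J) {T' : Over S} (w : T' ⟶ T)
    (x' : T' ⟶ V i) (h : w ≫ x = x' ≫ u i) :
    ∃ g : T' ⟶ Over.mk (pullback.fst x.left (u i).left ≫ T.hom),
      g ≫ overPart u x i = w ∧ g ≫ overPartTo u x i = x' := by
  have h' : w.left ≫ x.left = x'.left ≫ (u i).left := congrArg CommaMorphism.left h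
  refine ⟨Over.homMk (pullback.lift w.left x'.left h') ?_,
    Over.OverMorphism.ext (pullback.lift_fst _ _ _),
    Over.OverMorphism.ext (pullback.lift_snd _ _ _)⟩
  change _ ≫ _ ≫ T.hom = _
  rw [pullback.lift_fst_assoc, Over.w]

lemma IsOpenCovering.pullback (hu : IsOpenCovering u) (x : T ⟶ Z) :
    IsOpenCovering (overPart u x) where
  isOpenImmersion i := by
    have := hu.isOpenImmersion i
    exact inferInstanceAs (IsOpenImmersion (pullback.fst x.left (u i).left))
  exists_mem t := by
    obtain ⟨i, v, hv⟩ := hu.exists_mem (x.left t)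
    obtain ⟨y, hy, -⟩ := Scheme.Pullback.exists_preimage_pullback t v hv.symm
    exact ⟨i, y, hy⟩

lemma IsOpenCovering.hom_ext (hu : IsOpenCovering u) {f g : Z ⟶ Y} (h : ∀ i, u i ≫ f = u i ≫ g) :
    f = g :=
  Over.OverMorphism.ext (hu.cover.hom_ext _ _ fun i => congrArg CommaMorphism.left (h i))

lemma IsOpenCovering.exists_glue (hu : IsOpenCovering u) (f : ∀ i, V i ⟶ Y)
    (h : ∀ i j {T : Over S} (a : T ⟶ V i) (b : T ⟶ V j), a ≫ u i = b ≫ u j → a ≫ f i = b ≫ f j) :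
    ∃ g : Z ⟶ Y, ∀ i, u i ≫ g = f i := by
  have key : ∀ i j, pullback.fst (hu.cover.f i) (hu.cover.f j) ≫ (f i).left =
      pullback.snd (hu.cover.f i) (hu.cover.f j) ≫ (f j).left := fun i j =>
    congrArg CommaMorphism.left (h i j (overPart u (u i) j) (overPartTo u (u i) j)
      (overPart_comp u (u i) j))
  refine ⟨Over.homMk (hu.cover.glueMorphisms (fun i => (f i).left) key)
    (hu.cover.hom_ext _ _ fun i => ?_), fun i => Over.OverMorphism.ext ?_⟩
  · exact (Category.assoc _ _ _).symm.trans
      ((congrArg (· ≫ Y.hom) (hu.cover.ι_glueMorphisms _ key i)).trans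
        ((Over.w (f i)).trans (Over.w (u i)).symm))
  · exact hu.cover.ι_glueMorphisms _ key i

/-- Two morphisms from `T` agree if they agree on `T`-schemes over the members of a covering. -/
lemma IsOpenCovering.hom_ext_of_comp (hu : IsOpenCovering u) (x : T ⟶ Z) {f g : T ⟶ Y}
    (h : ∀ i (T' : Over S) (w : T' ⟶ T) (x' : T' ⟶ V i), w ≫ x = x' ≫ u i → w ≫ f = w ≫ g) :
    f = g :=
  (hu.pullback x).hom_ext fun i => h i _ _ _ (overPart_comp u x i)

variable {E : CommGrp (Over S)}

/-- Actions on `E` are determined locally on the base. -/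
lemma IsOpenCovering.act_ext (hu : IsOpenCovering u) {e e' : Z ⊗ E.X ⟶ E.X}
    (h : ∀ i (T : Over S) (x : T ⟶ V i) (y : T ⟶ E.X), act e (x ≫ u i) y = act e' (x ≫ u i) y) :
    e = e' :=
  DrinfeldRestriction.act_ext fun T x y => hu.hom_ext_of_comp x fun i T' w x' hw => by
    rw [← comp_act, ← comp_act, hw, h]

/-- Compatible local actions on `E` glue. -/
lemma IsOpenCovering.exists_act (hu : IsOpenCovering u) (e : ∀ i, V i ⊗ E.X ⟶ E.X)
    (h : ∀ i j {T : Over S} (a : T ⟶ V i) (b : T ⟶ V j) (y : T ⟶ E.X), a ≫ u i = b ≫ u j →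
      act (e i) a y = act (e j) b y) :
    ∃ e' : Z ⊗ E.X ⟶ E.X, ∀ i (T : Over S) (x : T ⟶ V i) (y : T ⟶ E.X),
      act e' (x ≫ u i) y = act (e i) x y := by
  obtain ⟨e', he'⟩ := (hu.pullback (fst Z E.X)).exists_glue
    (fun i => act (e i) (overPartTo u (fst Z E.X) i) (overPart u (fst Z E.X) i ≫ snd Z E.X))
    (fun i j T a b hab => by
      rw [← comp_act, ← comp_act, ← Category.assoc, hab, Category.assoc]
      refine h i j _ _ _ ?_
      rw [Category.assoc, Category.assoc, ← overPart_comp, ← overPart_comp, ← Category.assoc, hab,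
        Category.assoc])
  refine ⟨e', fun i T x y => ?_⟩
  obtain ⟨g, hg, hg'⟩ := exists_overPart u (fst Z E.X) i (lift (x ≫ u i) y) x (lift_fst _ _)
  rw [act, ← hg, Category.assoc, he', ← comp_act, hg', ← Category.assoc, hg, lift_snd]

variable {A A' : CommRingCat.{u}} {ρ : A ⟶ A'} {q : ℕ} {d' : A' → ℤ} {M : ModuleScheme A S}

/-- Being an extension of the action can be checked on an open covering: the identities are
between morphisms, and the condition on coordinates is local by definition. -/
lemma IsExtension.of_isOpenCovering (hu : IsOpenCovering u) {c' : Z.left ⟶ Spec A'}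
    {e : A' → (Z ⊗ M.E.X ⟶ M.E.X)} (c₁ : ∀ i, (V i).left ⟶ Spec A')
    (hc : ∀ i, (u i).left ≫ c' = c₁ i)
    (h : ∀ i, IsExtension ρ q d' M (V i) (c₁ i) (fun a => restrictAct (u i) (e a))) :
    IsExtension ρ q d' M Z c' e where
  act_mul a T x y z := hu.hom_ext_of_comp x fun i T' w x' hw => by
    rw [MonObj.comp_mul, ← comp_act, ← comp_act, ← comp_act, hw, MonObj.comp_mul,
      ← act_restrictAct, (h i).act_mul, act_restrictAct, act_restrictAct]
  one_act x y := hu.hom_ext_of_comp x fun i T' w x' hw => by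
    rw [← comp_act, hw, ← act_restrictAct, (h i).one_act]
  mul_act a b T x y := hu.hom_ext_of_comp x fun i T' w x' hw => by
    rw [← comp_act, ← comp_act, ← comp_act, hw, ← act_restrictAct, (h i).mul_act, act_restrictAct,
      act_restrictAct]
  add_act a b T x y := hu.hom_ext_of_comp x fun i T' w x' hw => by
    rw [MonObj.comp_mul, ← comp_act, ← comp_act, ← comp_act, hw, ← act_restrictAct, (h i).add_act,
      act_restrictAct, act_restrictAct]
  restrict_act a T x y := hu.hom_ext_of_comp x fun i T' w x' hw => by
    rw [← comp_act, hw, ← act_restrictAct, (h i).restrict_act, Category.assoc]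
  exists_coordinate z := by
    obtain ⟨i, v, rfl⟩ := hu.exists_mem z
    obtain ⟨B, j, hj, hv, χ, hχ⟩ := (h i).exists_coordinate v
    have := hu.isOpenImmersion i
    have hw : (j ≫ (u i).left) ≫ Z.hom = j ≫ (V i).hom := by rw [Category.assoc, Over.w]
    refine ⟨B, j ≫ (u i).left, inferInstance, ?_, ?_⟩
    · obtain ⟨b, rfl⟩ := hv
      exact ⟨b, by simp⟩
    · have hT : ∀ {T : Over S} (t : T ⟶ Over.mk ((j ≫ (u i).left) ≫ Z.hom)),
          t ≫ (Over.homMk (j ≫ (u i).left) : _ ⟶ Z) =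
            ((t ≫ (Over.homMk (𝟙 (Spec B)) (by simp) :
              Over.mk ((j ≫ (u i).left) ≫ Z.hom) ⟶ Over.mk (j ≫ (V i).hom))) ≫
                (Over.homMk j : Over.mk (j ≫ (V i).hom) ⟶ V i)) ≫ u i := fun t => by
        apply Over.OverMorphism.ext
        simp
      refine ⟨χ.restrict (𝟙 _) (by simp), ?_⟩
      have h1 := hχ.restrict (𝟙 _) (j' := (j ≫ (u i).left) ≫ Z.hom) (by simp)
      have h2 : ∀ a, (Spec.preimage (𝟙 (Spec B))).hom ((Spec.preimage (j ≫ c₁ i)).hom a) =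
          (Spec.preimage ((j ≫ (u i).left) ≫ c')).hom a := fun a => by
        rw [Category.assoc, hc]
        have : Spec.preimage (𝟙 (Spec B)) = 𝟙 B := Spec.map_injective (by simp)
        rw [this]; rfl
      have h3 : ∀ a, (actOperation (restrictAct (u i) (e a))
          (Over.homMk j : Over.mk (j ≫ (V i).hom) ⟶ V i)).restrict (𝟙 _) (by simp) =
          actOperation (e a) (Over.homMk (j ≫ (u i).left) :
            Over.mk ((j ≫ (u i).left) ≫ Z.hom) ⟶ Z) := fun a => by
        simp only [PointOperation.restrict, actOperation, act_restrictAct, hT]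
      simp only [h2, h3] at h1
      exact h1

end Covering

section Sheaf

variable {A A' : CommRingCat.{u}} {ρ : A ⟶ A'} {q : ℕ} {d' : A' → ℤ} {S : Scheme.{u}}
  {M : ModuleScheme A S} {P : Scheme.{u}} {cP : P ⟶ Spec A'} {p : P ⟶ S} {J : Type*}
  {X : Over P} {V : J → Over P} {u : ∀ i, V i ⟶ X}

lemma IsOpenCovering.map (hu : IsOpenCovering u) (p : P ⟶ S) :
    IsOpenCovering (fun i => (Over.map p).map (u i)) :=
  ⟨hu.isOpenImmersion, hu.exists_mem⟩

lemma extensionFunctor_separated (hu : IsOpenCovering u)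
    {e e' : (extensionFunctor ρ q d' M cP p).obj (op X)}
    (h : ∀ i, (extensionFunctor ρ q d' M cP p).map (u i).op e =
      (extensionFunctor ρ q d' M cP p).map (u i).op e') : e = e' := by
  refine Subtype.ext (funext fun a => (hu.map p).act_ext fun i T x y => ?_)
  rw [← act_extensionFunctor_map (u i) e a x y, ← act_extensionFunctor_map (u i) e' a x y, h]

lemma exists_extensionFunctor_glue (hu : IsOpenCovering u)
    (e : ∀ i, (extensionFunctor ρ q d' M cP p).obj (op (V i)))
    (h : ∀ i j (T : Over P) (a : T ⟶ V i) (b : T ⟶ V j), a ≫ u i = b ≫ u j →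
      (extensionFunctor ρ q d' M cP p).map a.op (e i) =
        (extensionFunctor ρ q d' M cP p).map b.op (e j)) :
    ∃ e' : (extensionFunctor ρ q d' M cP p).obj (op X),
      ∀ i, (extensionFunctor ρ q d' M cP p).map (u i).op e' = e i := by
  have key : ∀ a' : A', ∃ e' : (Over.map p).obj X ⊗ M.E.X ⟶ M.E.X,
      ∀ i (T : Over S) (x : T ⟶ (Over.map p).obj (V i)) (y : T ⟶ M.E.X),
        act e' (x ≫ (Over.map p).map (u i)) y = act ((e i).1 a') x y := fun a' => by
    refine (hu.map p).exists_act (fun i => (e i).1 a') fun i j T a b y hab => ?_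
    have h1 : a.left ≫ (u i).left = b.left ≫ (u j).left := congrArg CommaMorphism.left hab
    have ha : a.left ≫ (V i).hom ≫ p = T.hom := Over.w a
    -- `T` regarded as a scheme over `P`, through its morphism to `V i`
    let T₀ : Over P := Over.mk (a.left ≫ (V i).hom)
    let a₀ : T₀ ⟶ V i := Over.homMk a.left rfl
    let b₀ : T₀ ⟶ V j := Over.homMk b.left (by
      change _ = a.left ≫ (V i).hom
      rw [← Over.w (u i), ← Over.w (u j), ← Category.assoc, ← Category.assoc, h1])
    have h2 := h i j T₀ a₀ b₀ (Over.OverMorphism.ext h1)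
    let t : T ⟶ (Over.map p).obj T₀ := Over.homMk (𝟙 T.left) (by
      change 𝟙 _ ≫ (a.left ≫ (V i).hom) ≫ p = _
      rw [Category.id_comp, Category.assoc, ha])
    have ea : t ≫ (Over.map p).map a₀ = a := Over.OverMorphism.ext (Category.id_comp _)
    have eb : t ≫ (Over.map p).map b₀ = b := Over.OverMorphism.ext (Category.id_comp _)
    rw [← ea, ← eb, ← act_extensionFunctor_map a₀ (e i) a' t y,
      ← act_extensionFunctor_map b₀ (e j) a' t y, h2]
  choose e' he' using key
  have hr : ∀ i, (fun a => restrictAct ((Over.map p).map (u i)) (e' a)) = (e i).1 := fun i =>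
    funext fun a => act_ext fun T x y => by rw [act_restrictAct, he']
  refine ⟨⟨e', IsExtension.of_isOpenCovering (hu.map p) (fun i => (V i).hom ≫ cP)
    (fun i => ?_) fun i => ?_⟩, fun i => Subtype.ext (hr i)⟩
  · change (u i).left ≫ X.hom ≫ cP = _
    rw [← Category.assoc, Over.w]
  · have h3 := (e i).2
    rw [← hr i] at h3
    exact h3

end Sheaf

/-! ### Extensions over an affine scheme and twisted polynomials -/

section TwAct

variable {S : Scheme.{u}} {E : CommGrp (Over S)} {B : CommRingCat.{u}} {j : Spec B ⟶ S}

/-- The action on `E` which is given by the twisted polynomial `b` in the coordinate `χ`. -/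
noncomputable def Coordinate.twAct (χ : Coordinate E j) (q : ℕ) (b : ℕ →₀ B) :
    Over.mk j ⊗ E.X ⟶ E.X :=
  (χ.equiv (fst (Over.mk j) E.X)).symm
    (twEval q (scalarHom (fst (Over.mk j) E.X)) b
      (χ.equiv (fst (Over.mk j) E.X) (snd (Over.mk j) E.X)))

lemma Coordinate.act_twAct (χ : Coordinate E j) (q : ℕ) (b : ℕ →₀ B) {T : Over S}
    (t : T ⟶ Over.mk j) (y : T ⟶ E.X) :
    act (χ.twAct q b) t y = (χ.equiv t).symm (twEval q (scalarHom t) b (χ.equiv t y)) := by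
  rw [act, twAct, ← χ.symm_naturality, map_twEval, ← χ.naturality, ← scalarHom_comp, lift_fst,
    lift_snd]

lemma Coordinate.equiv_act_twAct (χ : Coordinate E j) (q : ℕ) (b : ℕ →₀ B) {T : Over S}
    (t : T ⟶ Over.mk j) (y : T ⟶ E.X) :
    χ.equiv t (act (χ.twAct q b) t y) = twEval q (scalarHom t) b (χ.equiv t y) := by
  rw [χ.act_twAct, Equiv.apply_symm_apply]

end TwAct

namespace StandardForm

variable {k : Type u} [Field k] {A A' : CommRingCat.{u}} {ρ : A ⟶ A'} {d' : A' → ℤ}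
  {S : Scheme.{u}} {M : ModuleScheme A S} {c : S ⟶ Spec A} {κ : k →+* A} {a₀ : A}
  {B B' : CommRingCat.{u}} {j₀ : Spec B ⟶ S} {j : Spec B' ⟶ S}

lemma represents_restrict (F : StandardForm M c κ a₀ j₀) (g : Spec B' ⟶ Spec B)
    (hg : g ≫ j₀ = j) (a : A) :
    (F.χ.restrict g hg).Represents (M.operation j a)
      (twPoly (Nat.card k) ((F.Φ a).mapRange (Spec.preimage g).hom (map_zero _))) :=
  (F.represents a).restrict g hg

/-- The coefficients of a twisted extension give an extension of the action. -/
theorem isExtension_twAct [Finite k] (F : StandardForm M c κ a₀ j₀) (g : Spec B' ⟶ Spec B)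
    (hg : g ≫ j₀ = j) {v : B} (hv : IsUnit v) {δ : A' → ℕ → B'}
    (hδ : TwistedExtension (Nat.card k) ρ.hom F.Φ d' F.N v (Spec.preimage g).hom δ)
    (c' : Spec B' ⟶ Spec A') (hc' : ∀ a, (Spec.preimage c').hom a = δ a 0) :
    IsExtension ρ (Nat.card k) d' M (Over.mk j) c'
      (fun a => (F.χ.restrict g hg).twAct (Nat.card k) (hδ.coeffs a)) := by
  have hq : 1 < Nat.card k := Finite.one_lt_card
  let f : k →+* B' := ((Spec.preimage g).hom.comp (Spec.preimage (j₀ ≫ c)).hom).comp κ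
  refine ⟨fun a T x y z => ?_, fun x y => ?_, fun a b T x y => ?_, fun a b T x y => ?_,
    fun a T x y => ?_, fun z => ?_⟩
  · apply ((F.χ.restrict g hg).equiv x).injective
    rw [Coordinate.map_mul, Coordinate.equiv_act_twAct, Coordinate.equiv_act_twAct,
      Coordinate.equiv_act_twAct, Coordinate.map_mul, twEval_add ((scalarHom x).comp f)]
  · apply ((F.χ.restrict g hg).equiv x).injective
    rw [Coordinate.equiv_act_twAct, hδ.coeffs_one, twEval_single, map_one, one_mul, pow_zero,
      pow_one]
  · apply ((F.χ.restrict g hg).equiv x).injective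
    rw [Coordinate.equiv_act_twAct, Coordinate.equiv_act_twAct, Coordinate.equiv_act_twAct,
      hδ.coeffs_mul (by omega), twEval_twMul ((scalarHom x).comp f)]
  · apply ((F.χ.restrict g hg).equiv x).injective
    rw [Coordinate.map_mul, Coordinate.equiv_act_twAct, Coordinate.equiv_act_twAct,
      Coordinate.equiv_act_twAct, hδ.coeffs_add, twEval_add_left]
  · apply ((F.χ.restrict g hg).equiv x).injective
    rw [Coordinate.equiv_act_twAct, hδ.coeffs_restrict]
    exact (Coordinate.represents_twPoly_iff.1 (F.represents_restrict g hg a) T x y).symm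
  · refine ⟨B', 𝟙 _, inferInstance, ⟨z, rfl⟩, (F.χ.restrict g hg).restrict (𝟙 _) rfl,
      fun a ha => ⟨hδ.coeffs a, ?_, ?_, fun i hi => ?_, fun i hi => ?_⟩⟩
    · rw [Coordinate.represents_twPoly_iff]
      intro T t y
      have hs : scalarHom t = scalarHom (t ≫ (Over.homMk (𝟙 _) rfl :
          Over.mk (𝟙 (Spec B') ≫ j) ⟶ Over.mk j)) := by
        refine Eq.trans ?_ (Coordinate.scalarHom_restrict (𝟙 (Spec B')) rfl t).symm
        have : Spec.preimage (𝟙 (Spec B')) = 𝟙 B' := Spec.map_injective (by simp)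
        rw [this]; rfl
      rw [hs]
      exact Coordinate.equiv_act_twAct _ _ _ _ _
    · rw [Category.id_comp, hc']; rfl
    · exact hδ.isUnit_leading hq F.pos hv a i ha hi
    · rw [hδ.coeffs_apply, hδ.degree_le a i ha hi]; exact IsNilpotent.zero

/-- In a standard coordinate, an extension of the action is given by a twisted extension. -/
theorem exists_twistedExtension [Finite k] (F : StandardForm M c κ a₀ j₀) (g : Spec B' ⟶ Spec B)
    (hg : g ≫ j₀ = j) {Z : Over S} {c' : Z.left ⟶ Spec A'} {e : A' → (Z ⊗ M.E.X ⟶ M.E.X)}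
    (h : IsExtension ρ (Nat.card k) d' M Z c' e) (x : Over.mk j ⟶ Z) {ch : A' →+* B'}
    {χ' : Coordinate M.E j}
    (hχ' : χ'.HasDegree (Nat.card k) d' ch (fun a => actOperation (e a) x)) :
    ∃ δ : A' → ℕ →₀ B',
      (∀ a, (F.χ.restrict g hg).Represents (actOperation (e a) x) (twPoly (Nat.card k) (δ a))) ∧
      TwistedExtension (Nat.card k) ρ.hom F.Φ d' F.N (F.Φ a₀ F.N) (Spec.preimage g).hom
        (fun a i => δ a i) ∧ ∀ a, δ a 0 = ch a := by
  have hq : 1 < Nat.card k := Finite.one_lt_card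
  let f₀ : k →+* B := (Spec.preimage (j₀ ≫ c)).hom.comp κ
  let f : k →+* B' := (Spec.preimage g).hom.comp f₀
  set χ := F.χ.restrict g hg with hχ
  let Ψ : A → ℕ →₀ B' := fun a => (F.Φ a).mapRange (Spec.preimage g).hom (map_zero _)
  have hρ : ∀ a, χ.Represents (actOperation (e (ρ.hom a)) x) (twPoly (Nat.card k) (Ψ a)) :=
    fun a T t y => by
      refine Eq.trans ?_ (F.represents_restrict g hg a T t y)
      exact congrArg (χ.equiv t) (h.restrict_act a _ _)
  have hmul : ∀ (a b : A') (T : Over S) (t : T ⟶ Over.mk j) (y : T ⟶ M.E.X),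
      (actOperation (e (a * b)) x).app t y =
        (actOperation (e a) x).app t ((actOperation (e b) x).app t y) :=
    fun a b T t y => h.mul_act a b _ _
  have hscalar : ∀ t : k, twPoly (Nat.card k) (Ψ (κ t)) = Polynomial.C (f t) * Polynomial.X :=
    fun t => by
      simp only [Ψ]
      rw [F.scalar t, Finsupp.mapRange_single, twPoly, Finsupp.sum_single_index (by simp),
        pow_zero, pow_one]
      rfl
  -- The action of `a` is additive, and commutes with the scalars from `k` since `A'` is commutative;
  -- so it is given by a polynomial in the Frobenius.
  have hex : ∀ a, ∃ δ : ℕ →₀ B',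
      χ.Represents (actOperation (e a) x) (twPoly (Nat.card k) δ) := fun a => by
    obtain ⟨Q, hQ⟩ := χ.exists_represents (actOperation (e a) x)
    obtain ⟨b, rfl⟩ := exists_eq_twPoly f Q (hQ.additive fun T t y z => h.act_mul a _ _ _)
      fun t => by
        have h1 := hQ.mul (hρ (κ t)) (hmul _ _)
        have h2 := (hρ (κ t)).mul hQ (hmul _ _)
        rw [mul_comm] at h2
        have := h1.unique h2
        rwa [hscalar, Polynomial.mul_comp, Polynomial.C_comp, Polynomial.X_comp] at this
    exact ⟨b, hQ⟩
  choose δ hδ using hex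
  have hδm : ∀ a b, δ (a * b) = twMul (Nat.card k) (δ a) (δ b) := fun a b =>
    (hδ (a * b)).twUnique hq ((hδ a).twMul f (hδ b) (hmul a b))
  have hδρ : ∀ a, δ (ρ.hom a) = Ψ a := fun a => (hδ _).twUnique hq (hρ a)
  have hδa : ∀ a b, δ (a + b) = δ a + δ b := fun a b =>
    (hδ (a + b)).twUnique hq ((hδ a).twAdd (hδ b) fun T t y => h.add_act a b _ _)
  have hcomm : ∀ a, twMul (Nat.card k) (δ a) (Ψ a₀) = twMul (Nat.card k) (Ψ a₀) (δ a) :=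
    fun a => by rw [← hδρ, ← hδm, ← hδm, mul_comm]
  have hu : IsUnit (Ψ a₀ F.N) := by
    simp only [Ψ]; rw [Finsupp.mapRange_apply]; exact F.unit.map _
  have hb : ∀ i, F.N < i → Ψ a₀ i = 0 := fun i hi => by
    simp only [Ψ]; rw [Finsupp.mapRange_apply, F.bound i hi, map_zero]
  -- In `χ'`, hence also in `χ`, the coefficients beyond `d' a` are nilpotent; they vanish in `χ`
  -- because `δ a` commutes with the action of `a₀`, which has exact degree there.
  have hdeg : ∀ (a : A') (i : ℕ), a ≠ 0 → d' a < i → δ a i = 0 := fun a i ha hi => by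
    obtain ⟨δ', h1, -, -, h4⟩ := hχ' a ha
    refine coeff_eq_zero_of_commute hq F.pos hu hb (hcomm a) (D := d' a) (fun i hi => ?_) i hi
    exact ((h1.twCompare hq (hδ a)).2 i).1.2 (h4 i hi)
  refine ⟨δ, hδ, ⟨fun i => ?_, fun a b i => by rw [hδa]; rfl, fun a b n => ?_, fun a i => ?_, hdeg,
    fun a i ha hi => ?_⟩, fun a => ?_⟩
  · rw [(hδ 1).twUnique hq (Coordinate.Represents.twId fun T t y => h.one_act _ _),
      Finsupp.single_apply]
    simp only [eq_comm]
  · rw [hδm, twMul_apply _ (by omega)]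
  · rw [hδρ]; simp only [Ψ]; rw [Finsupp.mapRange_apply]
  · obtain ⟨δ', h1, -, h3, -⟩ := hχ' a ha
    have := unit_coeff_of_commute hq hu hb (hcomm a) (i := i)
      (fun n hn => hdeg a n ha (by omega)) (((h1.twCompare hq (hδ a)).2 i).2.2 (h3 i hi))
    simp only [Ψ] at this
    rwa [Finsupp.mapRange_apply] at this
  · by_cases ha : a = 0
    · rw [ha, (hδ 0).twUnique hq (Coordinate.Represents.twZero fun T t y => h.zero_act _ _)]
      exact (map_zero ch).symm
    · obtain ⟨δ', h1, h2, -, -⟩ := hχ' a ha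
      rw [(h1.twCompare hq (hδ a)).1, h2]

end StandardForm

/-! ### Local representability -/

lemma exists_affine_isOpenCovering {P : Scheme.{u}} (X : Over P) :
    ∃ (B : X.left → CommRingCat.{u}) (j : ∀ z, Spec (B z) ⟶ X.left),
      IsOpenCovering (fun z => (Over.homMk (j z) : Over.mk (j z ≫ X.hom) ⟶ X)) := by
  have : ∀ z : X.left, ∃ (B : CommRingCat.{u}) (j : Spec B ⟶ X.left),
      IsOpenImmersion j ∧ z ∈ Set.range j := fun z => by
    obtain ⟨U, hU, hz, -⟩ := exists_isAffineOpen_mem_and_subset (U := ⊤) (x := z) trivial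
    exact ⟨Γ(X.left, U), hU.fromSpec, inferInstance, by rwa [hU.range_fromSpec]⟩
  choose B j hj hz using this
  exact ⟨B, j, hj, fun z => ⟨z, hz z⟩⟩

/-- The morphism of affine schemes underlying a morphism over `P`. -/
noncomputable def specHom {P : Scheme.{u}} {B B' : CommRingCat.{u}} {j : Spec B ⟶ P}
    {j' : Spec B' ⟶ P} (h : Over.mk j ⟶ Over.mk j') : Spec B ⟶ Spec B' := h.left

lemma specHom_comp {P : Scheme.{u}} {B B' : CommRingCat.{u}} {j : Spec B ⟶ P}
    {j' : Spec B' ⟶ P} (h : Over.mk j ⟶ Over.mk j') : specHom h ≫ j' = j := Over.w h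

namespace StandardForm

variable {k : Type u} [Field k] {A A' : CommRingCat.{u}} {ρ : A ⟶ A'} (d' : A' → ℤ)
  {S : Scheme.{u}} {M : ModuleScheme A S} {c : S ⟶ Spec A} {κ : k →+* A} {a₀ : A}
  {B B' : CommRingCat.{u}} {j₀ : Spec B ⟶ S} (F : StandardForm M c κ a₀ j₀)
  {P : Scheme.{u}} {cP : P ⟶ Spec A'} {p : P ⟶ S} (hP : IsPullback cP p (Spec.map ρ) c)

variable (ρ) in
/-- The ring of twisted extensions attached to a standard coordinate. -/
noncomputable abbrev extensionRing : CommRingCat.{u} :=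
  CommRingCat.of (twistedExtensionRing (Nat.card k) ρ.hom F.Φ d' F.N (F.Φ a₀ F.N))

variable (ρ) in
/-- The structure morphism of the ring of twisted extensions. -/
noncomputable def extensionBase : B ⟶ F.extensionRing ρ d' :=
  CommRingCat.ofHom (universalBase (Nat.card k) ρ.hom F.Φ d' F.N (F.Φ a₀ F.N))

variable (ρ) in
/-- The characteristic of the universal extension. -/
noncomputable def extensionCharacteristic : A' ⟶ F.extensionRing ρ d' :=
  CommRingCat.ofHom (universal_twistedExtension (q := Nat.card k) (ρ := ρ.hom) (Φ := F.Φ)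
    (d' := d') (N := F.N) (v := F.Φ a₀ F.N)).constantCoeff

lemma extension_condition : Spec.map (F.extensionCharacteristic ρ d') ≫ Spec.map ρ =
    (Spec.map (F.extensionBase ρ d') ≫ j₀) ≫ c := by
  rw [Category.assoc, ← Spec.map_preimage (j₀ ≫ c), ← Spec.map_comp, ← Spec.map_comp]
  congr 1
  ext a
  refine (universal_twistedExtension.restrict a 0).trans ?_
  rw [F.constant a]
  rfl

/-- The spectrum of the ring of twisted extensions, as a scheme over `P`. -/
noncomputable def extensionMap : Spec (F.extensionRing ρ d') ⟶ P :=
  hP.lift (Spec.map (F.extensionCharacteristic ρ d'))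
    (Spec.map (F.extensionBase ρ d') ≫ j₀) (F.extension_condition d')

lemma extensionMap_fst : F.extensionMap d' hP ≫ cP =
    Spec.map (F.extensionCharacteristic ρ d') := hP.lift_fst _ _ _

lemma extensionMap_snd : F.extensionMap d' hP ≫ p =
    Spec.map (F.extensionBase ρ d') ≫ j₀ := hP.lift_snd _ _ _

/-- The scheme over `P` which represents the functor of extensions over the domain of a standard
coordinate. -/
noncomputable abbrev extensionScheme : Over P := Over.mk (F.extensionMap d' hP)

lemma universal_twistedExtension_preimage : TwistedExtension (Nat.card k) ρ.hom F.Φ d' F.N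
    (F.Φ a₀ F.N) (Spec.preimage (Spec.map (F.extensionBase ρ d'))).hom
    (universalCoeff (Nat.card k) ρ.hom F.Φ d' F.N (F.Φ a₀ F.N)) := by
  rw [Spec.preimage_map]
  exact universal_twistedExtension

/-- The universal extension. -/
noncomputable def universalExtension [Finite k] :
    (extensionFunctor ρ (Nat.card k) d' M cP p).obj (op (F.extensionScheme d' hP)) :=
  ⟨fun a => (F.χ.restrict (Spec.map (F.extensionBase ρ d'))
      (F.extensionMap_snd d' hP).symm).twAct (Nat.card k)
      ((F.universal_twistedExtension_preimage d').coeffs a),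
    F.isExtension_twAct (Spec.map (F.extensionBase ρ d')) (F.extensionMap_snd d' hP).symm
      F.unit (F.universal_twistedExtension_preimage d') (F.extensionMap d' hP ≫ cP)
      (fun a => by rw [F.extensionMap_fst d' hP, Spec.preimage_map]; rfl)⟩

variable {d'}

/-- The twisted polynomials which give the pullback of the universal extension. -/
lemma represents_universalExtension [Finite k] {j : Spec B' ⟶ P}
    (h : Over.mk j ⟶ F.extensionScheme d' hP)
    (g : Spec B' ⟶ Spec B) (hg : g ≫ j₀ = j ≫ p)
    (hh : specHom h ≫ Spec.map (F.extensionBase ρ d') = g) (a : A') :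
    (F.χ.restrict g hg).Represents
      (actOperation (((extensionFunctor ρ (Nat.card k) d' M cP p).map h.op
        (F.universalExtension d' hP)).1 a) (𝟙 ((Over.map p).obj (Over.mk j))))
      (twPoly (Nat.card k) (((F.universal_twistedExtension_preimage d').coeffs a).mapRange
        (Spec.preimage (specHom h)).hom (map_zero _))) := by
  rw [Coordinate.represents_twPoly_iff]
  intro T t y
  rw [twEval_map]
  have h1 : (actOperation (((extensionFunctor ρ (Nat.card k) d' M cP p).map h.op
        (F.universalExtension d' hP)).1 a) (𝟙 ((Over.map p).obj (Over.mk j)))).app t y =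
      act ((F.universalExtension d' hP).1 a) (t ≫ (Over.map p).map h) y :=
    (act_extensionFunctor_map h (F.universalExtension d' hP) a _ y).trans
      (congrArg (fun x => act ((F.universalExtension d' hP).1 a) (x ≫ (Over.map p).map h) y)
        (Category.comp_id t))
  rw [h1]
  have h2 : (t ≫ (Over.homMk g hg : Over.mk (j ≫ p) ⟶ Over.mk j₀)) =
      ((t ≫ (Over.map p).map h : T ⟶ Over.mk (F.extensionMap d' hP ≫ p)) ≫
        (Over.homMk (Spec.map (F.extensionBase ρ d'))
          (F.extensionMap_snd d' hP).symm : _ ⟶ Over.mk j₀)) := by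
    apply Over.OverMorphism.ext
    exact (congrArg (t.left ≫ ·) hh.symm).trans (Category.assoc _ _ _).symm
  have h3 := Coordinate.equiv_act_twAct (F.χ.restrict (Spec.map (F.extensionBase ρ d'))
      (F.extensionMap_snd d' hP).symm) (Nat.card k)
      ((F.universal_twistedExtension_preimage d').coeffs a) (t ≫ (Over.map p).map h) y
  have h4 : scalarHom (t ≫ (Over.map p).map h : T ⟶ Over.mk (F.extensionMap d' hP ≫ p)) =
      (scalarHom t).comp (Spec.preimage (specHom h)).hom := toGamma_preimage (T := T.left) t.left h.left
  rw [← h4, Coordinate.restrict_equiv, Coordinate.restrict_equiv, h2]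
  exact h3

variable {F hP}

/-- The pullback of the universal extension determines all the coefficients, hence the morphism. -/
lemma extensionScheme_hom_ext_spec [Finite k] [Mono j₀] {j : Spec B' ⟶ P}
    {h h' : Over.mk j ⟶ F.extensionScheme d' hP}
    (e : (extensionFunctor ρ (Nat.card k) d' M cP p).map h.op (F.universalExtension d' hP) =
      (extensionFunctor ρ (Nat.card k) d' M cP p).map h'.op (F.universalExtension d' hP)) :
    h = h' := by
  have hw : ∀ h : Over.mk j ⟶ F.extensionScheme d' hP,
      (specHom h ≫ Spec.map (F.extensionBase ρ d')) ≫ j₀ = j ≫ p := fun h => by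
    rw [Category.assoc, ← F.extensionMap_snd d' hP, ← Category.assoc, specHom_comp]
  have hg : specHom h' ≫ Spec.map (F.extensionBase ρ d') =
      specHom h ≫ Spec.map (F.extensionBase ρ d') := by
    rw [← cancel_mono j₀, hw, hw]
  have h1 := F.represents_universalExtension hP h _ (hw h) rfl
  have h2 := F.represents_universalExtension hP h' _ (hw h) hg
  rw [← e] at h2
  have h3 : ∀ a i, (Spec.preimage (specHom h)).hom (universalCoeff _ _ _ _ _ _ a i) =
      (Spec.preimage (specHom h')).hom (universalCoeff _ _ _ _ _ _ a i) := fun a i =>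
    DFunLike.congr_fun ((h1 a).twUnique Finite.one_lt_card (h2 a)) i
  have h4 : F.extensionBase ρ d' ≫ Spec.preimage (specHom h) =
      F.extensionBase ρ d' ≫ Spec.preimage (specHom h') := by
    apply Spec.map_injective
    rw [Spec.map_comp, Spec.map_comp, Spec.map_preimage, Spec.map_preimage, hg]
  have h5 : specHom h = specHom h' := by
    rw [← Spec.map_preimage (specHom h), ← Spec.map_preimage (specHom h')]
    congr 1
    exact CommRingCat.hom_ext (twistedExtensionRing_hom_ext (congrArg CommRingCat.Hom.hom h4) h3)
  exact Over.OverMorphism.ext h5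

lemma extensionScheme_hom_ext [Finite k] [Mono j₀] {X : Over P}
    {h h' : X ⟶ F.extensionScheme d' hP}
    (e : (extensionFunctor ρ (Nat.card k) d' M cP p).map h.op (F.universalExtension d' hP) =
      (extensionFunctor ρ (Nat.card k) d' M cP p).map h'.op (F.universalExtension d' hP)) :
    h = h' := by
  obtain ⟨B, j, hj⟩ := exists_affine_isOpenCovering X
  refine hj.hom_ext fun z => extensionScheme_hom_ext_spec ?_
  rw [op_comp, op_comp, Functor.map_comp_apply, Functor.map_comp_apply, e]

variable (F hP)

/-- Extensions over the domain of a standard coordinate are pullbacks of the universal one,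
locally. -/
lemma exists_hom_spec [Finite k] {X : Over P} (t : X.left ⟶ Spec B) (ht : t ≫ j₀ = X.hom ≫ p)
    (e : (extensionFunctor ρ (Nat.card k) d' M cP p).obj (op X)) (j : Spec B' ⟶ X.left)
    {χ' : Coordinate M.E (j ≫ ((Over.map p).obj X).hom)}
    (hχ' : χ'.HasDegree (Nat.card k) d' (Spec.preimage (j ≫ X.hom ≫ cP)).hom
      (fun a => actOperation (e.1 a) (Over.homMk j :
        Over.mk (j ≫ ((Over.map p).obj X).hom) ⟶ (Over.map p).obj X))) :
    ∃ h : Over.mk (j ≫ X.hom) ⟶ F.extensionScheme d' hP,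
      (extensionFunctor ρ (Nat.card k) d' M cP p).map h.op (F.universalExtension d' hP) =
        (extensionFunctor ρ (Nat.card k) d' M cP p).map
          (Over.homMk j : Over.mk (j ≫ X.hom) ⟶ X).op e := by
  have hg : (j ≫ t) ≫ j₀ = j ≫ X.hom ≫ p := by rw [Category.assoc, ht]
  obtain ⟨δ, h1, h2, h3⟩ := F.exists_twistedExtension (j ≫ t) hg e.2 (Over.homMk j) hχ'
  let l : F.extensionRing ρ d' ⟶ B' := CommRingCat.ofHom h2.lift
  have hb : Spec.map l ≫ Spec.map (F.extensionBase ρ d') = j ≫ t := by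
    refine Eq.trans ?_ (Spec.map_preimage (j ≫ t))
    rw [← Spec.map_comp]
    congr 1
    exact CommRingCat.hom_ext h2.lift_base
  have hc : Spec.map l ≫ Spec.map (F.extensionCharacteristic ρ d') = j ≫ X.hom ≫ cP := by
    refine Eq.trans ?_ (Spec.map_preimage (j ≫ X.hom ≫ cP))
    rw [← Spec.map_comp]
    congr 1
    refine CommRingCat.hom_ext (RingHom.ext fun a => ?_)
    exact (h2.lift_coeff a 0).trans (h3 a)
  have hw : Spec.map l ≫ F.extensionMap d' hP = j ≫ X.hom := by
    apply hP.hom_ext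
    · rw [Category.assoc, F.extensionMap_fst d' hP, hc, Category.assoc]
    · rw [Category.assoc, F.extensionMap_snd d' hP, ← Category.assoc, hb, Category.assoc,
        ht, Category.assoc]
  let h : Over.mk (j ≫ X.hom) ⟶ F.extensionScheme d' hP :=
    Over.homMk (Spec.map l) hw
  refine ⟨h, Subtype.ext (funext fun a => act_ext fun T x y => ?_)⟩
  have h5 := F.represents_universalExtension hP h (j ≫ t)
    (hg.trans (Category.assoc _ _ _).symm) hb a
  have h6 : ((F.universal_twistedExtension_preimage d').coeffs a).mapRange
        (Spec.preimage (specHom h)).hom (map_zero _) = δ a := Finsupp.ext fun i => by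
    rw [Finsupp.mapRange_apply]
    change (Spec.preimage (Spec.map l)).hom _ = _
    rw [Spec.preimage_map]
    exact h2.lift_coeff a i
  rw [h6] at h5
  have h7 := h5.app_eq (h1 a) x y
  refine Eq.trans ?_ (h7.trans ?_)
  · exact congrArg (fun z => act _ z y) (Category.comp_id x).symm
  · exact (act_extensionFunctor_map (Over.homMk j : Over.mk (j ≫ X.hom) ⟶ X) e a x y).symm

/-- Every extension over the domain of a standard coordinate is the pullback of the universal one
along a unique morphism. -/
theorem existsUnique_hom [Finite k] [Mono j₀] {X : Over P} (t : X.left ⟶ Spec B)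
    (ht : t ≫ j₀ = X.hom ≫ p) (e : (extensionFunctor ρ (Nat.card k) d' M cP p).obj (op X)) :
    ∃! h : X ⟶ F.extensionScheme d' hP,
      (extensionFunctor ρ (Nat.card k) d' M cP p).map h.op (F.universalExtension d' hP) = e := by
  refine existsUnique_of_exists_of_unique ?_
    fun h h' e1 e2 => extensionScheme_hom_ext (e1.trans e2.symm)
  choose B' j hj hz χ' hχ' using e.2.exists_coordinate
  have hu : IsOpenCovering (fun z => (Over.homMk (j z) : Over.mk (j z ≫ X.hom) ⟶ X)) :=
    ⟨hj, fun z => ⟨z, hz z⟩⟩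
  choose h hh using fun z => F.exists_hom_spec hP t ht e (j z) (hχ' z)
  obtain ⟨g, hg⟩ := hu.exists_glue h fun z z' T a b hab => extensionScheme_hom_ext (by
    rw [op_comp, op_comp, Functor.map_comp_apply, Functor.map_comp_apply, hh, hh,
      ← Functor.map_comp_apply, ← Functor.map_comp_apply, ← op_comp, ← op_comp, hab])
  refine ⟨g, extensionFunctor_separated hu fun z => ?_⟩
  rw [← Functor.map_comp_apply, ← op_comp, hg, hh]

end StandardForm

/-! ### Gluing local representations -/

section Gluing

variable {P S : Scheme.{u}}

/-- The functor `G` on schemes over `P` is a sheaf for coverings by open subschemes. -/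
structure IsZariskiSheaf (G : (Over P)ᵒᵖ ⥤ Type u) : Prop where
  separated : ∀ {J : Type (u + 1)} {X : Over P} {V : J → Over P} {u : ∀ i, V i ⟶ X},
    IsOpenCovering u → ∀ {e e' : G.obj (op X)},
      (∀ i, G.map (u i).op e = G.map (u i).op e') → e = e'
  exists_glue : ∀ {J : Type (u + 1)} {X : Over P} {V : J → Over P} {u : ∀ i, V i ⟶ X},
    IsOpenCovering u → ∀ e : ∀ i, G.obj (op (V i)),
      (∀ i j (T : Over P) (a : T ⟶ V i) (b : T ⟶ V j), a ≫ u i = b ≫ u j →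
        G.map a.op (e i) = G.map b.op (e j)) →
      ∃ e' : G.obj (op X), ∀ i, G.map (u i).op e' = e i

/-- The object `T` and `ξ ∈ G(T)` represent the restriction of `G` to those schemes over `P` whose
morphism to `S` factors through `j : W ⟶ S`. -/
structure IsLocalRepresentation (G : (Over P)ᵒᵖ ⥤ Type u) (p : P ⟶ S) {W : Scheme.{u}} (j : W ⟶ S)
    (T : Over P) (t : T.left ⟶ W) (ξ : G.obj (op T)) : Prop where
  w : t ≫ j = T.hom ≫ p
  existsUnique : ∀ {X : Over P} (b : X.left ⟶ W), b ≫ j = X.hom ≫ p →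
    ∀ x : G.obj (op X), ∃! h : X ⟶ T, G.map h.op ξ = x

variable (G : (Over P)ᵒᵖ ⥤ Type u)

lemma sigma_mk_eq_iff {X : Scheme.{u}} {g g' : X ⟶ P} {x : G.obj (op (Over.mk g))}
    {x' : G.obj (op (Over.mk g'))} (h : 𝟙 X ≫ g = g') :
    (⟨g, x⟩ : Σ g : X ⟶ P, G.obj (op (Over.mk g))) = ⟨g', x'⟩ ↔
      G.map (Over.homMk (𝟙 X) h : Over.mk g' ⟶ Over.mk g).op x = x' := by
  rw [Category.id_comp] at h
  subst h
  have h1 : (Over.homMk (𝟙 X) (Category.id_comp g) : Over.mk g ⟶ Over.mk g) = 𝟙 _ :=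
    Over.OverMorphism.ext rfl
  rw [h1, op_id, Functor.map_id_apply]
  simp

/-- The functor of pairs `(g, x)` of a morphism `g : X ⟶ P` and an element `x` of `G(g)`. -/
def totalFunctor : Scheme.{u}ᵒᵖ ⥤ Type u where
  obj X := Σ g : X.unop ⟶ P, G.obj (op (Over.mk g))
  map v := TypeCat.ofHom fun x =>
    ⟨v.unop ≫ x.1, G.map (Over.homMk v.unop : Over.mk (v.unop ≫ x.1) ⟶ Over.mk x.1).op x.2⟩
  map_id X := by
    refine ConcreteCategory.hom_ext _ _ fun x => ?_
    refine ((sigma_mk_eq_iff G (by simp)).2 ?_).symm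
    rfl
  map_comp {X Y Z} v w := by
    refine ConcreteCategory.hom_ext _ _ fun x => ?_
    have h : 𝟙 Z.unop ≫ w.unop ≫ v.unop ≫ x.1 = (w.unop ≫ v.unop) ≫ x.1 := by simp
    refine ((sigma_mk_eq_iff G h).2 ?_).symm
    change G.map _ (G.map (Over.homMk w.unop :
      Over.mk (w.unop ≫ v.unop ≫ x.1) ⟶ Over.mk (v.unop ≫ x.1)).op
        (G.map (Over.homMk v.unop : Over.mk (v.unop ≫ x.1) ⟶ Over.mk x.1).op x.2)) = _
    rw [← Functor.map_comp_apply, ← Functor.map_comp_apply, ← op_comp, ← op_comp]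
    congr 3

variable {G}

lemma totalFunctor_map {X : Over P} {Y : Over P} (v : Y ⟶ X) (x : G.obj (op X)) :
    (totalFunctor G).map v.left.op (⟨X.hom, x⟩ : Σ g : X.left ⟶ P, G.obj (op (Over.mk g))) =
      (⟨Y.hom, G.map v.op x⟩ : Σ g : Y.left ⟶ P, G.obj (op (Over.mk g))) := by
  have h : 𝟙 Y.left ≫ v.left ≫ X.hom = Y.hom := by rw [Category.id_comp, Over.w]
  refine (sigma_mk_eq_iff G h).2 ?_
  rw [← Functor.map_comp_apply, ← op_comp]
  exact congrArg (fun v => G.map (Quiver.Hom.op v) x) (Over.OverMorphism.ext (Category.id_comp _))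

lemma totalFunctor_mk_injective {X : Over P} {x x' : G.obj (op X)}
    (h : (⟨X.hom, x⟩ : Σ g : X.left ⟶ P, G.obj (op (Over.mk g))) = ⟨X.hom, x'⟩) : x = x' :=
  eq_of_heq (Sigma.mk.inj h).2

lemma exists_eq_of_fst_eq {X : Scheme.{u}} (t : Σ g : X ⟶ P, G.obj (op (Over.mk g))) {g : X ⟶ P}
    (h : t.1 = g) : ∃ e : G.obj (op (Over.mk g)), ⟨g, e⟩ = t := by
  subst h
  exact ⟨t.2, rfl⟩

/-- The total functor is a sheaf because morphisms to `P` glue and `G` is a sheaf on schemes over `P`. -/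
lemma totalFunctor_isSheaf (hG : IsZariskiSheaf G) :
    Presieve.IsSheaf Scheme.zariskiTopology (totalFunctor G) := by
  rw [Precoverage.isSheaf_toGrothendieck_iff_of_isStableUnderBaseChange]
  rintro X R hR x hx
  obtain ⟨(𝒰 : X.OpenCover), rfl⟩ := Scheme.exists_cover_of_mem_pretopology hR
  let y : ∀ i : 𝒰.I₀, Σ g : 𝒰.X i ⟶ P, G.obj (op (Over.mk g)) := fun i => x (𝒰.f i) (.mk i)
  have hy : ∀ i j {Z : Scheme.{u}} (a : Z ⟶ 𝒰.X i) (b : Z ⟶ 𝒰.X j), a ≫ 𝒰.f i = b ≫ 𝒰.f j →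
      (totalFunctor G).map a.op (y i) = (totalFunctor G).map b.op (y j) :=
    fun i j Z a b hab => hx a b (.mk i) (.mk j) hab
  have hy' : ∀ i j, pullback.fst (𝒰.f i) (𝒰.f j) ≫ (y i).1 = pullback.snd _ _ ≫ (y j).1 :=
    fun i j => congrArg Sigma.fst (hy i j _ _ pullback.condition)
  let g : X ⟶ P := 𝒰.glueMorphisms (fun i => (y i).1) hy'
  have hg : ∀ i, (y i).1 = 𝒰.f i ≫ g := fun i => (𝒰.ι_glueMorphisms _ hy' i).symm
  choose e he using fun i => exists_eq_of_fst_eq (y i) (hg i)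
  let u : ∀ i, Over.mk (𝒰.f i ≫ g) ⟶ Over.mk g := fun i => Over.homMk (𝒰.f i)
  have hu : IsOpenCovering u := ⟨fun i => inferInstanceAs (IsOpenImmersion (𝒰.f i)),
    fun z => 𝒰.exists_eq z⟩
  obtain ⟨e', he'⟩ := hG.exists_glue hu e fun i j T a b hab => by
    have h1 := hy i j a.left b.left (congrArg CommaMorphism.left hab)
    rw [← he i, ← he j] at h1
    exact totalFunctor_mk_injective
      ((totalFunctor_map a (e i)).symm.trans (h1.trans (totalFunctor_map b (e j))))
  have key : ∀ i, (totalFunctor G).map (𝒰.f i).op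
      (⟨g, e'⟩ : Σ g : X ⟶ P, G.obj (op (Over.mk g))) = y i := fun i =>
    (totalFunctor_map (u i) e').trans (by rw [he' i]; exact he i)
  refine ⟨⟨g, e'⟩, ?_, ?_⟩
  · rintro Z f ⟨i⟩
    exact key i
  · rintro ⟨g', e''⟩ h
    have h1 : ∀ i, (totalFunctor G).map (𝒰.f i).op
        (⟨g', e''⟩ : Σ g : X ⟶ P, G.obj (op (Over.mk g))) = y i := fun i => h (𝒰.f i) (.mk i)
    have h2 : g' = g := 𝒰.hom_ext _ _ fun i => (congrArg Sigma.fst (h1 i)).trans (hg i)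
    subst h2
    refine congrArg (Sigma.mk g) (hG.separated hu fun i => ?_)
    exact totalFunctor_mk_injective ((totalFunctor_map (u i) e'').symm.trans
      ((h1 i).trans ((key i).symm.trans (totalFunctor_map (u i) e'))))

variable {p : P ⟶ S} {J : Type u} {W : J → Scheme.{u}} {j : ∀ s, W s ⟶ S}
  {T : J → Over P} {t : ∀ s, (T s).left ⟶ W s} {ξ : ∀ s, G.obj (op (T s))}

/-- The morphism to the total functor given by a local representation. -/
def totalFunctorHom (T : Over P) (ξ : G.obj (op T)) : yoneda.obj T.left ⟶ totalFunctor G :=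
  yonedaEquiv.symm (⟨T.hom, ξ⟩ : Σ g : T.left ⟶ P, G.obj (op (Over.mk g)))

lemma totalFunctorHom_app (T : Over P) (ξ : G.obj (op T)) {X : Over P} (v : X ⟶ T) :
    (totalFunctorHom T ξ).app (op X.left) v.left =
      (⟨X.hom, G.map v.op ξ⟩ : Σ g : X.left ⟶ P, G.obj (op (Over.mk g))) :=
  totalFunctor_map v ξ

/-- A local representation over `j : W ⟶ S` is an open subfunctor of the total functor: its pullback
along an element over `X` is represented by the open subscheme `X ×_S W` of `X`. -/
lemma IsLocalRepresentation.presheaf_isOpenImmersion {W : Scheme.{u}} {j : W ⟶ S}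
    [IsOpenImmersion j] {T : Over P} {t : T.left ⟶ W} {ξ : G.obj (op T)}
    (h : IsLocalRepresentation G p j T t ξ) :
    MorphismProperty.presheaf @IsOpenImmersion (totalFunctorHom T ξ) := by
  refine MorphismProperty.relative.of_exists fun X f => ?_
  obtain ⟨⟨g, x⟩, rfl⟩ := yonedaEquiv.symm.surjective f
  let b := pullback (g ≫ p) j
  let v : Over.mk (pullback.fst (g ≫ p) j ≫ g) ⟶ Over.mk g := Over.homMk (pullback.fst (g ≫ p) j)
  obtain ⟨w, hw, -⟩ := h.existsUnique (X := Over.mk (pullback.fst (g ≫ p) j ≫ g))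
    (pullback.snd (g ≫ p) j)
    (pullback.condition.symm.trans (Category.assoc _ _ _).symm) (G.map v.op x)
  refine ⟨b, yoneda.map w.left, pullback.fst (g ≫ p) j, ?_, inferInstance⟩
  refine IsPullback.of_forall_isPullback_app fun Y => ?_
  rw [Types.isPullback_iff]
  refine ⟨?_, ?_, ?_⟩
  · refine ConcreteCategory.hom_ext _ _ fun (a : Y.unop ⟶ b) => ?_
    let a' : Over.mk (a ≫ pullback.fst (g ≫ p) j ≫ g) ⟶
      Over.mk (pullback.fst (g ≫ p) j ≫ g) := Over.homMk a
    refine (totalFunctorHom_app T ξ (a' ≫ w)).trans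
      (Eq.trans ?_ (totalFunctorHom_app (Over.mk g) x (a' ≫ v)).symm)
    rw [op_comp, op_comp, Functor.map_comp_apply, Functor.map_comp_apply, hw]
  · rintro (a : Y.unop ⟶ b) (a' : Y.unop ⟶ b) ⟨-, h2⟩
    exact (cancel_mono (pullback.fst (g ≫ p) j)).1 h2
  · rintro (a : Y.unop ⟶ T.left) (a' : Y.unop ⟶ X) haa
    have h1 : a ≫ T.hom = a' ≫ g := congrArg Sigma.fst haa
    have h2 : a' ≫ g ≫ p = (a ≫ t) ≫ j := by
      rw [Category.assoc, h.w, ← Category.assoc, ← Category.assoc, h1]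
    let l : Y.unop ⟶ b := pullback.lift a' (a ≫ t) h2
    have hl : l ≫ pullback.fst (g ≫ p) j = a' := pullback.lift_fst _ _ _
    refine ⟨l, ?_, hl⟩
    let Y' : Over P := Over.mk (a' ≫ g)
    let a₁ : Y' ⟶ T := Over.homMk a h1
    let a₂ : Y' ⟶ Over.mk g := Over.homMk a' rfl
    let l' : Y' ⟶ Over.mk (pullback.fst (g ≫ p) j ≫ g) := Over.homMk l (by
      change l ≫ _ ≫ g = a' ≫ g
      rw [← Category.assoc, hl])
    have h3 : G.map a₁.op ξ = G.map a₂.op x := totalFunctor_mk_injective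
      ((totalFunctorHom_app T ξ a₁).symm.trans (haa.trans (totalFunctorHom_app (Over.mk g) x a₂)))
    have h4 : l' ≫ w = a₁ := by
      refine (h.existsUnique (X := Y') (a ≫ t) ?_ (G.map a₂.op x)).unique ?_ h3
      · rw [← h2]; exact (Category.assoc _ _ _).symm
      · rw [op_comp, Functor.map_comp_apply, hw, ← Functor.map_comp_apply, ← op_comp]
        exact congrArg (fun v => G.map (Quiver.Hom.op v) x) (Over.OverMorphism.ext hl)
    exact congrArg CommaMorphism.left h4

/-- A Zariski sheaf with local representations over an open covering of `S` is representable, by the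
criterion for functors covered by representable open subfunctors applied to the total functor. -/
lemma exists_representableBy (hG : IsZariskiSheaf G) (hj : ∀ s, IsOpenImmersion (j s))
    (hcov : ∀ x : S, ∃ s, x ∈ Set.range (j s))
    (h : ∀ s, IsLocalRepresentation G p (j s) (T s) (t s) (ξ s)) :
    ∃ T : Over P, Nonempty (G.RepresentableBy T) := by
  let F : Sheaf Scheme.zariskiTopology.{u} (Type u) :=
    ⟨totalFunctor G, (isSheaf_iff_isSheaf_of_type _ _).2 (totalFunctor_isSheaf hG)⟩
  let f : ∀ s, yoneda.obj (T s).left ⟶ F.1 := fun s => totalFunctorHom (T s) (ξ s)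
  have hf : ∀ s, MorphismProperty.presheaf @IsOpenImmersion (f s) := fun s =>
    (h s).presheaf_isOpenImmersion
  have : Presheaf.IsLocallySurjective Scheme.zariskiTopology (Sigma.desc f) := ⟨by
    rintro X ⟨g, x⟩
    let 𝒰 : X.OpenCover :=
      { I₀ := J
        X := fun s => pullback (g ≫ p) (j s)
        f := fun s => pullback.fst (g ≫ p) (j s)
        mem₀ := by
          rw [Scheme.presieve₀_mem_precoverage_iff]
          refine ⟨fun y => ?_, fun s => inferInstance⟩
          obtain ⟨s, v, hv⟩ := hcov ((g ≫ p) y)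
          obtain ⟨y', hy', -⟩ := Scheme.Pullback.exists_preimage_pullback y v hv.symm
          exact ⟨s, y', hy'⟩ }
    refine GrothendieckTopology.superset_covering _ ?_ 𝒰.mem_grothendieckTopology
    rintro Y v ⟨Z, a, b, ⟨s⟩, rfl⟩
    obtain ⟨w, hw, -⟩ := (h s).existsUnique (X := Over.mk (pullback.fst (g ≫ p) (j s) ≫ g))
      (pullback.snd (g ≫ p) (j s)) (pullback.condition.symm.trans (Category.assoc _ _ _).symm)
      (G.map (Over.homMk (pullback.fst (g ≫ p) (j s)) : _ ⟶ Over.mk g).op x)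
    refine Sieve.downward_closed _ ?_ a
    refine ⟨(Sigma.ι (fun s => yoneda.obj (T s).left) s).app _ w.left, ?_⟩
    have h1 : (Sigma.ι (fun s => yoneda.obj (T s).left) s) ≫ Sigma.desc f = f s :=
      Sigma.ι_desc _ _
    refine (ConcreteCategory.congr_hom (congrArg (fun α => NatTrans.app α _) h1) w.left).trans ?_
    exact (totalFunctorHom_app (T s) (ξ s) w).trans
      ((congrArg (Sigma.mk (pullback.fst (g ≫ p) (j s) ≫ g)) hw))⟩
  obtain ⟨Y, ⟨r⟩⟩ := (Scheme.LocalRepresentability.isRepresentable hf).has_representation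
  let y₀ : Σ g : Y ⟶ P, G.obj (op (Over.mk g)) := r.homEquiv (𝟙 Y)
  have hr : ∀ {X : Over P} (h : X ⟶ Over.mk y₀.1), r.homEquiv (X := X.left) h.left =
      (⟨X.hom, G.map h.op y₀.2⟩ : Σ g : X.left ⟶ P, G.obj (op (Over.mk g))) := fun {X} h => by
    refine Eq.trans ?_ (totalFunctor_map h y₀.2)
    refine Eq.trans ?_ (r.homEquiv_comp h.left (𝟙 Y))
    exact congrArg r.homEquiv (Category.comp_id h.left).symm
  -- A representation of the total functor is one of `G`, over the morphism to `P` it carries.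
  have hb : ∀ X : Over P, Function.Bijective
      (fun h : X ⟶ Over.mk y₀.1 => G.map h.op y₀.2) := fun X => by
    constructor
    · intro h h' e
      refine Over.OverMorphism.ext (r.homEquiv.injective ?_)
      exact (hr h).trans ((congrArg (Sigma.mk X.hom) e).trans (hr h').symm)
    · intro x
      let v : X.left ⟶ Y := r.homEquiv.symm
        (⟨X.hom, x⟩ : Σ g : X.left ⟶ P, G.obj (op (Over.mk g)))
      have hv : r.homEquiv v = (⟨X.hom, x⟩ : Σ g : X.left ⟶ P, G.obj (op (Over.mk g))) :=
        r.homEquiv.apply_symm_apply _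
      have hv' : r.homEquiv v = (totalFunctor G).map v.op y₀ :=
        (congrArg r.homEquiv (Category.comp_id v).symm).trans (r.homEquiv_comp v (𝟙 Y))
      let h : X ⟶ Over.mk y₀.1 := Over.homMk v (congrArg Sigma.fst (hv'.symm.trans hv))
      exact ⟨h, totalFunctor_mk_injective ((hr h).symm.trans hv)⟩
  exact ⟨Over.mk y₀.1, ⟨⟨fun {X} => Equiv.ofBijective _ (hb X), fun {X X'} f g => by
    change G.map (f ≫ g).op y₀.2 = G.map f.op (G.map g.op y₀.2)
    rw [op_comp, Functor.map_comp_apply]⟩⟩⟩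

/-- A scheme representing `G` restricts to the local representations. -/
lemma IsLocalRepresentation.isPullback {W : Scheme.{u}} {j : W ⟶ S} [Mono j] {T : Over P}
    {t : T.left ⟶ W} {ξ : G.obj (op T)} (h : IsLocalRepresentation G p j T t ξ) {Y : Over P}
    (r : G.RepresentableBy Y) :
    IsPullback (r.homEquiv.symm ξ).left t (Y.hom ≫ p) j := by
  set f := r.homEquiv.symm ξ with hf
  have hξ : G.map f.op (r.homEquiv (𝟙 Y)) = ξ := by
    rw [← r.homEquiv_comp, Category.comp_id, hf, Equiv.apply_symm_apply]
  have hw : f.left ≫ Y.hom ≫ p = t ≫ j := by rw [h.w, ← Category.assoc, Over.w]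
  refine ⟨⟨hw⟩, ⟨PullbackCone.IsLimit.mk hw (fun s => ?_) (fun s => ?_) (fun s => ?_)
    (fun s m hm hm' => ?_)⟩⟩
  all_goals
    let X : Over P := Over.mk (s.fst ≫ Y.hom)
    let a : X ⟶ Y := Over.homMk s.fst rfl
    have hX : s.snd ≫ j = X.hom ≫ p := s.condition.symm.trans (Category.assoc _ _ _).symm
    have H := h.existsUnique (X := X) s.snd hX (G.map a.op (r.homEquiv (𝟙 Y)))
  · exact H.choose.left
  · have h1 : H.choose ≫ f = a := r.homEquiv.injective (by
      rw [r.homEquiv_comp, hf, Equiv.apply_symm_apply, H.choose_spec.1, ← r.homEquiv_comp,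
        Category.comp_id])
    exact congrArg CommaMorphism.left h1
  · rw [← cancel_mono j, Category.assoc, h.w, ← Category.assoc, Over.w, hX]
  · let m' : X ⟶ T := Over.homMk m (by
      change _ = s.fst ≫ Y.hom
      rw [← hm, Category.assoc, Over.w])
    have h1 : m' ≫ f = a := Over.OverMorphism.ext hm
    have h2 : m' = H.choose := H.choose_spec.2 m' (by
      change G.map m'.op ξ = G.map a.op (r.homEquiv (𝟙 Y))
      rw [← hξ, ← Functor.map_comp_apply, ← op_comp, h1])
    exact congrArg CommaMorphism.left h2

/-- Schemes which represent `G` are finite over `S` if this is so locally. -/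
lemma isFinite_of_representableBy (hj : ∀ s, IsOpenImmersion (j s))
    (hcov : ∀ x : S, ∃ s, x ∈ Set.range (j s))
    (h : ∀ s, IsLocalRepresentation G p (j s) (T s) (t s) (ξ s)) (ht : ∀ s, IsFinite (t s))
    {Y : Over P} (r : G.RepresentableBy Y) : IsFinite (Y.hom ≫ p) := by
  let 𝒰 : S.OpenCover :=
    { I₀ := J
      X := W
      f := j
      mem₀ := by
        rw [Scheme.presieve₀_mem_precoverage_iff]
        exact ⟨hcov, hj⟩ }
  have : IsZariskiLocalAtTarget (@IsFinite : MorphismProperty Scheme.{u}) :=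
    (HasAffineProperty.iff.1 ((HasAffineProperty.affineAnd_iff _ RingHom.finite_respectsIso
      RingHom.finite_localizationPreserves.away RingHom.finite_ofLocalizationSpan).2
        fun {X Y} f => isFinite_iff f)).1
  refine IsZariskiLocalAtTarget.of_openCover 𝒰 fun s => ?_
  have e := (h s).isPullback r
  have : IsFinite (e.isoPullback.inv ≫ t s) := inferInstance
  rwa [e.isoPullback_inv_snd] at this

end Gluing

/-! ### Representability of the functor of triples -/

section Main

variable {k : Type u} [Field k] [Finite k] {A A' : CommRingCat.{u}} {ρ : A ⟶ A'} {d : A → ℤ}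
  {d' : A' → ℤ} {S : Scheme.{u}} {c : S ⟶ Spec A} {M : ModuleScheme A S}

lemma extensionFunctor_isZariskiSheaf {q : ℕ} {P : Scheme.{u}} {cP : P ⟶ Spec A'} {p : P ⟶ S} :
    IsZariskiSheaf (extensionFunctor ρ q d' M cP p) :=
  ⟨extensionFunctor_separated, exists_extensionFunctor_glue⟩

/-- The functor of triples is representable and finite if the degree function takes a positive
value and `A'` is of finite type over `A`. -/
theorem representable_and_finite_of_pos (κ : k →+* A) (hM : M.IsDrinfeld (Nat.card k) d c)
    (hκ : ∀ t : k, t ≠ 0 → d (κ t) = 0) {a₀ : A} (ha₀ : a₀ ≠ 0) (hd : 0 < d a₀)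
    (hρ : ρ.hom.FiniteType) :
    (∃ T : Over (pullback (Spec.map ρ) c),
      Nonempty ((tripleFunctor ρ (Nat.card k) d' c M).RepresentableBy T)) ∧
    ∀ T : Over (pullback (Spec.map ρ) c),
      Nonempty ((tripleFunctor ρ (Nat.card k) d' c M).RepresentableBy T) →
      IsFinite (T.hom ≫ pullback.snd (Spec.map ρ) c) := by
  have hP := IsPullback.of_hasPullback (Spec.map ρ) c
  choose B j hj hs F using fun s => hM.exists_standardForm (κ := κ) hκ ha₀ hd s
  replace F := fun s => (F s).some
  have hcov : ∀ x : S, ∃ s, x ∈ Set.range (j s) := fun x => ⟨x, hs x⟩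
  have hF : ∀ s, IsLocalRepresentation
      (extensionFunctor ρ (Nat.card k) d' M (pullback.fst (Spec.map ρ) c)
        (pullback.snd (Spec.map ρ) c)) (pullback.snd (Spec.map ρ) c) (j s)
      ((F s).extensionScheme d' hP) (Spec.map ((F s).extensionBase ρ d'))
      ((F s).universalExtension d' hP) := fun s =>
    ⟨((F s).extensionMap_snd d' hP).symm, fun b hb x => (F s).existsUnique_hom hP b hb x⟩
  constructor
  · obtain ⟨T, ⟨r⟩⟩ := exists_representableBy extensionFunctor_isZariskiSheaf hj hcov hF
    exact ⟨T, ⟨representableByEquiv.symm r⟩⟩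
  · rintro T ⟨r⟩
    refine isFinite_of_representableBy hj hcov hF (fun s => ?_) (representableByEquiv r)
    rw [IsFinite.SpecMap_iff]
    exact universalBase_finite Finite.one_lt_card (F s).pos (F s).unit rfl (F s).bound hρ

lemma act_snd_comp {E : CommGrp (Over S)} {Z T : Over S} (f : E.X ⟶ E.X) (x : T ⟶ Z)
    (y : T ⟶ E.X) : act (snd Z E.X ≫ f) x y = y ≫ f := by
  rw [act, ← Category.assoc, lift_snd]

/-- The action of `A` itself, transported along the isomorphism `A ⟶ A'`, is an extension. -/
lemma isExtension_of_bijective {q : ℕ} (hM : M.IsDrinfeld q d c)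
    (hρ : Function.Bijective ρ.hom) (hd : ∀ a : A, a ≠ 0 → d' (ρ.hom a) = d a) {Z : Over S}
    {c' : Z.left ⟶ Spec A'} (hc : c' ≫ Spec.map ρ = Z.hom ≫ c) :
    IsExtension ρ q d' M Z c' (fun a => snd Z M.E.X ≫
      toSchemeHom (M.φ ((RingEquiv.ofBijective ρ.hom hρ).symm a))) where
  act_mul a T x y z := by
    rw [act_snd_comp, act_snd_comp, act_snd_comp, ModuleScheme.toSchemeHom_mul]
  one_act x y := by rw [act_snd_comp, map_one, M.comp_φ_one]
  mul_act a b T x y := by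
    rw [act_snd_comp, act_snd_comp, act_snd_comp, map_mul, M.comp_φ_mul]
  add_act a b T x y := by
    rw [act_snd_comp, act_snd_comp, act_snd_comp, map_add, M.comp_φ_add]
  restrict_act a T x y := by
    rw [act_snd_comp]
    congr 3
    exact (RingEquiv.ofBijective ρ.hom hρ).symm_apply_apply a
  exists_coordinate z := by
    obtain ⟨B, j, hj, hz, χ, hχ⟩ := ModuleScheme.isDrinfeld_iff.1 hM (Z.hom z)
    obtain ⟨V, hV, hzV, hle⟩ := exists_isAffineOpen_mem_and_subset
      (U := Z.hom ⁻¹ᵁ j.opensRange) (x := z) hz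
    let l : Spec Γ(Z.left, V) ⟶ Spec B := IsOpenImmersion.lift j (hV.fromSpec ≫ Z.hom) (by
      rintro _ ⟨x, rfl⟩
      have : hV.fromSpec x ∈ V := by
        have := hV.range_fromSpec
        rw [← SetLike.mem_coe, ← this]; exact ⟨x, rfl⟩
      exact hle this)
    have hl : l ≫ j = hV.fromSpec ≫ Z.hom := IsOpenImmersion.lift_fac _ _ _
    refine ⟨_, hV.fromSpec, inferInstance, by rwa [hV.range_fromSpec], χ.restrict l hl, ?_⟩
    intro a' ha'
    obtain ⟨a, rfl⟩ := hρ.2 a'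
    have ha : a ≠ 0 := by rintro rfl; exact ha' (map_zero _)
    obtain ⟨δ, h1, h2, h3, h4⟩ := hχ.restrict l hl a ha
    refine ⟨δ, fun T t y => ?_, ?_, by rw [hd a ha]; exact h3, by rw [hd a ha]; exact h4⟩
    · refine Eq.trans ?_ (h1 T t y)
      refine congrArg ((χ.restrict l hl).equiv t) ((act_snd_comp _ _ _).trans ?_)
      exact congrArg (fun b => y ≫ toSchemeHom (M.φ b))
        ((RingEquiv.ofBijective ρ.hom hρ).symm_apply_apply a)
    · rw [h2]
      have e : Spec.preimage (j ≫ c) ≫ Spec.preimage l =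
          ρ ≫ Spec.preimage (hV.fromSpec ≫ c') := by
        apply Spec.map_injective
        rw [Spec.map_comp, Spec.map_comp, Spec.map_preimage, Spec.map_preimage, Spec.map_preimage,
          ← Category.assoc, hl, Category.assoc, Category.assoc, hc]
      exact RingHom.congr_fun (congrArg CommRingCat.Hom.hom e) a

/-- If `A ⟶ A'` is an isomorphism compatible with the degree functions, then every scheme over
`Spec A' ×_{Spec A} S` carries a unique triple. -/
theorem representable_and_finite_of_bijective {q : ℕ} (hM : M.IsDrinfeld q d c)
    (hρ : Function.Bijective ρ.hom) (hd : ∀ a : A, a ≠ 0 → d' (ρ.hom a) = d a) :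
    (∃ T : Over (pullback (Spec.map ρ) c),
      Nonempty ((tripleFunctor ρ q d' c M).RepresentableBy T)) ∧
    ∀ T : Over (pullback (Spec.map ρ) c),
      Nonempty ((tripleFunctor ρ q d' c M).RepresentableBy T) →
      IsFinite (T.hom ≫ pullback.snd (Spec.map ρ) c) := by
  have hP := IsPullback.of_hasPullback (Spec.map ρ) c
  let G := extensionFunctor ρ q d' M (pullback.fst (Spec.map ρ) c) (pullback.snd (Spec.map ρ) c)
  have hsub : ∀ X : Over (pullback (Spec.map ρ) c), ∀ e e' : G.obj (op X), e = e' := by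
    intro X e e'
    refine Subtype.ext (funext fun a' => act_ext fun T x y => ?_)
    obtain ⟨a, rfl⟩ := hρ.2 a'
    rw [e.2.restrict_act, e'.2.restrict_act]
  have hne : ∀ X : Over (pullback (Spec.map ρ) c), Nonempty (G.obj (op X)) := fun X =>
    ⟨⟨_, isExtension_of_bijective hM hρ hd (Z := (Over.map (pullback.snd (Spec.map ρ) c)).obj X)
      (c' := X.hom ≫ pullback.fst (Spec.map ρ) c) (by
        refine (Category.assoc _ _ _).trans ?_
        rw [hP.w]
        exact (Category.assoc _ _ _).symm)⟩⟩
  have r : G.RepresentableBy (Over.mk (𝟙 (pullback (Spec.map ρ) c))) :=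
    { homEquiv := fun {X} =>
        { toFun := fun _ => (hne X).some
          invFun := fun _ => Over.mkIdTerminal.from X
          left_inv := fun _ => Over.mkIdTerminal.hom_ext _ _
          right_inv := fun _ => hsub X _ _ }
      homEquiv_comp := fun _ _ => hsub _ _ _ }
  refine ⟨⟨_, ⟨representableByEquiv.symm r⟩⟩, ?_⟩
  rintro T ⟨r'⟩
  have e : T ≅ Over.mk (𝟙 (pullback (Spec.map ρ) c)) := (representableByEquiv r').uniqueUpToIso r
  have : IsIso ρ := (ConcreteCategory.isIso_iff_bijective ρ).2 hρ
  have h1 : T.hom = e.hom.left := by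
    have := Over.w e.hom
    exact this.symm.trans (Category.comp_id _)
  have : IsIso T.hom := by
    rw [h1]
    exact inferInstanceAs (IsIso ((Over.forget _).map e.hom))
  infer_instance

end Main

/-! ### Local rings of smooth curves -/

open IsLocalRing in
/-- A standard smooth algebra of relative dimension one over a field `R` is étale over `R[t]`. Hence
the maximal ideals of its local rings are generated by the image of a generator of a prime ideal of
`R[t]`, and `R[t]` embeds into each of them by flatness. -/
lemma isPrincipal_maximalIdeal_of_isStandardSmooth {R B O : Type u} [CommRing R] (hR : IsField R)
    [CommRing B] {f : R →+* B} (hf : f.IsStandardSmoothOfRelativeDimension 1)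
    [CommRing O] [IsLocalRing O] [Algebra B O] (p : Ideal B) [p.IsPrime]
    [IsLocalization.AtPrime O p] :
    (maximalIdeal O).IsPrincipal ∧
      ∃ g : MvPolynomial (Fin 1) R →+* O, Function.Injective g := by
  let _ := hR.toField
  obtain ⟨g, -, hg⟩ := hf.exists_etale_mvPolynomial
  algebraize [g]
  have : IsPrincipalIdealRing (MvPolynomial (Fin 1) R) :=
    IsPrincipalIdealRing.of_surjective (MvPolynomial.uniqueAlgEquiv R (Fin 1)).symm.toRingEquiv
      (MvPolynomial.uniqueAlgEquiv R (Fin 1)).symm.surjective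
  constructor
  · let _ := Localization.AtPrime.algebraOfLiesOver (p.under (MvPolynomial (Fin 1) R)) p
    have h := ((Algebra.isUnramifiedAt_iff_map_eq (MvPolynomial (Fin 1) R)
      (p.under (MvPolynomial (Fin 1) R)) p).1 inferInstance).2
    have h' : (maximalIdeal (Localization.AtPrime p)).IsPrincipal := by
      rw [← h]
      exact (IsPrincipalIdealRing.principal _).map_ringHom _
    let e := (IsLocalization.algEquiv p.primeCompl (Localization.AtPrime p) O).toRingEquiv
    have h2 := h'.map_ringHom (e : Localization.AtPrime p →+* O)
    convert h2
    exact (IsLocalRing.map_maximalIdeal_of_surjective _ e.surjective).symm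
  · let _ : Algebra (MvPolynomial (Fin 1) R) O := ((algebraMap B O).comp g).toAlgebra
    have : IsScalarTower (MvPolynomial (Fin 1) R) B O := IsScalarTower.of_algebraMap_eq' rfl
    have : Module.Flat B O := IsLocalization.flat O p.primeCompl
    have : Module.Flat (MvPolynomial (Fin 1) R) O := Module.Flat.trans _ B O
    exact ⟨algebraMap _ O, FaithfulSMul.algebraMap_injective _ O⟩

lemma isField_sections_spec {k : Type u} [Field k] (U : (Spec (CommRingCat.of k)).Opens)
    (x : Spec (CommRingCat.of k)) (hx : x ∈ U) : IsField Γ(Spec (CommRingCat.of k), U) := by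
  obtain rfl : U = ⊤ := top_le_iff.1 fun y _ => by
    have : Subsingleton (Spec (CommRingCat.of k)) :=
      inferInstanceAs (Subsingleton (PrimeSpectrum k))
    rwa [Subsingleton.elim y x]
  exact (Scheme.ΓSpecIso (CommRingCat.of k)).commRingCatIsoToRingEquiv.toMulEquiv.isField
    (Field.toIsField k)

namespace PointedCurve

variable {k : Type u} [Field k] (X : PointedCurve k)

/-- The local rings of a smooth curve have principal maximal ideals and contain a polynomial ring. -/
lemma stalk_structure (x : X.C) :
    (IsLocalRing.maximalIdeal (X.C.presheaf.stalk x)).IsPrincipal ∧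
      ∃ (R : Type u) (_ : CommRing R) (_ : Nontrivial R)
        (g : MvPolynomial (Fin 1) R →+* X.C.presheaf.stalk x), Function.Injective g := by
  have := X.smooth
  obtain ⟨U, hU, V, hV, hx, e, h⟩ :=
    SmoothOfRelativeDimension.exists_isStandardSmoothOfRelativeDimension (n := 1) (f := X.str) x
  have hF := isField_sections_spec U _ (e hx)
  let _ : Algebra Γ(X.C, V) (X.C.presheaf.stalk x) := (X.C.presheaf.germ V x hx).hom.toAlgebra
  have : IsLocalization.AtPrime (X.C.presheaf.stalk x) (hV.primeIdealOf ⟨x, hx⟩).asIdeal :=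
    hV.isLocalization_stalk ⟨x, hx⟩
  have h2 := isPrincipal_maximalIdeal_of_isStandardSmooth hF h (O := X.C.presheaf.stalk x)
    (hV.primeIdealOf ⟨x, hx⟩).asIdeal
  exact ⟨h2.1, _, _, hF.nontrivial, h2.2⟩

instance (x : X.C) : IsPrincipalIdealRing (X.C.presheaf.stalk x) :=
  ((tfae_of_isNoetherianRing_of_isLocalRing_of_isDomain (X.C.presheaf.stalk x)).out 4 0).1
    (X.stalk_structure x).1

/-- The residue field of a closed point is finite over `k`. -/
lemma toResidueField_finite : X.toResidueField.Finite := by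
  have := isClosed_singleton_iff_isClosedImmersion.1 X.isClosed
  have : IsFinite (X.C.fromSpecResidueField X.pt ≫ X.str) := by
    rw [isFinite_iff_locallyOfFiniteType_of_jacobsonSpace]
    infer_instance
  rw [← Spec.map_preimage (X.C.fromSpecResidueField X.pt ≫ X.str)] at this
  exact (IsFinite.SpecMap_iff _).1 this

lemma deg_pos : 0 < X.deg := by
  let _ := X.toResidueField.toAlgebra
  have : Module.Finite k (X.C.residueField X.pt) := X.toResidueField_finite
  exact Module.finrank_pos

variable [Finite k]

lemma finite_residueField : Finite (X.C.residueField X.pt) := by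
  let _ := X.toResidueField.toAlgebra
  have : Module.Finite k (X.C.residueField X.pt) := X.toResidueField_finite
  exact Module.finite_of_finite k

/-- A closed point of a smooth curve is not generic: its residue field is finite, whereas its local
ring contains a polynomial ring. -/
lemma not_isField_stalk : ¬ IsField (X.C.presheaf.stalk X.pt) := by
  intro h
  obtain ⟨R, _, _, g, hg⟩ := (X.stalk_structure X.pt).2
  let _ := h.toField
  have := X.finite_residueField
  have hinj : Function.Injective (X.C.residue X.pt).hom :=
    RingHom.injective (X.C.residue X.pt).hom
  have : Finite (MvPolynomial (Fin 1) R) := Finite.of_injective _ (hinj.comp hg)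
  exact not_finite (MvPolynomial (Fin 1) R)

instance : IsDiscreteValuationRing (X.C.presheaf.stalk X.pt) :=
  ((IsDiscreteValuationRing.TFAE _ X.not_isField_stalk).out 4 0).1 (X.stalk_structure X.pt).1

lemma coheight_pt : Order.coheight X.pt = 1 := by
  have h := ringKrullDim_stalk_eq_coheight X.pt
  rw [IsPrincipalIdealRing.ringKrullDim_eq_one _ X.not_isField_stalk] at h
  exact_mod_cast h.symm

lemma genericPoint_ne_pt : genericPoint X.C ≠ X.pt := by
  intro h
  have := X.not_isField_stalk
  rw [← h] at this
  exact this (Field.toIsField X.C.functionField)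

lemma genericPoint_mem : genericPoint X.C ∈ X.affinePart := X.genericPoint_ne_pt

instance : Nonempty X.affinePart := ⟨⟨_, X.genericPoint_mem⟩⟩

end PointedCurve

/-! ### Rational functions on curves -/

/-- The rational function `f` is regular at the point `x`. -/
def IsRegularAt {Y : Scheme.{u}} [IsIntegral Y] (f : Y.functionField) (x : Y) : Prop :=
  f ∈ (algebraMap (Y.presheaf.stalk x) Y.functionField).range

lemma IsRegularAt.of_section {Y : Scheme.{u}} [IsIntegral Y] {U : Y.Opens} [Nonempty U]
    (s : Γ(Y, U)) {x : Y} (hx : x ∈ U) : IsRegularAt (Y.germToFunctionField U s) x :=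
  ⟨_, Scheme.algebraMap_germ_eq_germToFunctionField _ hx s⟩

/-- A rational function that is regular at all points of `U` is a section over `U`. -/
lemma exists_section_of_isRegularAt {Y : Scheme.{u}} [IsIntegral Y] (U : Y.Opens) [Nonempty U]
    (f : Y.functionField) (hf : ∀ x ∈ U, IsRegularAt f x) :
    ∃ s : Γ(Y, U), Y.germToFunctionField U s = f := by
  have h1 : ∀ x : U, ∃ (V : Y.Opens) (_ : x.1 ∈ V) (_ : V ≤ U) (_ : genericPoint Y ∈ V)
      (s : Γ(Y, V)), Y.presheaf.germ V (genericPoint Y) ‹_› s = f := by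
    rintro ⟨x, hx⟩
    obtain ⟨g, hg⟩ := hf x hx
    obtain ⟨V, hV, s, rfl⟩ := Y.presheaf.exists_germ_eq g
    have hxV : x ∈ V ⊓ U := ⟨hV, hx⟩
    have hne : Nonempty (V ⊓ U : Y.Opens) := ⟨⟨x, hxV⟩⟩
    refine ⟨V ⊓ U, hxV, inf_le_right, ((genericPoint_spec Y).mem_open_set_iff (V ⊓ U).isOpen).mpr
      ⟨x, trivial, hxV⟩, Y.presheaf.map (homOfLE inf_le_left).op s, ?_⟩
    rw [← hg]
    have := Y.presheaf.germ_res_apply (homOfLE (inf_le_left : V ⊓ U ≤ V)) x hxV s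
    rw [← this]
    exact (Scheme.algebraMap_germ_eq_germToFunctionField _ hxV _).symm
  choose V hxV hVU hη s hs using h1
  obtain ⟨t, ht, -⟩ := TopCat.Sheaf.existsUnique_gluing' Y.sheaf V U (fun x => homOfLE (hVU x))
    (fun x hx => TopologicalSpace.Opens.mem_iSup.2 ⟨⟨x, hx⟩, hxV ⟨x, hx⟩⟩) s (by
      intro i j
      apply germ_injective_of_isIntegral Y (genericPoint Y) (U := V i ⊓ V j) ⟨hη i, hη j⟩
      refine (Y.presheaf.germ_res_apply (TopologicalSpace.Opens.infLELeft (V i) (V j)) _ _ _).trans ?_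
      refine Eq.trans ?_ (Y.presheaf.germ_res_apply (TopologicalSpace.Opens.infLERight (V i) (V j)) _ _ _).symm
      rw [hs, hs])
  obtain ⟨x⟩ := ‹Nonempty U›
  refine ⟨t, ?_⟩
  rw [← hs x, ← ht x]
  exact (Y.presheaf.germ_res_apply (homOfLE (hVU x)) _ (hη x) t).symm

namespace PointedCurve

variable {k : Type u} [Field k] [Finite k] (X : PointedCurve k)

/-- The inclusion of `A` into the function field. -/
noncomputable def toFunctionField : X.ring →+* X.C.functionField :=
  (X.C.germToFunctionField X.affinePart).hom

lemma toFunctionField_injective : Function.Injective X.toFunctionField :=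
  X.C.germToFunctionField_injective X.affinePart

lemma ord_eq (a : X.ring) : X.ord a = X.C.ord (X.toFunctionField a) X.pt :=
  dif_pos X.genericPoint_mem

variable {X}

lemma exists_eq_toFunctionField {f : X.C.functionField} (hf : ∀ x ≠ X.pt, IsRegularAt f x) :
    ∃ a : X.ring, X.toFunctionField a = f :=
  exists_section_of_isRegularAt X.affinePart f hf

/-- A rational function with a pole at `∞` has negative valuation. -/
lemma ord_neg_of_not_isRegularAt {f : X.C.functionField} (hf : ¬ IsRegularAt f X.pt) :
    X.C.ord f X.pt < 0 := by
  have hf0 : f ≠ 0 := fun h => hf (h ▸ ⟨0, map_zero _⟩)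
  obtain ⟨b, hb⟩ := (ValuationRing.isInteger_or_isInteger (X.C.presheaf.stalk X.pt) f).resolve_left hf
  have hb0 : b ≠ 0 := by
    rintro rfl
    exact inv_ne_zero hf0 (hb.symm.trans (map_zero _))
  have hu : ¬ IsUnit b := by
    rintro ⟨v, rfl⟩
    refine hf ⟨(v⁻¹ : _ˣ), ?_⟩
    rw [← inv_inv f, ← hb]
    refine eq_inv_of_mul_eq_one_left ?_
    rw [← map_mul, Units.inv_mul, map_one]
  have h1 := X.C.ord_mul (x := X.pt) hf0 (inv_ne_zero hf0)
  rw [mul_inv_cancel₀ hf0, ← hb] at h1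
  have h2 : X.C.ord 1 X.pt = 0 := by
    rw [Scheme.ord_eq_iff X.coheight_pt one_ne_zero, map_one]; rfl
  have hb' : algebraMap (X.C.presheaf.stalk X.pt) X.C.functionField b ≠ 0 := by
    rw [hb]; exact inv_ne_zero hf0
  have h3 : 0 ≤ X.C.ord (algebraMap (X.C.presheaf.stalk X.pt) X.C.functionField b) X.pt := by
    rw [Scheme.le_ord_iff X.coheight_pt hb']
    exact Ring.ordFrac_ge_one_of_ne_zero hb0
  have h4 : X.C.ord (algebraMap (X.C.presheaf.stalk X.pt) X.C.functionField b) X.pt ≠ 0 := by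
    rw [Ne, Scheme.ord_eq_iff X.coheight_pt hb']
    exact fun h => hu (Ring.isUnit_iff_ordFrac_one_of_isDiscreteValuationRing.2 h)
  omega

lemma degreeFunction_pos {r : ℕ} (hr : 0 < r) {a : X.ring}
    (ha : ¬ IsRegularAt (X.toFunctionField a) X.pt) : 0 < X.degreeFunction r a := by
  have h1 := ord_neg_of_not_isRegularAt ha
  rw [← ord_eq] at h1
  have h2 := X.deg_pos
  rw [degreeFunction, neg_mul_comm]
  have : 0 < (r : ℤ) := by exact_mod_cast hr
  have : 0 < (X.deg : ℤ) := by exact_mod_cast h2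
  have : 0 < - X.ord a := by omega
  positivity

instance : Nonempty (⊤ : X.C.Opens) := ⟨⟨X.pt, trivial⟩⟩

variable (X) in
/-- The restriction `Γ(C, 𝒪_C) → A`. -/
noncomputable def resGlobal : Γ(X.C, ⊤) →+* X.ring :=
  (X.C.presheaf.map (homOfLE (le_top : X.affinePart ≤ ⊤)).op).hom

lemma exists_resGlobal_eq {a : X.ring} (ha : IsRegularAt (X.toFunctionField a) X.pt) :
    ∃ s, X.resGlobal s = a := by
  obtain ⟨s, hs⟩ := exists_section_of_isRegularAt ⊤ (X.toFunctionField a) (fun x _ => by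
    by_cases hx : x = X.pt
    · exact hx ▸ ha
    · exact .of_section (U := X.affinePart) a hx)
  refine ⟨s, X.toFunctionField_injective (Eq.trans ?_ hs)⟩
  exact X.C.presheaf.germ_res_apply _ _ X.genericPoint_mem s

lemma degreeFunction_resGlobal (r : ℕ) {s : Γ(X.C, ⊤)} (hs : X.resGlobal s ≠ 0) :
    X.degreeFunction r (X.resGlobal s) = 0 := by
  have h0 : s ≠ 0 := by rintro rfl; exact hs (map_zero _)
  have hu : IsUnit s := by
    let _ := (isField_of_universallyClosed k X.str).toField
    exact isUnit_iff_ne_zero.2 h0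
  have h1 : X.ord (X.resGlobal s) = 0 := by
    rw [ord_eq]
    refine Eq.trans (congrArg (fun f => X.C.ord f X.pt) ?_)
      (Scheme.ord_of_isUnit (U := ⊤) hu (x := X.pt) trivial)
    exact X.C.presheaf.germ_res_apply _ _ X.genericPoint_mem s
  rw [degreeFunction, h1, mul_zero, zero_mul]

end PointedCurve

/-! ### Finite generation of the ring of functions regular away from `∞` -/

/-- Let `A` and `O` be subrings of a field with finite intersection, and let `s ∈ O` be such that
`O / s O` is finite, `a = s⁻¹` lies in `A`, and every element of `A` is carried into `O` by a power
of `s`. Then `A` is generated by finitely many elements: the sets `L j = {x ∈ A | s ^ j x ∈ O}` are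
finite, and the images of `s ^ j L j` in `O / s O` increase with `j`, so that they become constant;
from then on each element of `L (j + 1)` is of the form `a y + z` with `y, z ∈ L j`. -/
lemma exists_finite_closure_eq_top {K A O : Type*} [Field K] [CommRing A] [CommRing O]
    (α : A →+* K) (κ : O →+* K) {a : A} {s : O} (has : κ s * α a = 1)
    [Finite (O ⧸ Ideal.span {s})] (h0 : {x : A | ∃ o, κ o = α x}.Finite)
    (hα : ∀ x : A, ∃ (j : ℕ) (o : O), κ o = κ s ^ j * α x) :
    ∃ F : Set A, F.Finite ∧ Subring.closure F = ⊤ := by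
  have hs : κ s ≠ 0 := left_ne_zero_of_mul_eq_one has
  let L : ℕ → Set A := fun j => {x | ∃ o, κ o = κ s ^ j * α x}
  have hLmono : Monotone L := monotone_nat_of_le_succ fun j x ⟨o, ho⟩ =>
    ⟨s * o, by rw [map_mul, ho, pow_succ']; ring⟩
  have hstep : ∀ (j : ℕ) (x : A) (o : O), κ s * κ o = κ s ^ (j + 1) * α x → x ∈ L j := by
    intro j x o h
    refine ⟨o, mul_left_cancel₀ hs (h.trans ?_)⟩
    rw [pow_succ']; ring
  have hLfin : ∀ j, (L j).Finite := by
    intro j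
    induction j with
    | zero => simpa [L] using h0
    | succ j ih =>
      have hch : ∀ x : L (j + 1), ∃ o, κ o = κ s ^ (j + 1) * α x := fun x => x.2
      choose o ho using hch
      have : ∀ x y : L (j + 1), Ideal.Quotient.mk (Ideal.span {s}) (o x) =
          Ideal.Quotient.mk (Ideal.span {s}) (o y) → x.1 - y.1 ∈ L j := by
        intro x y hxy
        obtain ⟨t, ht⟩ := Ideal.mem_span_singleton'.1 (Ideal.Quotient.eq.1 hxy)
        refine hstep j _ t ?_
        rw [← map_mul, mul_comm, ht, map_sub, map_sub, mul_sub, ho, ho]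
      refine Set.finite_coe_iff.1 (Set.finite_univ_iff.1 (Set.Finite.of_finite_fibers
        (fun x : L (j + 1) => Ideal.Quotient.mk (Ideal.span {s}) (o x)) (Set.toFinite _) ?_))
      rintro - ⟨y, -, rfl⟩
      exact Set.Finite.of_injOn (f := fun x : L (j + 1) => x.1 - y.1) (t := L j)
        (fun x hx => this x y hx.2) (fun x _ x' _ h => Subtype.ext (sub_left_injective h)) ih
  let I : ℕ →o Set (O ⧸ Ideal.span {s}) :=
    ⟨fun j => {c | ∃ x o, κ o = κ s ^ j * α x ∧ Ideal.Quotient.mk (Ideal.span {s}) o = c},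
      monotone_nat_of_le_succ fun j c ⟨x, o, ho, hc⟩ => ⟨a * x, o, by
        rw [ho, pow_succ, map_mul, mul_assoc, ← mul_assoc (κ s), has, one_mul], hc⟩⟩
  obtain ⟨N, hN⟩ := WellFoundedGT.monotone_chain_condition I
  refine ⟨insert a (L N), (hLfin N).insert a, top_le_iff.1 fun x _ => ?_⟩
  obtain ⟨j, hj⟩ := hα x
  have hall : ∀ j, L j ⊆ Subring.closure (insert a (L N)) := by
    intro j
    induction j with
    | zero => exact ((hLmono N.zero_le).trans (Set.subset_insert _ _)).trans Subring.subset_closure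
    | succ j ih =>
      rcases le_or_gt (j + 1) N with h | h
      · exact ((hLmono h).trans (Set.subset_insert _ _)).trans Subring.subset_closure
      · rintro x ⟨o, ho⟩
        have hmem : Ideal.Quotient.mk (Ideal.span {s}) o ∈ I (j + 1) := ⟨x, o, ho, rfl⟩
        rw [← hN (j + 1) (by omega), hN j (by omega)] at hmem
        obtain ⟨y, o', ho', hoo⟩ := hmem
        obtain ⟨t, ht⟩ := Ideal.mem_span_singleton'.1 (Ideal.Quotient.eq.1 hoo.symm)
        have hz : x - a * y ∈ L j := by
          refine hstep j _ t ?_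
          rw [← map_mul, mul_comm, ht, map_sub, map_sub, mul_sub, ho, ho', pow_succ, map_mul,
            mul_assoc _ (κ s) (α a * α y), ← mul_assoc (κ s) (α a), has, one_mul]
        rw [← sub_add_cancel x (a * y)]
        exact add_mem (ih hz) (mul_mem (Subring.subset_closure (Set.mem_insert _ _))
          (ih ⟨o', ho'⟩))
  exact hall j hj

namespace PointedCurve

variable {k : Type u} [Field k] [Finite k] (X : PointedCurve k)

lemma finite_globalSections : Finite Γ(X.C, ⊤) := by
  have h : X.str.appTop.hom.Finite := finite_appTop_of_universallyClosed k X.str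
  algebraize [X.str.appTop.hom]
  have : Finite Γ(Spec (CommRingCat.of k), ⊤) :=
    Finite.of_equiv k (Scheme.ΓSpecIso (CommRingCat.of k)).commRingCatIsoToRingEquiv.symm.toEquiv
  exact Module.finite_of_finite Γ(Spec (CommRingCat.of k), ⊤)

lemma finite_setOf_isRegularAt : {a : X.ring | IsRegularAt (X.toFunctionField a) X.pt}.Finite := by
  have := X.finite_globalSections
  exact (Set.finite_range X.resGlobal).subset fun a ha => exists_resGlobal_eq ha

open IsLocalRing in
/-- If some element of `A` has a pole at `∞`, then `A` is a finitely generated ring. -/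
lemma exists_finite_closure_eq_top_of_pole {a : X.ring}
    (ha : ¬ IsRegularAt (X.toFunctionField a) X.pt) :
    ∃ F : Set X.ring, F.Finite ∧ Subring.closure F = ⊤ := by
  obtain ⟨s, hs⟩ := (ValuationRing.isInteger_or_isInteger (X.C.presheaf.stalk X.pt)
    (X.toFunctionField a)).resolve_left ha
  have ha0 : X.toFunctionField a ≠ 0 := fun h => ha (h ▸ ⟨0, map_zero _⟩)
  have has : algebraMap (X.C.presheaf.stalk X.pt) X.C.functionField s * X.toFunctionField a = 1 := by
    rw [hs, inv_mul_cancel₀ ha0]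
  have hs0 : s ≠ 0 := by
    rintro rfl
    rw [map_zero, zero_mul] at has
    exact zero_ne_one has
  have hsm : s ∈ maximalIdeal (X.C.presheaf.stalk X.pt) := by
    rw [mem_maximalIdeal, mem_nonunits_iff]
    rintro ⟨v, rfl⟩
    refine ha ⟨(v⁻¹ : _ˣ), ?_⟩
    refine (mul_left_cancel₀ (left_ne_zero_of_mul_eq_one has) ?_)
    rw [has, ← map_mul, Units.mul_inv, map_one]
  have hpow := exists_maximalIdeal_pow_eq_of_principal (X.C.presheaf.stalk X.pt)
    (X.stalk_structure X.pt).1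
  have : Finite (X.C.presheaf.stalk X.pt ⧸ Ideal.span {s}) := by
    obtain ⟨n, hn⟩ := hpow (Ideal.span {s}) (by simpa using hs0)
    rw [hn]
    have : Finite (X.C.presheaf.stalk X.pt ⧸ maximalIdeal (X.C.presheaf.stalk X.pt)) :=
      X.finite_residueField
    exact Ideal.finite_quotient_pow (IsNoetherian.noetherian _) n
  refine exists_finite_closure_eq_top X.toFunctionField
    (algebraMap (X.C.presheaf.stalk X.pt) X.C.functionField) has X.finite_setOf_isRegularAt ?_
  intro x
  obtain ⟨u, v, hv, huv⟩ := IsFractionRing.div_surjective (A := X.C.presheaf.stalk X.pt)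
    (X.toFunctionField x)
  have hv0 : v ≠ 0 := nonZeroDivisors.ne_zero hv
  obtain ⟨n, hn⟩ := hpow (Ideal.span {v}) (by simpa using hv0)
  have h1 : s ^ n ∈ Ideal.span {v} := hn ▸ Ideal.pow_mem_pow hsm n
  obtain ⟨t, ht⟩ := Ideal.mem_span_singleton'.1 h1
  refine ⟨n, t * u, ?_⟩
  have hv1 : algebraMap (X.C.presheaf.stalk X.pt) X.C.functionField v ≠ 0 :=
    IsFractionRing.to_map_ne_zero_of_mem_nonZeroDivisors hv
  rw [← map_pow, ← ht, ← huv, map_mul, map_mul]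
  field_simp

end PointedCurve

/-! ### Finite morphisms of curves -/

namespace PointedCurve

variable {k : Type u} [Field k] [Finite k] {X X' : PointedCurve k} (π : X'.C ⟶ X.C)

/-- `π` is dominant: the image of the generic point specializes to `∞` but differs from it, and `∞` has
coheight one. -/
lemma map_genericPoint
    (hpt : ∀ y : X'.C, π y = X.pt ↔ y = X'.pt) : π (genericPoint X'.C) = genericPoint X.C := by
  have h1 : π (genericPoint X'.C) ⤳ X.pt := by
    rw [← (hpt X'.pt).2 rfl]
    exact ((genericPoint_spec X'.C).specializes trivial).map π.continuous
  have h2 : π (genericPoint X'.C) ≠ X.pt := fun h => X'.genericPoint_ne_pt ((hpt _).1 h)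
  have h3 : X.pt < π (genericPoint X'.C) :=
    lt_of_le_not_ge (Scheme.le_iff_specializes.2 h1) fun h =>
      h2 ((Scheme.le_iff_specializes.1 h).antisymm h1).eq.symm
  have h4 : Order.coheight (π (genericPoint X'.C)) = 0 := by
    have := Order.coheight_add_one_le h3
    rw [X.coheight_pt] at this
    rw [← nonpos_iff_eq_zero]
    exact (ENat.add_le_add_iff_right ENat.one_ne_top).1 (by rwa [zero_add])
  have h5 : genericPoint X.C ⤳ π (genericPoint X'.C) := (genericPoint_spec X.C).specializes trivial
  exact ((Scheme.le_iff_specializes.1 (Order.coheight_eq_zero.1 h4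
    (Scheme.le_iff_specializes.2 h5))).antisymm h5).eq

/-- The extension `K → K'` of function fields given by `π`. -/
noncomputable def functionFieldMap
    (hpt : ∀ y : X'.C, π y = X.pt ↔ y = X'.pt) : X.C.functionField →+* X'.C.functionField :=
  (X.C.presheaf.stalkSpecializes (specializes_of_eq (map_genericPoint π hpt)) ≫
    π.stalkMap (genericPoint X'.C)).hom

lemma functionFieldMap_algebraMap
    (hpt : ∀ y : X'.C, π y = X.pt ↔ y = X'.pt) (y : X'.C) (b : X.C.presheaf.stalk (π y)) :
    functionFieldMap π hpt (algebraMap _ X.C.functionField b) =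
      algebraMap _ X'.C.functionField ((π.stalkMap y).hom b) := by
  have h : genericPoint X'.C ⤳ y := (genericPoint_spec X'.C).specializes trivial
  refine Eq.trans ?_ (ConcreteCategory.congr_hom (π.stalkSpecializes_stalkMap _ _ h) b)
  refine congrArg (π.stalkMap (genericPoint X'.C)).hom ?_
  exact ConcreteCategory.congr_hom (X.C.presheaf.stalkSpecializes_comp _ _) b

lemma functionFieldMap_germ
    (hpt : ∀ y : X'.C, π y = X.pt ↔ y = X'.pt) (V : X.C.Opens) (hV : genericPoint X.C ∈ V)
    (hV' : genericPoint X'.C ∈ π ⁻¹ᵁ V) (s : Γ(X.C, V)) :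
    functionFieldMap π hpt (X.C.presheaf.germ V _ hV s) =
      X'.C.presheaf.germ (π ⁻¹ᵁ V) _ hV' ((π.app V).hom s) := by
  refine Eq.trans ?_ (π.germ_stalkMap_apply V _ hV' s)
  refine congrArg (π.stalkMap (genericPoint X'.C)).hom ?_
  exact ConcreteCategory.congr_hom (X.C.presheaf.germ_stalkSpecializes _ _) s

lemma functionFieldMap_toFunctionField (hpt : ∀ y : X'.C, π y = X.pt ↔ y = X'.pt) (a : X.ring) :
    functionFieldMap π hpt (X.toFunctionField a) =
      X'.toFunctionField ((ringMap π hpt).hom a) := by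
  have hV' : genericPoint X'.C ∈ π ⁻¹ᵁ X.affinePart := by
    change π (genericPoint X'.C) ∈ X.affinePart
    rw [map_genericPoint π hpt]
    exact X.genericPoint_mem
  refine (functionFieldMap_germ π hpt X.affinePart X.genericPoint_mem hV' a).trans ?_
  exact (X'.C.presheaf.germ_res_apply _ _ X'.genericPoint_mem _).symm

lemma ringMap_injective
    (hpt : ∀ y : X'.C, π y = X.pt ↔ y = X'.pt) : Function.Injective (ringMap π hpt).hom := fun a b h =>
  X.toFunctionField_injective ((functionFieldMap π hpt).injective (by
    rw [functionFieldMap_toFunctionField, functionFieldMap_toFunctionField, h]))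

lemma IsRegularAt.map
    (hpt : ∀ y : X'.C, π y = X.pt ↔ y = X'.pt) {f : X.C.functionField} {y : X'.C} (hf : IsRegularAt f (π y)) :
    IsRegularAt (functionFieldMap π hpt f) y := by
  obtain ⟨b, rfl⟩ := hf
  exact ⟨_, (functionFieldMap_algebraMap π hpt y b).symm⟩

/-- `π` is flat, since its source has torsion-free local rings over the principal local
rings of its target. -/
lemma flat (hpt : ∀ y : X'.C, π y = X.pt ↔ y = X'.pt) : Flat π := by
  refine Flat.of_stalkMap _ fun y => ?_
  let _ := (π.stalkMap y).hom.toAlgebra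
  have hinj : Function.Injective (π.stalkMap y).hom := fun a b h => by
    apply IsFractionRing.injective (X.C.presheaf.stalk (π y)) X.C.functionField
    apply (functionFieldMap π hpt).injective
    rw [functionFieldMap_algebraMap, functionFieldMap_algebraMap, h]
  have : FaithfulSMul (X.C.presheaf.stalk (π y)) (X'.C.presheaf.stalk y) :=
    (faithfulSMul_iff_algebraMap_injective _ _).2 hinj
  have : Module.IsTorsionFree (X.C.presheaf.stalk (π y)) (X'.C.presheaf.stalk y) := inferInstance
  exact (inferInstance : Module.Flat (X.C.presheaf.stalk (π y)) (X'.C.presheaf.stalk y))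

lemma finrank_pos
    (hpt : ∀ y : X'.C, π y = X.pt ↔ y = X'.pt) [IsFinite π] : 0 < π.finrank (genericPoint X.C) := by
  have := flat π hpt
  have h := π.one_le_finrank_map (genericPoint X'.C)
  rwa [map_genericPoint π hpt] at h

/-- Over each point of `C ∖ {∞}`, elements of `A'` are integral over the local ring. -/
lemma isIntegralElem_toFunctionField
    (hpt : ∀ y : X'.C, π y = X.pt ↔ y = X'.pt) [IsFinite π] (a' : X'.ring) {x : X.C} (hx : x ≠ X.pt) :
    ((functionFieldMap π hpt).comp
      (algebraMap (X.C.presheaf.stalk x) X.C.functionField)).IsIntegralElem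
        (X'.toFunctionField a') := by
  obtain ⟨V, hV, hxV, hVA⟩ := exists_isAffineOpen_mem_and_subset (U := X.affinePart) (x := x) hx
  have hVA' : π ⁻¹ᵁ V ≤ X'.affinePart := fun y hy hy' => hVA hy ((hpt y).2 hy')
  have hη : genericPoint X.C ∈ V :=
    ((genericPoint_spec X.C).mem_open_set_iff V.isOpen).mpr ⟨x, trivial, hxV⟩
  have hη' : genericPoint X'.C ∈ π ⁻¹ᵁ V := by
    change π (genericPoint X'.C) ∈ V
    rwa [map_genericPoint π hpt]
  obtain ⟨p, hp, hp0⟩ := π.isIntegral_app V hV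
    ((X'.C.presheaf.map (homOfLE hVA').op).hom a')
  refine ⟨p.map (X.C.presheaf.germ V x hxV).hom, hp.map _, ?_⟩
  have : Nonempty V := ⟨⟨x, hxV⟩⟩
  have h1 : ((functionFieldMap π hpt).comp
      (algebraMap (X.C.presheaf.stalk x) X.C.functionField)).comp (X.C.presheaf.germ V x hxV).hom =
      (X'.C.presheaf.germ (π ⁻¹ᵁ V) _ hη').hom.comp (π.app V).hom := by
    ext s
    refine Eq.trans ?_ (functionFieldMap_germ π hpt V hη hη' s)
    exact congrArg (functionFieldMap π hpt)
      (Scheme.algebraMap_germ_eq_germToFunctionField _ hxV s)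
  have h2 : X'.toFunctionField a' = (X'.C.presheaf.germ (π ⁻¹ᵁ V) _ hη').hom
      ((X'.C.presheaf.map (homOfLE hVA').op).hom a') :=
    (X'.C.presheaf.germ_res_apply _ _ hη' a').symm
  rw [Polynomial.eval₂_map, h1, h2, ← Polynomial.hom_eval₂, hp0, map_zero]

/-- If an element `a'` of `A'` has a pole at `∞'`, then a coefficient of its minimal polynomial
over `K` has a pole at `∞`. The coefficients lie in `A`, as the local rings of `C ∖ {∞}` are
integrally closed. -/
lemma exists_pole (hpt : ∀ y : X'.C, π y = X.pt ↔ y = X'.pt) [IsFinite π] {a' : X'.ring}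
    (ha' : ¬ IsRegularAt (X'.toFunctionField a') X'.pt) :
    ∃ a : X.ring, ¬ IsRegularAt (X.toFunctionField a) X.pt := by
  by_contra! hA
  let _ := (functionFieldMap π hpt).toAlgebra
  have hloc : ∀ x : X.C, x ≠ X.pt → IsIntegral X.C.functionField (X'.toFunctionField a') ∧
      ∀ i, IsRegularAt ((minpoly X.C.functionField (X'.toFunctionField a')).coeff i) x := by
    intro x hx
    let _ := ((functionFieldMap π hpt).comp
      (algebraMap (X.C.presheaf.stalk x) X.C.functionField)).toAlgebra
    have : IsScalarTower (X.C.presheaf.stalk x) X.C.functionField X'.C.functionField :=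
      IsScalarTower.of_algebraMap_eq' rfl
    have hint : IsIntegral (X.C.presheaf.stalk x) (X'.toFunctionField a') :=
      isIntegralElem_toFunctionField π hpt a' hx
    refine ⟨hint.tower_top, fun i => ?_⟩
    rw [minpoly.isIntegrallyClosed_eq_field_fractions' X.C.functionField hint,
      Polynomial.coeff_map]
    exact ⟨_, rfl⟩
  have hK := (hloc _ X.genericPoint_ne_pt).1
  have hpt' : ∀ i, IsRegularAt
      ((minpoly X.C.functionField (X'.toFunctionField a')).coeff i) X.pt := by
    intro i
    obtain ⟨a, ha⟩ := exists_eq_toFunctionField (fun x hx => (hloc x hx).2 i)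
    rw [← ha]
    exact hA a
  have hcoeff : (minpoly X.C.functionField (X'.toFunctionField a')).map (functionFieldMap π hpt) ∈
      Polynomial.lifts (algebraMap (X'.C.presheaf.stalk X'.pt) X'.C.functionField) := by
    rw [Polynomial.lifts_iff_coeff_lifts]
    intro i
    rw [Polynomial.coeff_map]
    have h := hpt' i
    rw [← (hpt X'.pt).2 rfl] at h
    exact IsRegularAt.map π hpt h
  obtain ⟨p, hp, -, hpm⟩ := Polynomial.lifts_and_natDegree_eq_and_monic hcoeff
    ((minpoly.monic hK).map _)
  have hint : IsIntegral (X'.C.presheaf.stalk X'.pt) (X'.toFunctionField a') := by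
    refine ⟨p, hpm, ?_⟩
    rw [Polynomial.eval₂_eq_eval_map, hp, Polynomial.eval_map]
    exact minpoly.aeval X.C.functionField (X'.toFunctionField a')
  obtain ⟨b, hb⟩ := IsIntegrallyClosed.isIntegral_iff.1 hint
  exact ha' ⟨b, hb⟩

end PointedCurve

/-! ### Constants -/

open TensorProduct in
/-- Let `L` be a finite extension of the finite field `k` such that `Spec (L ⊗[k] L)` is
irreducible. Then `L ⊗[k] L` has only one prime ideal, so that the homomorphisms
`x ⊗ y ↦ x y` and `x ⊗ y ↦ x y ^ q` to `L` have the same kernel. As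
`x ⊗ 1 - 1 ⊗ x` is in the first kernel, `x = x ^ q` for all `x`, that is, `L = k`. -/
lemma algebraMap_surjective_of_irreducibleSpace {k L : Type*} [Field k] [Finite k] [Field L]
    [Algebra k L] [Module.Finite k L] [IrreducibleSpace (PrimeSpectrum (L ⊗[k] L))] :
    Function.Surjective (algebraMap k L) := by
  have : Fintype k := Fintype.ofFinite k
  have : Finite (L ⊗[k] L) := Module.finite_of_finite k
  have hsub : Subsingleton (PrimeSpectrum (L ⊗[k] L)) :=
    ⟨fun x y => (PreirreducibleSpace.isPreirreducible_univ
      (X := PrimeSpectrum (L ⊗[k] L))).subsingleton trivial trivial⟩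
  let f : L ⊗[k] L →ₐ[k] L := Algebra.TensorProduct.lift (AlgHom.id k L) (AlgHom.id k L)
    fun _ _ => Commute.all _ _
  let g : L ⊗[k] L →ₐ[k] L := Algebra.TensorProduct.lift (AlgHom.id k L)
    (FiniteField.frobeniusAlgHom k L) fun _ _ => Commute.all _ _
  have hfg : RingHom.ker f = RingHom.ker g := congrArg PrimeSpectrum.asIdeal
    (Subsingleton.elim (⟨RingHom.ker f, RingHom.ker_isPrime _⟩ : PrimeSpectrum (L ⊗[k] L))
      ⟨RingHom.ker g, RingHom.ker_isPrime _⟩)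
  have hx : ∀ x : L, x ^ Fintype.card k = x := by
    intro x
    have h : x ⊗ₜ[k] 1 - 1 ⊗ₜ[k] x ∈ RingHom.ker f := by
      simp [RingHom.mem_ker, f]
    rw [hfg] at h
    simpa [RingHom.mem_ker, g, sub_eq_zero, eq_comm] using h
  have : Finite L := Module.finite_of_finite k
  have : Fintype L := Fintype.ofFinite L
  have hne := FiniteField.X_pow_card_sub_X_ne_zero L (Fintype.one_lt_card (α := k))
  have hcard : Nat.card L ≤ Nat.card k := by
    rw [Nat.card_eq_fintype_card, Nat.card_eq_fintype_card (α := k), ← Finset.card_univ,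
      ← FiniteField.X_pow_card_sub_X_natDegree_eq L (Fintype.one_lt_card (α := k))]
    refine Polynomial.card_le_degree_of_subset_roots fun x _ => ?_
    simp [Polynomial.mem_roots hne, hx]
  exact ((algebraMap k L).injective.bijective_of_nat_card_le hcard).2

namespace PointedCurve

variable {k : Type u} [Field k] (X : PointedCurve k)

/-- The inclusion of the constants `k` into the global functions on `C`. -/
noncomputable def constants : CommRingCat.of k ⟶ Γ(X.C, ⊤) :=
  (Scheme.ΓSpecIso (CommRingCat.of k)).inv ≫ X.str.appTop

lemma toSpecΓ_comp_constants : X.C.toSpecΓ ≫ Spec.map X.constants = X.str := by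
  rw [constants, Spec.map_comp, ← Category.assoc, ← Scheme.toSpecΓ_naturality, Category.assoc,
    ← SpecMap_ΓSpecIso_hom, ← Spec.map_comp, Iso.inv_hom_id, Spec.map_id, Category.comp_id]

open TensorProduct in
/-- Since `C` is geometrically irreducible, so is the spectrum of the field `Γ(C, 𝒪_C)`: its
base change is the image of that of `C`. -/
lemma constants_surjective [Finite k] : Function.Surjective X.constants.hom := by
  let _ := (isField_of_universallyClosed k X.str).toField
  let _ := X.constants.hom.toAlgebra
  have hfin : X.constants.hom.Finite := by
    have h : X.str.appTop.hom.Finite := finite_appTop_of_universallyClosed k X.str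
    exact h.comp (RingHom.Finite.of_surjective _
      (Scheme.ΓSpecIso (CommRingCat.of k)).commRingCatIsoToRingEquiv.symm.surjective)
  have : Module.Finite k Γ(X.C, ⊤) := hfin
  have := X.geometricallyIrreducible
  let s := Spec.map X.constants
  have h1 : IrreducibleSpace ↥(pullback X.str s) :=
    pullback_of_geometrically GeometricallyIrreducible.geometrically_irreducibleSpace
      Γ(X.C, ⊤) s
  have hs : Surjective X.C.toSpecΓ := by
    have : Subsingleton (Spec Γ(X.C, ⊤)) :=
      inferInstanceAs (Subsingleton (PrimeSpectrum Γ(X.C, ⊤)))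
    exact ⟨fun y => ⟨X.pt, Subsingleton.elim _ _⟩⟩
  have h2 : Surjective (pullback.map X.str s s s X.C.toSpecΓ (𝟙 _) (𝟙 _)
      ((Category.comp_id _).trans X.toSpecΓ_comp_constants.symm)
      ((Category.comp_id _).trans (Category.id_comp _).symm)) :=
    ⟨Set.range_eq_univ.1 (by
      rw [Scheme.Pullback.range_map, Set.range_eq_univ.2 hs.surj,
        Set.range_eq_univ.2 (Scheme.Hom.surjective (𝟙 _)), Set.preimage_univ, Set.preimage_univ,
        Set.inter_univ])⟩
  let e := pullbackSpecIso k Γ(X.C, ⊤) Γ(X.C, ⊤)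
  let w : pullback X.str s ⟶ Spec (CommRingCat.of (Γ(X.C, ⊤) ⊗[k] Γ(X.C, ⊤))) :=
    pullback.map X.str s s s X.C.toSpecΓ (𝟙 _) (𝟙 _)
      ((Category.comp_id _).trans X.toSpecΓ_comp_constants.symm)
      ((Category.comp_id _).trans (Category.id_comp _).symm) ≫ e.hom
  have h3 : Surjective w := inferInstance
  have h4 : IrreducibleSpace (PrimeSpectrum (Γ(X.C, ⊤) ⊗[k] Γ(X.C, ⊤))) := by
    rw [irreducibleSpace_def]
    have := (IrreducibleSpace.isIrreducible_univ ↥(pullback X.str s)).image w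
      w.continuous.continuousOn
    rwa [Set.image_univ, Set.range_eq_univ.2 w.surjective] at this
  exact algebraMap_surjective_of_irreducibleSpace (k := k) (L := Γ(X.C, ⊤))

/-- The inclusion of the constants into `A`. -/
noncomputable def constantsRing : k →+* X.ring := X.resGlobal.comp X.constants.hom

lemma degreeFunction_constantsRing [Finite k] (r : ℕ) {t : k} (ht : t ≠ 0) :
    X.degreeFunction r (X.constantsRing t) = 0 := by
  have : Nontrivial X.ring := X.toFunctionField.domain_nontrivial
  exact X.degreeFunction_resGlobal r ((map_ne_zero X.constantsRing).2 ht)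

lemma ringMap_constantsRing {X X' : PointedCurve k} (π : X'.C ⟶ X.C) (hπ : π ≫ X.str = X'.str)
    (hpt : ∀ y : X'.C, π y = X.pt ↔ y = X'.pt) (t : k) :
    (ringMap π hpt).hom (X.constantsRing t) = X'.constantsRing t := by
  have h1 : π.appTop ≫ X'.C.presheaf.map (homOfLE (le_top : X'.affinePart ≤ ⊤)).op =
      X.C.presheaf.map (homOfLE (le_top : X.affinePart ≤ ⊤)).op ≫ ringMap π hpt :=
    (π.map_appLE _ (homOfLE (le_top : X.affinePart ≤ ⊤)).op).symm
  have h2 : X'.constants = X.constants ≫ π.appTop := by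
    rw [constants, constants, ← hπ, Scheme.Hom.comp_appTop, Category.assoc]
  have h3 : X.constants ≫ X.C.presheaf.map (homOfLE (le_top : X.affinePart ≤ ⊤)).op ≫
      ringMap π hpt =
      X'.constants ≫ X'.C.presheaf.map (homOfLE (le_top : X'.affinePart ≤ ⊤)).op := by
    rw [h2]
    exact (congrArg (X.constants ≫ ·) h1.symm).trans (Category.assoc _ _ _).symm
  exact ConcreteCategory.congr_hom h3 t

end PointedCurve
namespace PointedCurve

variable {k : Type u} [Field k] [Finite k]

/-- Elements of `A` which are regular at `∞` are global functions on `C`, hence constants. -/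
lemma exists_constantsRing_eq {X : PointedCurve k} {a : X.ring}
    (ha : IsRegularAt (X.toFunctionField a) X.pt) : ∃ t, X.constantsRing t = a := by
  obtain ⟨s, rfl⟩ := exists_resGlobal_eq ha
  obtain ⟨t, rfl⟩ := X.constants_surjective s
  exact ⟨t, rfl⟩

/-- `A'` is even a finitely generated ring as soon as it contains an element with a pole at `∞'`. -/
lemma ringMap_finiteType {X X' : PointedCurve k} (π : X'.C ⟶ X.C)
    (hpt : ∀ y : X'.C, π y = X.pt ↔ y = X'.pt) {a' : X'.ring}
    (ha' : ¬ IsRegularAt (X'.toFunctionField a') X'.pt) : (ringMap π hpt).hom.FiniteType := by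
  obtain ⟨F, hF, hcl⟩ := X'.exists_finite_closure_eq_top_of_pole ha'
  algebraize [(ringMap π hpt).hom]
  refine ⟨⟨hF.toFinset, ?_⟩⟩
  rw [Set.Finite.coe_toFinset]
  refine top_le_iff.1 fun x _ => ?_
  have hx : x ∈ Subring.closure F := hcl ▸ trivial
  exact (Subring.closure_le (t := (Algebra.adjoin X.ring F).toSubring)).2
    Algebra.subset_adjoin hx

end PointedCurve
end DrinfeldRestriction

theorem proposition2p3 {k : Type u} [Field k] [Finite k]
    (X X' : PointedCurve k)
    (π : X'.C ⟶ X.C) (hπ : π ≫ X.str = X'.str) [IsFinite π]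
    (n : ℕ) (hn : π.finrank (genericPoint X.C) = n)
    (hpt : ∀ y : X'.C, π y = X.pt ↔ y = X'.pt)
    (r' : ℕ) (hr' : 0 < r')
    (S : Scheme.{u}) (c : S ⟶ Spec X.ring) (M : ModuleScheme X.ring S)
    (hM : M.IsDrinfeld (Nat.card k) (X.degreeFunction (n * r')) c) :
    (∃ T : Over (pullback (Spec.map (PointedCurve.ringMap π hpt)) c),
      Nonempty ((tripleFunctor (PointedCurve.ringMap π hpt) (Nat.card k)
        (X'.degreeFunction r') c M).RepresentableBy T)) ∧
    ∀ T : Over (pullback (Spec.map (PointedCurve.ringMap π hpt)) c),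
      Nonempty ((tripleFunctor (PointedCurve.ringMap π hpt) (Nat.card k)
        (X'.degreeFunction r') c M).RepresentableBy T) →
      IsFinite (T.hom ≫ pullback.snd (Spec.map (PointedCurve.ringMap π hpt)) c) := by
  have hnr : 0 < n * r' := Nat.mul_pos (hn ▸ PointedCurve.finrank_pos π hpt) hr'
  by_cases h : ∃ a' : X'.ring, ¬ IsRegularAt (X'.toFunctionField a') X'.pt
  -- Some element of `A'` has a pole at `∞'`; then so does some element of `A` at `∞`.
  · obtain ⟨a', ha'⟩ := h
    obtain ⟨a, ha⟩ := PointedCurve.exists_pole π hpt ha'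
    refine representable_and_finite_of_pos X.constantsRing hM
      (fun t ht => X.degreeFunction_constantsRing _ ht) (a₀ := a) ?_
      (PointedCurve.degreeFunction_pos hnr ha) (PointedCurve.ringMap_finiteType π hpt ha')
    rintro rfl
    exact ha ⟨0, by rw [map_zero, map_zero]⟩
  -- Otherwise `A'` and `A` consist of constants, on which the degree functions vanish. (This case does
  -- not occur, by Riemann–Roch, but the assertion is immediate in it.)
  · push Not at h
    have hconst : ∀ a' : X'.ring, ∃ t, (PointedCurve.ringMap π hpt).hom (X.constantsRing t) = a' :=
      fun a' => by
        obtain ⟨t, rfl⟩ := PointedCurve.exists_constantsRing_eq (h a')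
        exact ⟨t, PointedCurve.ringMap_constantsRing π hπ hpt t⟩
    have hinj := PointedCurve.ringMap_injective π hpt
    refine representable_and_finite_of_bijective hM
      ⟨hinj, fun a' => ⟨_, (hconst a').choose_spec⟩⟩ fun a ha => ?_
    obtain ⟨t, ht⟩ := hconst ((PointedCurve.ringMap π hpt).hom a)
    obtain rfl := hinj ht
    have ht0 : t ≠ 0 := by rintro rfl; exact ha (map_zero _)
    rw [X.degreeFunction_constantsRing _ ht0, PointedCurve.ringMap_constantsRing π hπ hpt,
      X'.degreeFunction_constantsRing _ ht0]
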